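/- Graphs are finite and connected; loops and multiple edges are allowed, and a loop counts twice in the valence of its vertex. A cycle of a graph $\Gamma$ is a non-empty set of edges which, together with their ends, forms a connected $2$-regular graph. A tropical curve $C=(\Gamma,w,l)$ consists of a graph $\Gamma$, a weight function $w:V(\Gamma)\to\mathbb{Z}_{\ge 0}$ such that every vertex of weight $0$ has valence at least $3$, and a length function $l:E(\Gamma)\to\mathbb{R}_{>0}$. Its genus is $b_1(\Gamma)+|w|$, where $|w|=\sum_v w(v)$. The Jacobian $\operatorname{Jac}(C)$ is the real torus $(H_1(\Gamma,\mathbb{R})\oplus\mathbb{R}^{|w|})/(H_1(\Gamma,\mathbb{Z})\oplus\mathbb{Z}^{|w|})$ with the positive semi-definite quadratic form $Q_C$ that vanishes on $\mathbb{R}^{|w|}$ and is given on $H_1(\Gamma,\mathbb{R})$ by $Q_C\bigl(\sum_e\alpha_e e\bigr)=\sum_e\alpha_e^2\,l(e)$. Two such objects are isomorphic if there is a linear isomorphism of the underlying real vector spaces that maps one lattice onto the other and one form to the other; write $t_g^{\rm tr}(C)=t_g^{\rm tr}(C')$ if $\operatorname{Jac}(C)\cong\operatorname{Jac}(C')$.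 A C1-set of $\Gamma$ is an equivalence class of non-separating edges, two edges being equivalent if they belong to the same cycles. A $3$-edge-connectivization $C^3$ of $C$ is a tropical curve obtained by contracting all separating edges and, for each C1-set $S$, all edges of $S$ but one, $e_S$, which gets the length $\sum_{e\in S}l(e)$. (Contracting a loop raises the weight of its vertex by one; contracting any other edge adds the weights of its ends.) Two tropical curves are $2$-isomorphic if there is a length-preserving bijection between their edges that induces a bijection between their cycles; $[\,\cdot\,]_2$ denotes the $2$-isomorphism class, which ignores the weights. A graph is called $3$-connected if removing any set of at most two vertices, with the edges adjacent to them, leaves a connected graph (the empty graph counting as connected), and it has no loops unless it has only one vertex. It is $3$-edge-connected if removing any set of at most two edges leaves a connected graph. **Theorem.** Let $C=(\Gamma,w,l)$ and $C'=(\Gamma',w',l')$ be two tropical curves of genus $g$. 1. $t_g^{\rm tr}(C)=t_g^{\rm tr}(C')$ if and only if $[C^3]_2=[C'^3]_2$, for any choice of the $3$-edge-connectivizations $C^3$ and $C'^3$. 2. In particular, $t_g^{\rm tr}$ is injective on the locus of $3$-connected tropical curves of total weight zero: if $\Gamma$ and $\Gamma'$ are $3$-connected, $w=0$, $w'=0$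 and $t_g^{\rm tr}(C)=t_g^{\rm tr}(C')$, then $C\cong C'$. 3. For arbitrary weights, $t_g^{\rm tr}$ is injective up to the weights on this locus: if $\Gamma$ and $\Gamma'$ are $3$-connected and $3$-edge-connected and $t_g^{\rm tr}(C)=t_g^{\rm tr}(C')$, then the metric graphs $(\Gamma,l)$ and $(\Gamma',l')$ are isomorphic. (If there are at least four vertices, $3$-connected implies $3$-edge-connected.) -/

import Mathlib

open scoped Classical

universe u v u₁ v₁ u₂ v₂

set_option linter.checkUnivs false

/-- A finite graph, loops and multiple edges allowed. The maps `src` and `tgt` fix an orientation of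
the edges; apart from the boundary map below, every notion only uses the unordered pair of ends. -/
structure Multigraph where
  V : Type u
  E : Type v
  [fintypeV : Fintype V]
  [fintypeE : Fintype E]
  src : E → V
  tgt : E → V

namespace Multigraph

attribute [instance] fintypeV fintypeE

/-- `v` and `w` are joined by a walk all of whose edges lie in `S`. -/
def Joined (G : Multigraph.{u, v}) (S : Set G.E) : G.V → G.V → Prop :=
  Relation.EqvGen fun v w => ∃ e ∈ S, G.src e = v ∧ G.tgt e = w

def IsConnected (G : Multigraph.{u, v}) : Prop :=
  Nonempty G.V ∧ ∀ v w, G.Joined Set.univ v w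

/-- The valence of `v` in the subgraph with edge set `S`; a loop counts twice. -/
noncomputable def valenceIn (G : Multigraph.{u, v}) (S : Set G.E) (v : G.V) : ℕ :=
  (Finset.univ.filter fun e => e ∈ S ∧ G.src e = v).card +
    (Finset.univ.filter fun e => e ∈ S ∧ G.tgt e = v).card

noncomputable def valence (G : Multigraph.{u, v}) (v : G.V) : ℕ :=
  G.valenceIn Set.univ v

/-- `S` is the edge set of a cycle: together with the ends of its edges it is a non-empty connected
`2`-regular graph. -/
def IsCycle (G : Multigraph.{u, v}) (S : Set G.E) : Prop :=
  S.Nonempty ∧ (∀ v, G.valenceIn S v = 0 ∨ G.valenceIn S v = 2) ∧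
    ∀ v w, G.valenceIn S v = 2 → G.valenceIn S w = 2 → G.Joined S v w

/-- Removing the edge `e` disconnects the graph. -/
def IsSeparating (G : Multigraph.{u, v}) (e : G.E) : Prop :=
  ∃ v w, ¬ G.Joined {e}ᶜ v w

/-- The non-separating edges that belong to the same cycles as `e`. -/
def c1Class (G : Multigraph.{u, v}) (e : G.E) : Set G.E :=
  {f | ¬ G.IsSeparating f ∧ ∀ S, G.IsCycle S → (e ∈ S ↔ f ∈ S)}

def IsC1Set (G : Multigraph.{u, v}) (S : Set G.E) : Prop :=
  ∃ e, ¬ G.IsSeparating e ∧ S = G.c1Class e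

/-- `R` consists of non-separating edges, exactly one from each C1-set: these are the edges kept by a
`3`-edge-connectivization, and all the others are contracted. -/
def IsC1Transversal (G : Multigraph.{u, v}) (R : Set G.E) : Prop :=
  (∀ e ∈ R, ¬ G.IsSeparating e) ∧ ∀ S, G.IsC1Set S → ∃! e, e ∈ S ∧ e ∈ R

theorem exists_isC1Transversal (G : Multigraph.{u, v}) : ∃ R, G.IsC1Transversal R := by
  let r : Setoid {e : G.E // ¬ G.IsSeparating e} :=
    { r := fun e f => ∀ S, G.IsCycle S → (e.1 ∈ S ↔ f.1 ∈ S)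
      iseqv := ⟨fun _ _ _ => Iff.rfl, fun h S hS => (h S hS).symm,
        fun h k S hS => (h S hS).trans (k S hS)⟩ }
  refine ⟨{e | ∃ q : Quotient r, q.out.1 = e}, ?_, ?_⟩
  · rintro e ⟨q, rfl⟩
    exact q.out.2
  · rintro S ⟨e, he, rfl⟩
    let q : Quotient r := Quotient.mk r ⟨e, he⟩
    refine ⟨q.out.1, ⟨⟨q.out.2, ?_⟩, q, rfl⟩, ?_⟩
    · exact r.symm (Quotient.mk_out (s := r) ⟨e, he⟩)
    · rintro f ⟨⟨hf, hef⟩, p, rfl⟩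
      have : q = p := by
        rw [← Quotient.out_eq p]
        exact Quotient.sound (s := r) hef
      rw [this]

/-- Two vertices are identified when the edges in `T` are contracted. -/
def contractSetoid (G : Multigraph.{u, v}) (T : Set G.E) : Setoid G.V :=
  Relation.EqvGen.setoid fun v w => ∃ e ∈ T, G.src e = v ∧ G.tgt e = w

/-- The graph obtained by contracting all the edges that are not in `R`. -/
noncomputable def contractTo (G : Multigraph.{u, v}) (R : Set G.E) : Multigraph.{u, v} where
  V := Quotient (G.contractSetoid Rᶜ)
  E := R
  src e := Quotient.mk _ (G.src e)
  tgt e := Quotient.mk _ (G.tgt e)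

/-- The boundary map `C₁(Γ, A) → C₀(Γ, A)`, `e ↦ t(e) - s(e)`. -/
noncomputable def boundary (G : Multigraph.{u, v}) (A : Type) [CommRing A] :
    (G.E → A) →ₗ[A] (G.V → A) where
  toFun c v := (∑ e with G.tgt e = v, c e) - ∑ e with G.src e = v, c e
  map_add' c d := by
    funext v
    simp only [Pi.add_apply, Finset.sum_add_distrib]
    ring
  map_smul' a c := by
    funext v
    simp only [Pi.smul_apply, smul_eq_mul, ← Finset.mul_sum, RingHom.id_apply]
    ring

/-- The first homology group `H₁(Γ, A)`. -/
noncomputable def homology (G : Multigraph.{u, v}) (A : Type) [CommRing A] :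
    Submodule A (G.E → A) :=
  LinearMap.ker (G.boundary A)

/-- The genus (first Betti number) of a graph. -/
noncomputable def genus (G : Multigraph.{u, v}) : ℕ :=
  Module.finrank ℝ (G.homology ℝ)

/-- Removing any set of at most two edges leaves a connected graph. -/
def IsThreeEdgeConnected (G : Multigraph.{u, v}) : Prop :=
  ∀ F : Set G.E, F.ncard ≤ 2 → ∀ v w, G.Joined Fᶜ v w

/-- Removing any set of at most two vertices, with the edges adjacent to them, leaves a connected
graph (the empty graph counting as connected), and there are no loops unless there is only one
vertex. -/
def IsThreeConnected (G : Multigraph.{u, v}) : Prop :=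
  (∀ X : Set G.V, X.ncard ≤ 2 → ∀ v w, v ∉ X → w ∉ X →
      G.Joined {e | G.src e ∉ X ∧ G.tgt e ∉ X} v w) ∧
    ((∀ e, G.src e ≠ G.tgt e) ∨ Subsingleton G.V)

end Multigraph

/-- A tropical curve `(Γ, w, l)`: a finite connected graph with a weight function on the vertices that
makes it stable, and a positive length function on the edges. -/
structure TropicalCurve extends Multigraph.{u, v} where
  connected : toMultigraph.IsConnected
  weight : V → ℕ
  stable : ∀ v, weight v = 0 → 3 ≤ toMultigraph.valence v
  length : E → ℝ
  length_pos : ∀ e, 0 < length e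

namespace TropicalCurve

noncomputable def totalWeight (C : TropicalCurve.{u, v}) : ℕ := ∑ v, C.weight v

noncomputable def genus (C : TropicalCurve.{u, v}) : ℕ := C.toMultigraph.genus + C.totalWeight

/-- The weight function after the edges outside `R` are contracted. A vertex `q` of the contracted
graph stands for a connected subgraph of contracted edges, with `n` vertices and `m` edges; contracting
non-loops adds weights and contracting a loop adds `1`, so `q` gets the sum of the weights of these
vertices plus the first Betti number `1 + m - n`. -/
noncomputable def contractWeight (C : TropicalCurve.{u, v}) (R : Set C.E)
    (q : (C.toMultigraph.contractTo R).V) : ℕ :=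
  (∑ v with Quotient.mk (C.contractSetoid Rᶜ) v = q, C.weight v) +
    (1 + (Finset.univ.filter fun e => e ∉ R ∧
        Quotient.mk (C.contractSetoid Rᶜ) (C.src e) = q).card -
      (Finset.univ.filter fun v => Quotient.mk (C.contractSetoid Rᶜ) v = q).card)

theorem mk_src_eq_mk_tgt (C : TropicalCurve.{u, v}) (R : Set C.E) (e : C.E) (he : e ∉ R) :
    Quotient.mk (C.contractSetoid Rᶜ) (C.src e) = Quotient.mk (C.contractSetoid Rᶜ) (C.tgt e) :=
  Quotient.sound (s := C.contractSetoid Rᶜ) (Relation.EqvGen.rel _ _ ⟨e, he, rfl, rfl⟩)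

theorem contract_stable (C : TropicalCurve.{u, v}) (R : Set C.E)
    (q : (C.toMultigraph.contractTo R).V) (hq : C.contractWeight R q = 0) :
    3 ≤ (C.toMultigraph.contractTo R).valence q := by
  set k : C.V → (C.toMultigraph.contractTo R).V := Quotient.mk (C.contractSetoid Rᶜ) with hk
  have hq' : (∑ v with k v = q, C.weight v) +
    (1 + (Finset.univ.filter fun e => e ∉ R ∧ k (C.src e) = q).card -
      (Finset.univ.filter fun v => k v = q).card) = 0 := hq
  obtain ⟨h0, h1⟩ := Nat.add_eq_zero_iff.1 hq'
  have hne : 0 < (Finset.univ.filter fun v => k v = q).card := by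
    obtain ⟨v, hv⟩ := Quotient.exists_rep q
    exact Finset.card_pos.2 ⟨v, Finset.mem_filter.2 ⟨Finset.mem_univ _, hv⟩⟩
  have hval : 3 * (Finset.univ.filter fun v => k v = q).card ≤
      ∑ v with k v = q, C.toMultigraph.valence v := by
    rw [mul_comm, ← smul_eq_mul]
    refine Finset.card_nsmul_le_sum _ _ _ fun v hv => C.stable v ?_
    exact (Finset.sum_eq_zero_iff.1 h0) v hv
  have key : ∀ f : C.E → C.V,
      ∑ v with k v = q, (Finset.univ.filter fun e => e ∈ (Set.univ : Set C.E) ∧ f e = v).card =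
        (Finset.univ.filter fun e => k (f e) = q).card := by
    intro f
    rw [Finset.card_eq_sum_card_fiberwise (f := f) (t := Finset.univ.filter fun v => k v = q)
      (fun e he => by simpa using he)]
    refine Finset.sum_congr rfl fun v hv => ?_
    congr 1
    ext e
    simp only [Finset.mem_filter, Finset.mem_univ, true_and, Set.mem_univ] at hv ⊢
    constructor
    · rintro rfl
      exact ⟨hv, rfl⟩
    · exact fun h => h.2
  have hsum : ∑ v with k v = q, C.toMultigraph.valence v =
      (Finset.univ.filter fun e => k (C.src e) = q).card +
        (Finset.univ.filter fun e => k (C.tgt e) = q).card := by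
    simp only [Multigraph.valence, Multigraph.valenceIn, Finset.sum_add_distrib]
    refine congrArg₂ _ ?_ ?_
    · convert key C.src
    · convert key C.tgt
  have split : ∀ f : C.E → C.V, (Finset.univ.filter fun e => k (f e) = q).card =
      (Finset.univ.filter fun e => e ∉ R ∧ k (f e) = q).card +
        (Finset.univ.filter fun e : R => e ∈ (Set.univ : Set R) ∧ k (f e) = q).card := by
    intro f
    rw [← Finset.card_filter_add_card_filter_not (s := Finset.univ.filter fun e => k (f e) = q)
      (fun e => e ∉ R)]
    congr 1
    · rw [Finset.filter_filter]
      congr 1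
      ext e
      simp [and_comm]
    · symm
      refine Finset.card_bij (fun e _ => e.1) ?_ ?_ ?_
      · rintro ⟨e, he⟩ h
        simpa [he] using h
      · intro a _ b _ h
        exact Subtype.ext h
      · intro e he
        simp only [Finset.mem_filter, Finset.mem_univ, true_and, not_not] at he
        exact ⟨⟨e, he.2⟩, by simpa using he.1, rfl⟩
  have htgt : (Finset.univ.filter fun e => e ∉ R ∧ k (C.tgt e) = q).card =
      (Finset.univ.filter fun e => e ∉ R ∧ k (C.src e) = q).card := by
    congr 1
    ext e
    simp only [Finset.mem_filter, Finset.mem_univ, true_and]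
    refine and_congr_right fun he => ?_
    rw [hk, C.mk_src_eq_mk_tgt R e he]
  have s1 := split C.src
  have s2 := split C.tgt
  have goal : (C.toMultigraph.contractTo R).valence q =
      (Finset.univ.filter fun e : R => e ∈ (Set.univ : Set R) ∧ k (C.src e) = q).card +
        (Finset.univ.filter fun e : R => e ∈ (Set.univ : Set R) ∧ k (C.tgt e) = q).card := by
    simp only [Multigraph.valence, Multigraph.valenceIn]
    congr!
    · rename_i h
      exact congrArg (fun x : R => k (C.src x)) (eq_of_heq h)
    · rename_i h
      exact congrArg (fun x : R => k (C.tgt x)) (eq_of_heq h)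
  omega

theorem contract_connected (C : TropicalCurve.{u, v}) (R : Set C.E) :
    (C.toMultigraph.contractTo R).IsConnected := by
  obtain ⟨⟨v₀⟩, h⟩ := C.connected
  refine ⟨⟨Quotient.mk _ v₀⟩, ?_⟩
  have : ∀ v w, C.Joined Set.univ v w → (C.toMultigraph.contractTo R).Joined Set.univ
      (Quotient.mk (C.contractSetoid Rᶜ) v) (Quotient.mk (C.contractSetoid Rᶜ) w) := by
    intro v w hvw
    induction hvw with
    | rel v w h =>
      obtain ⟨e, -, rfl, rfl⟩ := h
      by_cases he : e ∈ R
      · exact Relation.EqvGen.rel _ _ ⟨⟨e, he⟩, Set.mem_univ _, rfl, rfl⟩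
      · rw [C.mk_src_eq_mk_tgt R e he]
        exact Relation.EqvGen.refl _
    | refl v => exact Relation.EqvGen.refl _
    | symm v w _ ih => exact Relation.EqvGen.symm _ _ ih
    | trans a b c _ _ ih₁ ih₂ => exact Relation.EqvGen.trans _ _ _ ih₁ ih₂
  intro p q
  obtain ⟨v, rfl⟩ := Quotient.exists_rep p
  obtain ⟨w, rfl⟩ := Quotient.exists_rep q
  exact this v w (h v w)

/-- The `3`-edge-connectivization of `C` in which the edges of `R` are kept. The length of a kept edge
is the sum of the lengths of the edges in its C1-set. -/
noncomputable def threeEdgeConnectivization (C : TropicalCurve.{u, v}) (R : Set C.E)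
    (hR : C.toMultigraph.IsC1Transversal R) : TropicalCurve.{u, v} where
  toMultigraph := C.toMultigraph.contractTo R
  connected := C.contract_connected R
  weight := C.contractWeight R
  stable := C.contract_stable R
  length e := ∑ f with f ∈ C.c1Class e.1, C.length f
  length_pos e := Finset.sum_pos (fun f _ => C.length_pos f)
    ⟨e.1, by simpa using ⟨hR.1 e.1 e.2, fun _ _ => Iff.rfl⟩⟩

/-- `C ≡₂ C'`: a length-preserving bijection of the edges that induces a bijection of the cycles. -/
def TwoIsomorphic (C : TropicalCurve.{u₁, v₁}) (C' : TropicalCurve.{u₂, v₂}) : Prop :=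
  ∃ φ : C.E ≃ C'.E, (∀ e, C'.length (φ e) = C.length e) ∧
    ∀ S : Set C.E, C.toMultigraph.IsCycle S ↔ C'.toMultigraph.IsCycle (φ '' S)

/-- The underlying metric graphs are isomorphic through `φ` on the edges and `ψ` on the vertices. -/
def IsMetricIso (C : TropicalCurve.{u₁, v₁}) (C' : TropicalCurve.{u₂, v₂})
    (φ : C.E ≃ C'.E) (ψ : C.V ≃ C'.V) : Prop :=
  (∀ e, s(C'.src (φ e), C'.tgt (φ e)) = s(ψ (C.src e), ψ (C.tgt e))) ∧
    ∀ e, C'.length (φ e) = C.length e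

/-- `(Γ, l)` and `(Γ', l')` are isomorphic metric graphs; the weights are ignored. -/
def MetricIsomorphic (C : TropicalCurve.{u₁, v₁}) (C' : TropicalCurve.{u₂, v₂}) : Prop :=
  ∃ φ ψ, IsMetricIso C C' φ ψ

/-- `C` and `C'` are isomorphic tropical curves. -/
def Isomorphic (C : TropicalCurve.{u₁, v₁}) (C' : TropicalCurve.{u₂, v₂}) : Prop :=
  ∃ φ ψ, IsMetricIso C C' φ ψ ∧ ∀ v, C'.weight (ψ v) = C.weight v

end TropicalCurve

/-- A (principally polarized) tropical abelian variety: the real torus `W / Λ` with a positive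
semi-definite quadratic form on `W` whose null space is rational with respect to `Λ`. -/
structure TropicalAbelianVariety where
  W : Type u
  [addCommGroup : AddCommGroup W]
  [module : Module ℝ W]
  lattice : Submodule ℤ W
  isLattice : ∃ (n : ℕ) (b : Module.Basis (Fin n) ℝ W), lattice = Submodule.span ℤ (Set.range b)
  form : QuadraticForm ℝ W
  form_nonneg : ∀ x, 0 ≤ form x
  null_rational : ∀ x, form x = 0 → x ∈ Submodule.span ℝ {y | y ∈ lattice ∧ form y = 0}

namespace TropicalAbelianVariety

attribute [instance] addCommGroup module

noncomputable def dim (A : TropicalAbelianVariety.{u}) : ℕ := Module.finrank ℝ A.W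

def Isomorphic (A : TropicalAbelianVariety.{u₁}) (B : TropicalAbelianVariety.{u₂}) : Prop :=
  ∃ h : A.W ≃ₗ[ℝ] B.W, (∀ x, h x ∈ B.lattice ↔ x ∈ A.lattice) ∧ ∀ x, B.form (h x) = A.form x

end TropicalAbelianVariety

namespace TropicalCurve

/-- The vector space `H₁(Γ, ℝ) ⊕ ℝ^{|w|}`. -/
abbrev JacSpace (C : TropicalCurve.{u, v}) : Type v :=
  C.toMultigraph.homology ℝ × (Fin C.totalWeight → ℝ)

/-- The subgroup `H₁(Γ, ℤ) ⊕ ℤ^{|w|}`. -/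
noncomputable def jacLattice (C : TropicalCurve.{u, v}) : Submodule ℤ C.JacSpace where
  carrier := {x | (∃ z ∈ C.toMultigraph.homology ℤ, ∀ e, x.1.1 e = (z e : ℝ)) ∧
    ∃ m : Fin C.totalWeight → ℤ, ∀ i, x.2 i = (m i : ℝ)}
  add_mem' := by
    rintro x y ⟨⟨z, hz, hxz⟩, m, hm⟩ ⟨⟨z', hz', hxz'⟩, m', hm'⟩
    exact ⟨⟨z + z', add_mem hz hz', fun e => by simp [hxz, hxz']⟩,
      m + m', fun i => by simp [hm, hm']⟩
  zero_mem' := ⟨⟨0, zero_mem _, fun e => by simp⟩, 0, fun i => by simp⟩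
  smul_mem' := by
    rintro k x ⟨⟨z, hz, hxz⟩, m, hm⟩
    exact ⟨⟨k • z, Submodule.smul_mem _ _ hz, fun e => by simp [hxz]⟩,
      k • m, fun i => by simp [hm]⟩

/-- The form `∑ αₑ e ↦ ∑ αₑ² l(e)` on `H₁(Γ, ℝ)`, extended by zero to `ℝ^{|w|}`. -/
noncomputable def jacForm (C : TropicalCurve.{u, v}) : QuadraticForm ℝ C.JacSpace :=
  (QuadraticMap.weightedSumSquares ℝ C.length).comp
    ((C.toMultigraph.homology ℝ).subtype ∘ₗ LinearMap.fst ℝ _ _)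

theorem jacForm_apply (C : TropicalCurve.{u, v}) (x : C.JacSpace) :
    C.jacForm x = ∑ e, x.1.1 e ^ 2 * C.length e := by
  simp [jacForm, QuadraticMap.weightedSumSquares_apply, pow_two, mul_comm]

theorem homology_mem_span (G : Multigraph.{u, v}) (c : G.E → ℝ) (hc : c ∈ G.homology ℝ) :
    c ∈ Submodule.span ℝ {d : G.E → ℝ | ∃ z ∈ G.homology ℤ, ∀ e, d e = (z e : ℝ)} := by
  set S := Submodule.span ℝ {d : G.E → ℝ | ∃ z ∈ G.homology ℤ, ∀ e, d e = (z e : ℝ)}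
  let b := Module.Basis.ofVectorSpace ℚ ℝ
  have hrat : ∀ q : G.E → ℚ, (∀ v, (∑ e with G.tgt e = v, q e) - ∑ e with G.src e = v, q e = 0) →
      (fun e => (q e : ℝ)) ∈ S := by
    intro q hq
    obtain ⟨d, hd⟩ := IsLocalization.exist_integer_multiples (nonZeroDivisors ℤ) Finset.univ q
    have hd0 : ((d : ℤ) : ℚ) ≠ 0 := by
      exact_mod_cast nonZeroDivisors.coe_ne_zero d
    choose z hz using fun e => hd e (Finset.mem_univ e)
    have hz' : ∀ e, (z e : ℚ) = (d : ℤ) * q e := by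
      intro e
      have := hz e
      simpa [Submonoid.smul_def] using this
    have hmem : (fun e => (z e : ℝ)) ∈ S := by
      refine Submodule.subset_span ⟨z, ?_, fun e => rfl⟩
      rw [Multigraph.homology, LinearMap.mem_ker]
      funext v
      have h : (((∑ e with G.tgt e = v, z e) - ∑ e with G.src e = v, z e : ℤ) : ℚ) = 0 := by
        push_cast
        simp only [hz']
        rw [← Finset.mul_sum, ← Finset.mul_sum, ← mul_sub, hq v, mul_zero]
      exact_mod_cast h
    have : (fun e => (q e : ℝ)) = ((d : ℤ) : ℝ)⁻¹ • fun e => (z e : ℝ) := by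
      funext e
      have h1 : (z e : ℝ) = ((d : ℤ) : ℝ) * (q e : ℝ) := by exact_mod_cast hz' e
      have h2 : ((d : ℤ) : ℝ) ≠ 0 := by exact_mod_cast hd0
      simp only [Pi.smul_apply, smul_eq_mul, h1]
      field_simp
    rw [this]
    exact S.smul_mem _ hmem
  let J := Finset.univ.biUnion fun e => (b.repr (c e)).support
  have hdec : c = ∑ j ∈ J, (b j) • fun e => ((b.repr (c e) j : ℚ) : ℝ) := by
    funext e
    have h1 := b.linearCombination_repr (c e)
    rw [Finsupp.linearCombination_apply, Finsupp.sum_of_support_subset (s := J) _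
      (Finset.subset_biUnion_of_mem (fun e => (b.repr (c e)).support) (Finset.mem_univ e)) _
      (by simp)] at h1
    rw [Finset.sum_apply]
    conv_lhs => rw [← h1]
    refine Finset.sum_congr rfl fun j _ => ?_
    simp [Algebra.smul_def, mul_comm]
  rw [hdec]
  refine S.sum_mem fun j _ => S.smul_mem _ (hrat _ fun v => ?_)
  have hv : (∑ e with G.tgt e = v, c e) - ∑ e with G.src e = v, c e = 0 := by
    have := congrFun (LinearMap.mem_ker.1 hc) v
    simpa [Multigraph.boundary] using this
  have := congrArg (fun x => b.repr x j) hv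
  simpa [map_sub, map_sum, Finsupp.finsetSum_apply] using this

theorem span_jacLattice (C : TropicalCurve.{u, v}) :
    Submodule.span ℝ (C.jacLattice : Set C.JacSpace) = ⊤ := by
  set L := Submodule.span ℝ (C.jacLattice : Set C.JacSpace)
  have h1 : ∀ (c : C.E → ℝ) (hc : c ∈ C.toMultigraph.homology ℝ),
      ((⟨c, hc⟩, 0) : C.JacSpace) ∈ L := by
    have hle : Submodule.span ℝ {d : C.E → ℝ | ∃ z ∈ C.toMultigraph.homology ℤ, ∀ e, d e = (z e : ℝ)} ≤
        (L.comap (LinearMap.inl ℝ _ _)).map (C.toMultigraph.homology ℝ).subtype := by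
      refine Submodule.span_le.2 ?_
      rintro d ⟨z, hz, hd⟩
      have hdm : d ∈ C.toMultigraph.homology ℝ := by
        rw [Multigraph.homology, LinearMap.mem_ker]
        funext v
        have hv := congrFun (LinearMap.mem_ker.1 hz) v
        have hv' : (∑ e with C.tgt e = v, z e) - ∑ e with C.src e = v, z e = 0 := by
          simpa [Multigraph.boundary] using hv
        have : (∑ e with C.tgt e = v, d e) - ∑ e with C.src e = v, d e = 0 := by
          simp only [hd]
          exact_mod_cast hv'
        simpa [Multigraph.boundary] using this
      refine ⟨⟨d, hdm⟩, ?_, rfl⟩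
      exact Submodule.subset_span ⟨⟨z, hz, hd⟩, 0, fun i => by simp⟩
    intro c hc
    obtain ⟨x, hx, hxc⟩ := hle (homology_mem_span C.toMultigraph c hc)
    have : x = ⟨c, hc⟩ := Subtype.ext hxc
    rw [← this]
    exact hx
  have h2 : ∀ i, ((0, Pi.single i 1) : C.JacSpace) ∈ L := by
    intro i
    refine Submodule.subset_span ⟨⟨0, zero_mem _, fun e => by simp⟩, Pi.single i 1, fun j => ?_⟩
    by_cases hj : j = i
    · subst hj
      simp
    · simp [hj]
  refine eq_top_iff.2 ?_
  rintro ⟨⟨c, hc⟩, y⟩ -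
  have : ((⟨c, hc⟩, y) : C.JacSpace) =
      ((⟨c, hc⟩, 0) : C.JacSpace) + ∑ i, y i • ((0, Pi.single i 1) : C.JacSpace) := by
    refine Prod.ext ?_ ?_
    · simp [Prod.fst_sum]
    · funext j
      simp [Prod.snd_sum, Finset.sum_apply, Pi.single_apply]
  rw [this]
  exact L.add_mem (h1 c hc) (L.sum_mem fun i _ => L.smul_mem _ (h2 i))

theorem jacLattice_isLattice (C : TropicalCurve.{u, v}) :
    ∃ (n : ℕ) (b : Module.Basis (Fin n) ℝ C.JacSpace),
      C.jacLattice = Submodule.span ℤ (Set.range b) := by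
  have hd : DiscreteTopology C.jacLattice := by
    refine discreteTopology_of_isOpen_singleton_zero ?_
    rw [Metric.isOpen_iff]
    rintro _ rfl
    refine ⟨1, one_pos, ?_⟩
    rintro ⟨x, ⟨z, hz, hxz⟩, m, hm⟩ hx
    rw [mem_ball_zero_iff] at hx
    have hx' : ‖x‖ < 1 := hx
    rw [Prod.norm_def, max_lt_iff] at hx'
    have hint : ∀ k : ℤ, ‖(k : ℝ)‖ < 1 → k = 0 := by
      intro k hk
      rw [Real.norm_eq_abs] at hk
      exact Int.abs_lt_one_iff.1 (by exact_mod_cast hk)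
    refine Subtype.ext (Prod.ext (Subtype.ext (funext fun e => ?_)) (funext fun i => ?_))
    · have h1 : ‖x.1.1 e‖ < 1 := (norm_le_pi_norm x.1.1 e).trans_lt hx'.1
      rw [hxz] at h1
      simpa [hint _ h1] using hxz e
    · have h1 : ‖x.2 i‖ < 1 := (norm_le_pi_norm x.2 i).trans_lt hx'.2
      rw [hm] at h1
      simpa [hint _ h1] using hm i
  have hz : IsZLattice ℝ C.jacLattice := ⟨C.span_jacLattice⟩
  have := ZLattice.module_free ℝ C.jacLattice
  have := ZLattice.module_finite ℝ C.jacLattice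
  let b := Module.finBasis ℤ C.jacLattice
  exact ⟨_, b.ofZLatticeBasis ℝ C.jacLattice, (b.ofZLatticeBasis_span ℝ C.jacLattice).symm⟩

theorem jac_null_rational (C : TropicalCurve.{u, v}) (x : C.JacSpace) (hx : C.jacForm x = 0) :
    x ∈ Submodule.span ℝ {y | y ∈ C.jacLattice ∧ C.jacForm y = 0} := by
  have h0 : x.1 = 0 := by
    rw [jacForm_apply, Finset.sum_eq_zero_iff_of_nonneg
      fun e _ => mul_nonneg (sq_nonneg _) (C.length_pos e).le] at hx
    refine Subtype.ext (funext fun e => ?_)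
    have := hx e (Finset.mem_univ e)
    simpa [(C.length_pos e).ne'] using this
  have hsum : x = ∑ i, x.2 i • ((0, Pi.single i 1) : C.JacSpace) := by
    refine Prod.ext ?_ ?_
    · simp [Prod.fst_sum, h0]
    · funext j
      simp [Prod.snd_sum, Finset.sum_apply, Pi.single_apply]
  rw [hsum]
  refine Submodule.sum_mem _ fun i _ => Submodule.smul_mem _ _ (Submodule.subset_span ⟨?_, ?_⟩)
  · refine ⟨⟨0, zero_mem _, fun e => by simp⟩, Pi.single i 1, fun j => ?_⟩
    by_cases hj : j = i
    · subst hj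
      simp
    · simp [hj]
  · rw [jacForm_apply]
    simp

/-- The Jacobian of a tropical curve. -/
noncomputable def jacobian (C : TropicalCurve.{u, v}) : TropicalAbelianVariety.{v} where
  W := C.JacSpace
  lattice := C.jacLattice
  isLattice := C.jacLattice_isLattice
  form := C.jacForm
  form_nonneg x := by
    rw [jacForm_apply]
    exact Finset.sum_nonneg fun e _ => mul_nonneg (sq_nonneg _) (C.length_pos e).le
  null_rational := C.jac_null_rational

theorem dim_jacobian (C : TropicalCurve.{u, v}) : C.jacobian.dim = C.genus := by
  change Module.finrank ℝ C.JacSpace = _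
  simp [JacSpace, genus, Multigraph.genus]

end TropicalCurve

/-!
The elements of `H_1` are called flows here: chains on the edges whose boundary vanishes at every
vertex. Contracted edges form a forest, so restriction identifies the flows of a graph with those of
its `3`-edge-connectivization, integral flows included (`exists_restrict_equiv`), and on a C1-set
the square of the value of a flow is constant (`sq_eq_of_mem_c1Class`). Hence the curve and its
`3`-edge-connectivization carry the same quadratic form.

*The Jacobian determines the `3`-edge-connectivization up to `2`-isomorphism.* The null space of the
form is the weight part, so an isomorphism of Jacobians induces an isometry of the lattices of
integral flows. A flow modulo `2` is a disjoint union of cycles, so it lifts to an integral flow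
with values `0, ±1` (`exists_isOrientation_support`). Therefore the minimum of the form on the class
of `z` modulo `2` is the total length of the edges at which `z` is odd, and this length is an
invariant of the isometry class (`length_odd_eq_of_isometry`). As a function of `z` it is, up to a
constant, a linear combination of the characters `(-1) ^ z e` with the lengths of the edges as
coefficients. Two nonseparating edges give the same character exactly if they lie in the same
C1-set, and a separating edge gives the trivial one, so by linear independence of characters
(`sum_length_parityChar_eq`) the isometry matches the C1-sets and their total lengths, compatibly
with flows modulo `2`. The cycles are the minimal supports of these (`isCycle_iff_minimal`).

*Conversely*, a bijection of edges that preserves cycles preserves flows up to signs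
(`exists_signs_of_isCycle_iff`). Orient the fundamental cycles of a maximal forest and those of its
image: on each edge of a fundamental cycle the two orientations agree up to a sign, and these signs
have to be corrected by changing signs of cycles and of edges. In the bipartite graph of fundamental
cycles and forest edges, this is possible as soon as the product of the signs along every induced
cycle is `1` (`exists_switching`, by induction on the cycles and a shortest path argument), and that
holds because the odd part of a sum of fundamental cycles can again be oriented.

*Injectivity.* If the graph is `3`-edge-connected, then every C1-set is a single edge, and the above
is a length-preserving bijection of the edges that respects flows modulo `2`. If the graph is also
`3`-connected with at least two vertices, its stars are exactly the minimal cuts whose complement is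
connected in a sense that refers to flows alone (`IsNonseparatingCut`). The bijection thus maps
stars to stars, which is Whitney's theorem in the case of `3`-connected graphs
(`exists_vertex_equiv_of_flows`). For total weight zero all valences are at least `3`, and then
`3`-connected graphs are `3`-edge-connected (`IsThreeConnected.isThreeEdgeConnected`).
-/

namespace Multigraph

/-! ### Flows, chains and the boundary map -/

section Flows

variable (G : Multigraph.{u, v}) (A : Type) [CommRing A]

theorem boundary_apply (c : G.E → A) (w : G.V) :
    G.boundary A c w = (∑ e with G.tgt e = w, c e) - ∑ e with G.src e = w, c e := rfl

theorem sum_mul_boundary (c : G.E → A) (f : G.V → A) :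
    ∑ w, f w * G.boundary A c w = ∑ e, (f (G.tgt e) - f (G.src e)) * c e := by
  have key : ∀ p : G.E → G.V, ∑ w, f w * ∑ e with p e = w, c e = ∑ e, f (p e) * c e := by
    intro p
    rw [← Finset.sum_fiberwise (s := Finset.univ) (g := p)]
    refine Finset.sum_congr rfl fun w _ => ?_
    rw [Finset.mul_sum]
    refine Finset.sum_congr rfl fun e he => ?_
    rw [(Finset.mem_filter.1 he).2]
  simp only [boundary_apply, mul_sub, Finset.sum_sub_distrib, sub_mul, key]

theorem mem_homology_iff (c : G.E → A) :
    c ∈ G.homology A ↔ ∀ w, G.boundary A c w = 0 := by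
  rw [homology, LinearMap.mem_ker]
  exact funext_iff

/-- A chain is a flow if and only if it is orthogonal to all coboundaries. -/
theorem mem_homology_iff_pairing (c : G.E → A) :
    c ∈ G.homology A ↔ ∀ f : G.V → A, ∑ e, (f (G.tgt e) - f (G.src e)) * c e = 0 := by
  rw [mem_homology_iff]
  constructor
  · intro h f
    rw [← sum_mul_boundary]
    simp [h]
  · intro h w
    have := h (Pi.single w 1)
    rw [← sum_mul_boundary] at this
    simpa [Pi.single_apply] using this

theorem boundary_single (e : G.E) :
    G.boundary A (Pi.single e 1) = Pi.single (G.tgt e) 1 - Pi.single (G.src e) 1 := by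
  funext w
  simp only [boundary_apply, Pi.sub_apply, Pi.single_apply, Finset.sum_ite_eq', Finset.mem_filter,
    Finset.mem_univ, true_and]
  simp only [eq_comm]

variable {G} in
theorem Joined.exists_chain {S : Set G.E} {a b : G.V} (h : G.Joined S a b) :
    ∃ c : G.E → A, (∀ e ∉ S, c e = 0) ∧
      G.boundary A c = Pi.single b 1 - Pi.single a 1 := by
  induction h with
  | rel a b h =>
    obtain ⟨e, he, rfl, rfl⟩ := h
    refine ⟨Pi.single e 1, fun f hf => ?_, G.boundary_single A e⟩
    rw [Pi.single_eq_of_ne]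
    rintro rfl
    exact hf he
  | refl a => exact ⟨0, fun _ _ => rfl, by simp⟩
  | symm a b _ ih =>
    obtain ⟨c, hc, hb⟩ := ih
    exact ⟨-c, fun e he => by simp [hc e he], by rw [map_neg, hb, neg_sub]⟩
  | trans a b d _ _ ih₁ ih₂ =>
    obtain ⟨c, hc, hb⟩ := ih₁
    obtain ⟨c', hc', hb'⟩ := ih₂
    exact ⟨c + c', fun e he => by simp [hc e he, hc' e he], by rw [map_add, hb, hb']; abel⟩

variable {G} in
theorem Joined.of_edge {S : Set G.E} {e : G.E} (he : e ∈ S) : G.Joined S (G.src e) (G.tgt e) :=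
  Relation.EqvGen.rel _ _ ⟨e, he, rfl, rfl⟩

variable {G} in
theorem Joined.symm {S : Set G.E} {a b : G.V} (h : G.Joined S a b) : G.Joined S b a :=
  Relation.EqvGen.symm _ _ h

variable {G} in
theorem Joined.trans {S : Set G.E} {a b c : G.V} (h : G.Joined S a b) (h' : G.Joined S b c) :
    G.Joined S a c :=
  Relation.EqvGen.trans _ _ _ h h'

variable {G} in
/-- A vertex property that is invariant along the edges of `S` is invariant under `Joined S`. -/
theorem Joined.iff_of_forall_edge {S : Set G.E} {P : G.V → Prop}
    (hP : ∀ e ∈ S, P (G.src e) ↔ P (G.tgt e)) {a b : G.V} (h : G.Joined S a b) : P a ↔ P b := by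
  induction h with
  | rel a b h =>
    obtain ⟨e, he, rfl, rfl⟩ := h
    exact hP e he
  | refl a => exact Iff.rfl
  | symm a b _ ih => exact ih.symm
  | trans a b d _ _ ih₁ ih₂ => exact ih₁.trans ih₂

variable {G A} in
theorem joined_src_tgt_of_flow {c : G.E → A} (hc : c ∈ G.homology A) {e : G.E}
    (he : c e ≠ 0) : G.Joined {e}ᶜ (G.src e) (G.tgt e) := by
  by_contra hj
  have h := (G.mem_homology_iff_pairing A c).1 hc
    fun w => if G.Joined {e}ᶜ (G.src e) w then 1 else 0
  rw [Finset.sum_eq_single e] at h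
  · have hr : G.Joined {e}ᶜ (G.src e) (G.src e) := Relation.EqvGen.refl _
    rw [if_neg hj, if_pos hr] at h
    exact he (by simpa using h)
  · intro f _ hf
    have hf' : G.Joined {e}ᶜ (G.src f) (G.tgt f) := Joined.of_edge (by simpa using hf)
    have : G.Joined {e}ᶜ (G.src e) (G.tgt f) ↔ G.Joined {e}ᶜ (G.src e) (G.src f) :=
      ⟨fun h => h.trans hf'.symm, fun h => h.trans hf'⟩
    simp [this]
  · simp

variable {G A} in
theorem not_isSeparating_of_flow (hG : G.IsConnected) {c : G.E → A} (hc : c ∈ G.homology A)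
    {e : G.E} (he : c e ≠ 0) : ¬ G.IsSeparating e := by
  rintro ⟨a, b, hab⟩
  refine hab ?_
  have := hG.2 a b
  refine (Joined.iff_of_forall_edge (P := fun w => G.Joined {e}ᶜ a w) ?_ this).1
    (Relation.EqvGen.refl _)
  intro f _
  have hf : G.Joined {e}ᶜ (G.src f) (G.tgt f) := by
    by_cases hfe : f = e
    · subst hfe
      exact joined_src_tgt_of_flow hc he
    · exact Joined.of_edge (by simpa using hfe)
  exact ⟨fun h => h.trans hf, fun h => h.trans hf.symm⟩

variable {G} in
/-- If the ends of `e` are joined inside `S`, which does not contain `e`, there is a flow through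
`e` supported in `S ∪ {e}`. -/
theorem exists_flow_of_joined {S : Set G.E} {e : G.E} (heS : e ∉ S)
    (h : G.Joined S (G.src e) (G.tgt e)) :
    ∃ c ∈ G.homology A, c e = 1 ∧ ∀ f ∉ S, f ≠ e → c f = 0 := by
  obtain ⟨c, hc, hb⟩ := h.exists_chain A
  refine ⟨Pi.single e 1 - c, ?_, ?_, ?_⟩
  · rw [homology, LinearMap.mem_ker, map_sub, boundary_single, hb, sub_self]
  · simp [hc e heS]
  · intro f hf hfe
    simp [hc f hf, hfe]

end Flows

/-! ### Cycles in supports of flows -/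

section Cycles

variable (G : Multigraph.{u, v})

theorem sum_valenceIn (S : Set G.E) :
    ∑ w, G.valenceIn S w = 2 * (Finset.univ.filter (· ∈ S)).card := by
  have key : ∀ p : G.E → G.V,
      ∑ w, (Finset.univ.filter fun e => e ∈ S ∧ p e = w).card =
        (Finset.univ.filter (· ∈ S)).card := by
    intro p
    rw [Finset.card_eq_sum_card_fiberwise (f := p) (t := Finset.univ) (fun _ _ => by simp)]
    refine Finset.sum_congr rfl fun w _ => ?_
    rw [Finset.filter_filter]
  simp only [valenceIn, Finset.sum_add_distrib, key]
  ring

variable {G} in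
theorem valenceIn_ne_zero_iff {S : Set G.E} {w : G.V} :
    G.valenceIn S w ≠ 0 ↔ ∃ e ∈ S, G.src e = w ∨ G.tgt e = w := by
  rw [valenceIn, Ne, Nat.add_eq_zero_iff, not_and_or]
  simp only [Finset.card_eq_zero, ← Ne.eq_def, ← Finset.nonempty_iff_ne_empty,
    Finset.filter_nonempty_iff, Finset.mem_univ, true_and]
  constructor
  · rintro (⟨e, he, h⟩ | ⟨e, he, h⟩)
    exacts [⟨e, he, Or.inl h⟩, ⟨e, he, Or.inr h⟩]
  · rintro ⟨e, he, h | h⟩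
    exacts [Or.inl ⟨e, he, h⟩, Or.inr ⟨e, he, h⟩]

theorem valenceIn_mono {S T : Set G.E} (h : S ⊆ T) (w : G.V) :
    G.valenceIn S w ≤ G.valenceIn T w := by
  refine Nat.add_le_add (Finset.card_le_card ?_) (Finset.card_le_card ?_) <;>
  · intro e
    simp only [Finset.mem_filter, Finset.mem_univ, true_and]
    exact fun he => ⟨h he.1, he.2⟩

/-- A subgraph with at least as many edges as vertices carries a nonzero flow: the boundary of a
chain has total `0`, so the flow condition may be dropped at one vertex. -/
theorem exists_flow_of_card_le (F : Type) [Field F] {S : Set G.E} (hS : S.Nonempty)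
    (hcard : (Finset.univ.filter fun w => G.valenceIn S w ≠ 0).card ≤
      (Finset.univ.filter (· ∈ S)).card) :
    ∃ c ∈ G.homology F, c ≠ 0 ∧ ∀ e ∉ S, c e = 0 := by
  obtain ⟨e₀, he₀⟩ := hS
  set N := Finset.univ.filter fun w => G.valenceIn S w ≠ 0 with hN
  have hv₀ : G.src e₀ ∈ N := by
    simp only [hN, Finset.mem_filter, Finset.mem_univ, true_and]
    exact valenceIn_ne_zero_iff.2 ⟨e₀, he₀, Or.inl rfl⟩
  let ext : (S → F) →ₗ[F] (G.E → F) := Function.ExtendByZero.linearMap F Subtype.val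
  let res : (G.V → F) →ₗ[F] (↥(N.erase (G.src e₀)) → F) := LinearMap.funLeft F F Subtype.val
  let L := res ∘ₗ G.boundary F ∘ₗ ext
  have hlt : Module.finrank F (↥(N.erase (G.src e₀)) → F) < Module.finrank F (S → F) := by
    rw [Module.finrank_fintype_fun_eq_card, Module.finrank_fintype_fun_eq_card, Fintype.card_coe,
      Finset.card_erase_of_mem hv₀, Fintype.card_subtype]
    have : 0 < N.card := Finset.card_pos.2 ⟨_, hv₀⟩
    omega
  obtain ⟨d, hd, hd0⟩ := (Submodule.ne_bot_iff _).1 (LinearMap.ker_ne_bot_of_finrank_lt (f := L) hlt)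
  have hin : ∀ e : S, ext d e = d e := fun e => Subtype.val_injective.extend_apply d 0 e
  have hout : ∀ e ∉ S, ext d e = 0 := by
    intro e he
    exact Function.extend_apply' d (0 : G.E → F) e (by rintro ⟨a, rfl⟩; exact he a.2)
  have hne : ∀ w, w ≠ G.src e₀ → G.boundary F (ext d) w = 0 := by
    intro w hw
    by_cases hwN : w ∈ N
    · have := congrFun (LinearMap.mem_ker.1 hd) ⟨w, Finset.mem_erase.2 ⟨hw, hwN⟩⟩
      exact this
    · have h0 : ∀ e, (G.src e = w ∨ G.tgt e = w) → ext d e = 0 := by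
        intro e he
        by_cases heS : e ∈ S
        · refine absurd ?_ hwN
          exact Finset.mem_filter.2 ⟨Finset.mem_univ _, valenceIn_ne_zero_iff.2 ⟨e, heS, he⟩⟩
        · exact hout e heS
      rw [boundary_apply, Finset.sum_eq_zero, Finset.sum_eq_zero, sub_zero]
      · intro e he
        exact h0 e (Or.inl (Finset.mem_filter.1 he).2)
      · intro e he
        exact h0 e (Or.inr (Finset.mem_filter.1 he).2)
  refine ⟨ext d, ?_, ?_, hout⟩
  · rw [mem_homology_iff]
    intro w
    by_cases hw : w = G.src e₀
    · -- the values of a boundary sum to zero, so the last one vanishes with all the others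
      have := G.sum_mul_boundary F (ext d) 1
      rw [Finset.sum_eq_single (G.src e₀) (fun b _ hb => by rw [hne b hb, mul_zero])
        (by simp)] at this
      rw [hw]
      simpa using this
    · exact hne w hw
  · intro h
    refine hd0 (funext fun e => ?_)
    rw [← hin e, h]
    rfl

theorem natCast_valenceIn_support (c : G.E → ZMod 2) (w : G.V) :
    (G.valenceIn (Function.support c) w : ZMod 2) = G.boundary (ZMod 2) c w := by
  have key : ∀ p : G.E → G.V,
      ((Finset.univ.filter fun e => e ∈ Function.support c ∧ p e = w).card : ZMod 2) =
        ∑ e with p e = w, c e := by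
    intro p
    rw [Finset.card_filter, Nat.cast_sum, Finset.sum_filter]
    refine Finset.sum_congr rfl fun e _ => ?_
    have h2 : ∀ x : ZMod 2, x = 0 ∨ x = 1 := by decide
    by_cases hp : p e = w <;> rcases h2 (c e) with h | h <;> simp [hp, h]
  rw [valenceIn, Nat.cast_add, key, key, boundary_apply, CharTwo.sub_eq_add, add_comm]

/-- An inclusion-minimal support of a nonzero flow modulo `2` is a cycle: its valences are even, and
a proper subset of its edges carries no flow, so it has at most as many edges as vertices. -/
theorem isCycle_support_of_minimal {c : G.E → ZMod 2} (hc : c ∈ G.homology (ZMod 2)) (hc0 : c ≠ 0)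
    (hmin : ∀ d ∈ G.homology (ZMod 2), d ≠ 0 → Function.support d ⊆ Function.support c →
      Function.support d = Function.support c) :
    G.IsCycle (Function.support c) := by
  set S := Function.support c with hS
  have hSne : S.Nonempty := Function.support_nonempty_iff.2 hc0
  have heven : ∀ w, Even (G.valenceIn S w) := by
    intro w
    have := G.natCast_valenceIn_support c w
    rw [(G.mem_homology_iff _ c).1 hc w] at this
    exact (ZMod.natCast_eq_zero_iff_even).1 this
  set N := Finset.univ.filter fun w => G.valenceIn S w ≠ 0 with hN
  have hcard : (Finset.univ.filter (· ∈ S)).card ≤ N.card := by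
    by_contra hlt
    push Not at hlt
    obtain ⟨e, he⟩ := hSne
    have hNpos : 0 < N.card := Finset.card_pos.2 ⟨G.src e, by
      simpa [hN] using valenceIn_ne_zero_iff.2 ⟨e, he, Or.inl rfl⟩⟩
    obtain ⟨X, hX⟩ : ∃ X, X = S \ {e} := ⟨_, rfl⟩
    have hXS : X ⊆ S := hX ▸ Set.sdiff_subset
    have hcS : (Finset.univ.filter (· ∈ X)).card + 1 = (Finset.univ.filter (· ∈ S)).card := by
      rw [← Finset.card_erase_add_one (a := e) (s := Finset.univ.filter (· ∈ S)) (by simpa using he)]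
      congr 2
      ext f
      simp [hX, and_comm]
    obtain ⟨d, hd, hd0, hdS⟩ := G.exists_flow_of_card_le (ZMod 2) (S := X) (by
      have : 0 < (Finset.univ.filter (· ∈ X)).card := by omega
      obtain ⟨f, hf⟩ := Finset.card_pos.1 this
      exact ⟨f, (Finset.mem_filter.1 hf).2⟩) (by
      refine le_trans (Finset.card_le_card (t := N) ?_) (by omega)
      intro w
      simp only [hN, Finset.mem_filter, Finset.mem_univ, true_and]
      have := G.valenceIn_mono (S := X) hXS w
      omega)
    have hsub : Function.support d ⊆ X := fun f hf => by
      by_contra hfS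
      exact hf (hdS f hfS)
    have := hmin d hd hd0 (hsub.trans hXS)
    exact (hX ▸ hsub (this ▸ he : e ∈ Function.support d) : e ∈ S \ {e}).2 rfl
  have hsum := G.sum_valenceIn S
  have hval : ∀ w, G.valenceIn S w = 0 ∨ G.valenceIn S w = 2 := by
    have h2 : ∑ w ∈ N, 2 = ∑ w ∈ N, G.valenceIn S w := by
      refine le_antisymm (Finset.sum_le_sum fun w hw => ?_) ?_
      · have h0 := (Finset.mem_filter.1 hw).2
        obtain ⟨k, hk⟩ := heven w
        omega
      · have : ∑ w ∈ N, G.valenceIn S w = ∑ w, G.valenceIn S w := by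
          rw [hN, Finset.sum_filter_ne_zero]
        rw [this, hsum, Finset.sum_const, smul_eq_mul]
        omega
    intro w
    by_cases hw : G.valenceIn S w = 0
    · exact Or.inl hw
    · refine Or.inr ((Finset.sum_eq_sum_iff_of_le fun w hw => ?_).1 h2 w ?_).symm
      · have h0 := (Finset.mem_filter.1 hw).2
        obtain ⟨k, hk⟩ := heven w
        omega
      · simpa [hN] using hw
  refine ⟨hSne, hval, fun a b ha hb => ?_⟩
  -- the part of `c` in the connected component of `a` is a flow, hence all of `c`
  let d : G.E → ZMod 2 := fun e => if G.Joined S a (G.src e) then c e else 0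
  have hend : ∀ e ∈ S, (G.Joined S a (G.src e) ↔ G.Joined S a (G.tgt e)) := fun e he =>
    ⟨fun h => h.trans (Joined.of_edge he), fun h => h.trans (Joined.of_edge he).symm⟩
  have hd : d ∈ G.homology (ZMod 2) := by
    rw [mem_homology_iff_pairing] at hc ⊢
    intro f
    rw [← hc fun w => if G.Joined S a w then f w else 0]
    refine Finset.sum_congr rfl fun e _ => ?_
    by_cases he : e ∈ S
    · simp only [d, ← hend e he]
      split_ifs <;> simp
    · have : c e = 0 := by simpa [hS] using he
      simp [d, this]
  have hda : ∀ w e, G.Joined S a w → e ∈ S → (G.src e = w ∨ G.tgt e = w) → d e ≠ 0 := by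
    rintro w e hw he h
    have : G.Joined S a (G.src e) := by
      rcases h with rfl | rfl
      · exact hw
      · exact (hend e he).2 hw
    simp only [d, if_pos this]
    exact he
  obtain ⟨e, he, hea⟩ := valenceIn_ne_zero_iff.1 (show G.valenceIn S a ≠ 0 by omega)
  have hSd := hmin d hd (fun h => hda a e (Relation.EqvGen.refl _) he hea (congrFun h e)) (by
    intro f hf hf0
    exact hf (by simp [d, hf0]))
  obtain ⟨f, hf, hfb⟩ := valenceIn_ne_zero_iff.1 (show G.valenceIn S b ≠ 0 by omega)
  have hfd : d f ≠ 0 := by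
    have : f ∈ Function.support d := hSd ▸ hf
    exact this
  have hja : G.Joined S a (G.src f) := by
    by_contra h
    exact hfd (by simp [d, h])
  rcases hfb with rfl | rfl
  · exact hja
  · exact (hend f hf).1 hja

/-- A nonempty edge set without leaves contains a cycle. -/
theorem exists_isCycle_of_valenceIn_ne_one {X : Set G.E} (hX : X.Nonempty)
    (h1 : ∀ w, G.valenceIn X w ≠ 1) : ∃ S ⊆ X, G.IsCycle S := by
  obtain ⟨c, hc, hc0, hcX⟩ := G.exists_flow_of_card_le (ZMod 2) hX (by
    have h2 : ∑ w ∈ Finset.univ.filter (fun w => G.valenceIn X w ≠ 0), 2 ≤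
        ∑ w ∈ Finset.univ.filter (fun w => G.valenceIn X w ≠ 0), G.valenceIn X w := by
      refine Finset.sum_le_sum fun w hw => ?_
      have := (Finset.mem_filter.1 hw).2
      have := h1 w
      omega
    rw [Finset.sum_filter_ne_zero, sum_valenceIn, Finset.sum_const, smul_eq_mul] at h2
    omega)
  let P : Finset (G.E → ZMod 2) := Finset.univ.filter fun d => d ∈ G.homology (ZMod 2) ∧ d ≠ 0 ∧
    Function.support d ⊆ X
  obtain ⟨d, hd, hmin⟩ := P.exists_min_image (fun d => (Function.support d).ncard)
    ⟨c, by
      simp only [P, Finset.mem_filter, Finset.mem_univ, true_and]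
      exact ⟨hc, hc0, fun e he => by_contra fun h => he (hcX e h)⟩⟩
  simp only [P, Finset.mem_filter, Finset.mem_univ, true_and] at hd hmin
  refine ⟨_, hd.2.2, G.isCycle_support_of_minimal hd.1 hd.2.1 fun d' hd' hd0 hsub => ?_⟩
  exact Set.eq_of_subset_of_ncard_le hsub (hmin d' ⟨hd', hd0, hsub.trans hd.2.2⟩)

/-- The support of a nonzero flow contains a cycle. -/
theorem exists_isCycle_subset_support {A : Type} [CommRing A] {c : G.E → A}
    (hc : c ∈ G.homology A) (hc0 : c ≠ 0) : ∃ S ⊆ Function.support c, G.IsCycle S := by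
  refine G.exists_isCycle_of_valenceIn_ne_one (Function.support_nonempty_iff.2 hc0) fun w hw => ?_
  have hb := (G.mem_homology_iff A c).1 hc w
  rw [boundary_apply] at hb
  have hr : ∀ p : G.E → G.V, ∑ e with p e = w, c e =
      ∑ e ∈ Finset.univ.filter (fun e => e ∈ Function.support c ∧ p e = w), c e := by
    intro p
    symm
    refine Finset.sum_subset (fun e => by simp) fun e he he' => ?_
    simp only [Finset.mem_filter, Finset.mem_univ, true_and, Function.mem_support] at he he'
    by_contra h
    exact he' ⟨h, he⟩
  rw [hr, hr] at hb
  rw [valenceIn] at hw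
  rcases Nat.add_eq_one_iff.1 hw with ⟨h0, h1⟩ | ⟨h1, h0⟩ <;>
  · rw [Finset.card_eq_zero] at h0
    obtain ⟨e, he⟩ := Finset.card_eq_one.1 h1
    have hmem := Finset.mem_singleton_self e
    rw [← he] at hmem
    rw [h0, he] at hb
    simp only [Finset.sum_singleton, Finset.sum_empty, sub_zero, zero_sub, neg_eq_zero] at hb
    exact (Finset.mem_filter.1 hmem).2.1 hb

end Cycles

end Multigraph

namespace Multigraph

/-! ### Orientations of cycles and of even edge sets -/

section Orientation

variable (G : Multigraph.{u, v})

/-- `y` is an integral flow with values `±1` on `S` and `0` elsewhere. -/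
structure IsOrientation (S : Set G.E) (y : G.E → ℤ) : Prop where
  mem : y ∈ G.homology ℤ
  on : ∀ e ∈ S, y e = 1 ∨ y e = -1
  off : ∀ e ∉ S, y e = 0

variable {G}

theorem intCast_mem_homology (A : Type) [CommRing A] {y : G.E → ℤ} (hy : y ∈ G.homology ℤ) :
    (fun e => (y e : A)) ∈ G.homology A := by
  rw [mem_homology_iff] at hy ⊢
  intro w
  have := congrArg (Int.cast : ℤ → A) (hy w)
  simpa [boundary_apply] using this

theorem mem_homology_of_intCast {y : G.E → ℤ} (hy : (fun e => (y e : ℝ)) ∈ G.homology ℝ) :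
    y ∈ G.homology ℤ := by
  rw [mem_homology_iff] at hy ⊢
  intro w
  have := hy w
  rw [boundary_apply] at this ⊢
  exact_mod_cast this

theorem IsOrientation.ne_zero_iff {S : Set G.E} {y : G.E → ℤ} (h : G.IsOrientation S y) {e : G.E} :
    y e ≠ 0 ↔ e ∈ S := by
  by_cases he : e ∈ S
  · rcases h.on e he with h1 | h1 <;> simp [h1, he]
  · simp [h.off e he, he]

theorem IsOrientation.intCast_ne_zero_iff (A : Type) [CommRing A] [Nontrivial A]
    {S : Set G.E} {y : G.E → ℤ} (h : G.IsOrientation S y) {e : G.E} :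
    (y e : A) ≠ 0 ↔ e ∈ S := by
  by_cases he : e ∈ S
  · rcases h.on e he with h1 | h1 <;> simp [h1, he]
  · simp [h.off e he, he]

theorem IsOrientation.mul_self {S : Set G.E} {y : G.E → ℤ} (h : G.IsOrientation S y) {e : G.E}
    (he : e ∈ S) : y e * y e = 1 := by
  rcases h.on e he with h1 | h1 <;> simp [h1]

theorem IsOrientation.neg {S : Set G.E} {y : G.E → ℤ} (h : G.IsOrientation S y) :
    G.IsOrientation S (-y) where
  mem := neg_mem h.mem
  on e he := by
    rcases h.on e he with h1 | h1 <;> simp [h1]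
  off e he := by simp [h.off e he]

/-- A real flow supported in a cycle has constant absolute value on it. -/
theorem IsCycle.exists_abs_eq {S : Set G.E} (hS : G.IsCycle S) {z : G.E → ℝ}
    (hz : z ∈ G.homology ℝ) (hzS : ∀ e ∉ S, z e = 0) : ∃ r : ℝ, ∀ e ∈ S, |z e| = r := by
  have hloc : ∀ w, ∃ r : ℝ, ∀ e ∈ S, (G.src e = w ∨ G.tgt e = w) → |z e| = r := by
    intro w
    have hb := (G.mem_homology_iff ℝ z).1 hz w
    rw [boundary_apply] at hb
    have hr : ∀ p : G.E → G.V, ∑ e with p e = w, z e =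
        ∑ e ∈ Finset.univ.filter (fun e => e ∈ S ∧ p e = w), z e := by
      intro p
      symm
      refine Finset.sum_subset (fun e => by simp) fun e he he' => ?_
      simp only [Finset.mem_filter, Finset.mem_univ, true_and] at he he'
      exact hzS e fun h => he' ⟨h, he⟩
    rw [hr, hr] at hb
    have hsrc : ∀ e ∈ S, G.src e = w → e ∈ Finset.univ.filter (fun e => e ∈ S ∧ G.src e = w) :=
      fun e he h => by simp [he, h]
    have htgt : ∀ e ∈ S, G.tgt e = w → e ∈ Finset.univ.filter (fun e => e ∈ S ∧ G.tgt e = w) :=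
      fun e he h => by simp [he, h]
    have hv := hS.2.1 w
    rw [valenceIn] at hv
    generalize Finset.univ.filter (fun e => e ∈ S ∧ G.src e = w) = X at *
    generalize Finset.univ.filter (fun e => e ∈ S ∧ G.tgt e = w) = Y at *
    have hcases : X.card + Y.card = 0 ∨ (X.card = 1 ∧ Y.card = 1) ∨ (X.card = 2 ∧ Y.card = 0) ∨
        (X.card = 0 ∧ Y.card = 2) := by omega
    rcases hcases with h | ⟨h1, h2⟩ | ⟨h1, h2⟩ | ⟨h1, h2⟩
    · obtain ⟨h1, h2⟩ := Nat.add_eq_zero_iff.1 h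
      rw [Finset.card_eq_zero] at h1 h2
      refine ⟨0, fun e he hew => ?_⟩
      rcases hew with h | h
      · exact absurd (hsrc e he h) (by simp [h1])
      · exact absurd (htgt e he h) (by simp [h2])
    · obtain ⟨a, rfl⟩ := Finset.card_eq_one.1 h1
      obtain ⟨b, rfl⟩ := Finset.card_eq_one.1 h2
      simp only [Finset.sum_singleton] at hb
      refine ⟨|z a|, fun e he hew => ?_⟩
      rcases hew with h | h
      · rw [Finset.mem_singleton.1 (hsrc e he h)]
      · rw [Finset.mem_singleton.1 (htgt e he h), sub_eq_zero.1 hb]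
    · obtain ⟨a, b, hab, rfl⟩ := Finset.card_eq_two.1 h1
      rw [Finset.card_eq_zero] at h2
      subst h2
      rw [Finset.sum_pair hab, Finset.sum_empty, zero_sub, neg_eq_zero] at hb
      have hba : z b = - z a := by linarith
      refine ⟨|z a|, fun e he hew => ?_⟩
      rcases hew with h | h
      · rcases Finset.mem_insert.1 (hsrc e he h) with rfl | h'
        · rfl
        · rw [Finset.mem_singleton.1 h', hba, abs_neg]
      · exact absurd (htgt e he h) (by simp)
    · obtain ⟨a, b, hab, rfl⟩ := Finset.card_eq_two.1 h2
      rw [Finset.card_eq_zero] at h1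
      subst h1
      rw [Finset.sum_pair hab, Finset.sum_empty, sub_zero] at hb
      have hba : z b = - z a := by linarith
      refine ⟨|z a|, fun e he hew => ?_⟩
      rcases hew with h | h
      · exact absurd (hsrc e he h) (by simp)
      · rcases Finset.mem_insert.1 (htgt e he h) with rfl | h'
        · rfl
        · rw [Finset.mem_singleton.1 h', hba, abs_neg]
  choose r hr using hloc
  have hjoin : ∀ a b, G.Joined S a b → r a = r b := by
    intro a b h
    refine (h.iff_of_forall_edge (P := fun w => r a = r w) fun e he => ?_).1 rfl
    rw [← hr _ e he (Or.inl rfl), ← hr _ e he (Or.inr rfl)]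
  obtain ⟨e₀, he₀⟩ := hS.1
  have htwo : ∀ e ∈ S, G.valenceIn S (G.src e) = 2 := fun e he =>
    (hS.2.1 _).resolve_left (valenceIn_ne_zero_iff.2 ⟨e, he, Or.inl rfl⟩)
  refine ⟨r (G.src e₀), fun e he => ?_⟩
  rw [hr _ e he (Or.inl rfl)]
  exact hjoin _ _ (hS.2.2 _ _ (htwo e he) (htwo e₀ he₀))

theorem IsCycle.exists_isOrientation {S : Set G.E} (hS : G.IsCycle S) :
    ∃ y, G.IsOrientation S y := by
  obtain ⟨z, hz, hz0, hzS⟩ := G.exists_flow_of_card_le ℝ hS.1 (by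
    have h2 : ∑ w ∈ Finset.univ.filter (fun w => G.valenceIn S w ≠ 0), 2 =
        ∑ w ∈ Finset.univ.filter (fun w => G.valenceIn S w ≠ 0), G.valenceIn S w :=
      Finset.sum_congr rfl fun w hw =>
        ((hS.2.1 w).resolve_left (Finset.mem_filter.1 hw).2).symm
    rw [Finset.sum_filter_ne_zero, sum_valenceIn, Finset.sum_const, smul_eq_mul] at h2
    omega)
  obtain ⟨r, hr⟩ := hS.exists_abs_eq hz hzS
  have hr0 : r ≠ 0 := by
    rintro rfl
    refine hz0 (funext fun e => ?_)
    by_cases he : e ∈ S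
    · simpa using hr e he
    · exact hzS e he
  have hval : ∀ e, ∃ n : ℤ, (n : ℝ) = r⁻¹ * z e ∧ (e ∈ S → n = 1 ∨ n = -1) ∧ (e ∉ S → n = 0) := by
    intro e
    by_cases he : e ∈ S
    · rcases abs_choice (z e) with h | h <;> rw [hr e he] at h
      · exact ⟨1, by rw [← h]; simp [hr0], fun _ => Or.inl rfl, fun h => absurd he h⟩
      · refine ⟨-1, ?_, fun _ => Or.inr rfl, fun h => absurd he h⟩
        rw [show z e = -r by linarith]
        simp [hr0]
    · exact ⟨0, by simp [hzS e he], fun h => absurd h he, fun _ => rfl⟩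
  choose y hy hon hoff using hval
  refine ⟨y, mem_homology_of_intCast ?_, hon, hoff⟩
  have : (fun e => (y e : ℝ)) = r⁻¹ • z := funext fun e => by rw [hy e]; rfl
  rw [this]
  exact Submodule.smul_mem _ _ hz

/-- A cycle can be oriented so that a prescribed edge gets the value `1`. -/
theorem IsCycle.exists_isOrientation_eq_one {S : Set G.E} (hS : G.IsCycle S) {e : G.E}
    (he : e ∈ S) : ∃ y, G.IsOrientation S y ∧ y e = 1 := by
  obtain ⟨y, hy⟩ := hS.exists_isOrientation
  rcases hy.on e he with h | h
  · exact ⟨y, hy, h⟩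
  · exact ⟨-y, hy.neg, by simp [h]⟩

theorem IsOrientation.eq_of_subset_isCycle {S T : Set G.E} {y : G.E → ℤ} (hy : G.IsOrientation T y)
    (hT : T.Nonempty) (hS : G.IsCycle S) (hTS : T ⊆ S) : T = S := by
  obtain ⟨r, hr⟩ := hS.exists_abs_eq (intCast_mem_homology ℝ hy.mem)
    (fun e he => by simp [hy.off e fun h => he (hTS h)])
  refine hTS.antisymm fun e he => ?_
  obtain ⟨f, hf⟩ := hT
  rw [← hy.intCast_ne_zero_iff ℝ, ← abs_ne_zero, hr e he, ← hr f (hTS hf), abs_ne_zero,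
    hy.intCast_ne_zero_iff ℝ]
  exact hf

/-- A flow whose support contains no cycle vanishes. -/
theorem eq_zero_of_forall_not_isCycle {A : Type} [CommRing A] {x : G.E → A} (hx : x ∈ G.homology A)
    (h : ∀ S ⊆ Function.support x, ¬ G.IsCycle S) : x = 0 := by
  by_contra hx0
  obtain ⟨S, hS, hS'⟩ := G.exists_isCycle_subset_support hx hx0
  exact h S hS hS'

theorem eq_of_forall_not_isCycle {A : Type} [CommRing A] {x y : G.E → A} (hx : x ∈ G.homology A)
    (hy : y ∈ G.homology A) {T : Set G.E} (hT : ∀ S ⊆ T, ¬ G.IsCycle S)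
    (hxy : ∀ e ∉ T, x e = y e) : x = y := by
  refine sub_eq_zero.1 (eq_zero_of_forall_not_isCycle (sub_mem hx hy) fun S hS => hT S fun e he => ?_)
  by_contra h
  exact hS he (by simp [hxy e h])

/-- A flow is a linear combination of oriented cycles contained in its support. -/
theorem mem_of_forall_isOrientation {A : Type} [CommRing A] {x : G.E → A} (hx : x ∈ G.homology A)
    (P : Submodule A (G.E → A))
    (hP : ∀ S ⊆ Function.support x, G.IsCycle S → ∀ y, G.IsOrientation S y →
      (fun e => (y e : A)) ∈ P) : x ∈ P := by
  induction hn : (Function.support x).ncard using Nat.strong_induction_on generalizing x with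
  | _ n ih =>
  by_cases hx0 : x = 0
  · rw [hx0]
    exact P.zero_mem
  obtain ⟨S, hS, hSc⟩ := G.exists_isCycle_subset_support hx hx0
  obtain ⟨e, he⟩ := hSc.1
  obtain ⟨y, hy, hye⟩ := hSc.exists_isOrientation_eq_one he
  have hsub : Function.support (x - x e • fun f => (y f : A)) ⊆ Function.support x \ {e} := by
    intro f hf
    refine ⟨fun h0 => hf ?_, ?_⟩
    · have : f ∉ S := fun h => hS h h0
      simp [h0, hy.off f this]
    · rintro rfl
      exact hf (by simp [hye])
  have hlt : Function.support (x - x e • fun f => (y f : A)) ⊂ Function.support x :=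
    ⟨hsub.trans Set.sdiff_subset, fun h => (hsub (h (hS he))).2 rfl⟩
  have := ih _ (hn ▸ Set.ncard_lt_ncard hlt)
    (sub_mem hx (Submodule.smul_mem _ (x e) (intCast_mem_homology A hy.mem)))
    (fun T hT => hP T (hT.trans hlt.1)) rfl
  have h2 := P.add_mem this (P.smul_mem (x e) (hP S hS hSc y hy))
  rwa [sub_add_cancel] at h2

theorem exists_isCycle_of_ne_zero {A : Type} [CommRing A] {x : G.E → A} (hx : x ∈ G.homology A)
    {e : G.E} (he : x e ≠ 0) : ∃ S ⊆ Function.support x, G.IsCycle S ∧ e ∈ S := by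
  by_contra! h
  refine he ?_
  have : x ∈ LinearMap.ker (LinearMap.proj e : (G.E → A) →ₗ[A] A) := by
    refine mem_of_forall_isOrientation hx _ fun S hS hSc y hy => ?_
    simp [LinearMap.mem_ker, hy.off e (h S hS hSc)]
  exact this

theorem not_isSeparating_of_mem_isCycle (hG : G.IsConnected) {S : Set G.E} (hS : G.IsCycle S)
    {e : G.E} (he : e ∈ S) : ¬ G.IsSeparating e := by
  obtain ⟨y, hy⟩ := hS.exists_isOrientation
  exact not_isSeparating_of_flow hG hy.mem (hy.ne_zero_iff.2 he)

theorem exists_isCycle_of_not_isSeparating {e : G.E} (he : ¬ G.IsSeparating e) :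
    ∃ S, G.IsCycle S ∧ e ∈ S := by
  have hj : G.Joined {e}ᶜ (G.src e) (G.tgt e) := by
    by_contra h
    exact he ⟨_, _, h⟩
  obtain ⟨c, hc, hce, -⟩ := exists_flow_of_joined ℤ (by simp) hj
  obtain ⟨S, -, hS, heS⟩ := exists_isCycle_of_ne_zero hc (e := e) (by simp [hce])
  exact ⟨S, hS, heS⟩

theorem zmod_two_ne_zero {x : ZMod 2} : x ≠ 0 ↔ x = 1 := by
  revert x
  decide

/-- Two chains modulo `2` with the same support are equal. -/
theorem eq_of_support_eq {ι : Type*} {c d : ι → ZMod 2}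
    (h : Function.support c = Function.support d) : c = d := by
  funext e
  have h1 : c e ≠ 0 ↔ d e ≠ 0 := Set.ext_iff.1 h e
  revert h1
  generalize c e = a
  generalize d e = b
  revert a b
  decide

/-- Every flow modulo `2` lifts to an integral flow with values in `{-1, 0, 1}`: its support is a
disjoint union of cycles. -/
theorem exists_isOrientation_support {c : G.E → ZMod 2} (hc : c ∈ G.homology (ZMod 2)) :
    ∃ y, G.IsOrientation (Function.support c) y := by
  induction hn : (Function.support c).ncard using Nat.strong_induction_on generalizing c with
  | _ n ih =>
  by_cases hc0 : c = 0
  · exact ⟨0, zero_mem _, fun e he => absurd (congrFun hc0 e) he, fun _ _ => rfl⟩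
  obtain ⟨S, hS, hSc⟩ := G.exists_isCycle_subset_support hc hc0
  obtain ⟨y, hy⟩ := hSc.exists_isOrientation
  have hsupp : Function.support (c - fun e => (y e : ZMod 2)) = Function.support c \ S := by
    ext e
    by_cases he : e ∈ S
    · have h1 : c e = 1 := zmod_two_ne_zero.1 (hS he)
      have h2 : (y e : ZMod 2) = 1 := zmod_two_ne_zero.1 ((hy.intCast_ne_zero_iff (ZMod 2)).2 he)
      simp [h1, h2, he]
    · simp [hy.off e he, he]
  obtain ⟨z, hz⟩ := ih _ (hn ▸ Set.ncard_lt_ncard (t := Function.support c) (by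
    rw [hsupp]
    refine ⟨Set.sdiff_subset, fun h => ?_⟩
    obtain ⟨e, he⟩ := hSc.1
    exact (h (hS he)).2 he)) (sub_mem hc (intCast_mem_homology _ hy.mem)) rfl
  rw [hsupp] at hz
  refine ⟨y + z, add_mem hy.mem hz.mem, fun e he => ?_, fun e he => ?_⟩
  · by_cases heS : e ∈ S
    · simpa [hz.off e fun h => h.2 heS] using hy.on e heS
    · simpa [hy.off e heS] using hz.on e ⟨he, heS⟩
  · simp [hy.off e fun h => he (hS h), hz.off e fun h => he h.1]

/-- The orientation of the odd part of an integral flow. -/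
theorem exists_isOrientation_odd {x : G.E → ℤ} (hx : x ∈ G.homology ℤ) :
    ∃ y, G.IsOrientation {e | Odd (x e)} y := by
  have := exists_isOrientation_support (intCast_mem_homology (ZMod 2) hx)
  have hs : (Function.support fun e => (x e : ZMod 2)) = {e | Odd (x e)} := by
    ext e
    simp only [Function.mem_support, Set.mem_ofPred_eq, Ne, ZMod.intCast_zmod_eq_zero_iff_dvd]
    rw [← Int.not_even_iff_odd, even_iff_two_dvd]
    rfl
  rwa [hs] at this

/-- The cycles are the minimal nonempty supports of flows modulo `2`. -/
theorem isCycle_iff_minimal {S : Set G.E} : G.IsCycle S ↔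
    ∃ c ∈ G.homology (ZMod 2), c ≠ 0 ∧ Function.support c = S ∧
      ∀ d ∈ G.homology (ZMod 2), d ≠ 0 → Function.support d ⊆ S → Function.support d = S := by
  constructor
  · intro hS
    obtain ⟨y, hy⟩ := hS.exists_isOrientation
    have hs : (Function.support fun e => (y e : ZMod 2)) = S := by
      ext e
      exact hy.intCast_ne_zero_iff (ZMod 2)
    refine ⟨_, intCast_mem_homology _ hy.mem, ?_, hs, fun d hd hd0 hdS => ?_⟩
    · rw [← Function.support_nonempty_iff, hs]
      exact hS.1
    · obtain ⟨z, hz⟩ := exists_isOrientation_support hd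
      exact hz.eq_of_subset_isCycle (Function.support_nonempty_iff.2 hd0) hS hdS
  · rintro ⟨c, hc, hc0, rfl, hmin⟩
    exact G.isCycle_support_of_minimal hc hc0 hmin

end Orientation

end Multigraph

namespace Multigraph

/-! ### Parity characters of the lattice of integral flows -/

section Parity

variable (G : Multigraph.{u, v})

/-- The character `z ↦ (-1) ^ z e` of the group of integral flows. -/
noncomputable def parityChar (e : G.E) : Multiplicative (G.homology ℤ) →* ℝ where
  toFun z := if Odd (z.toAdd.1 e) then -1 else 1
  map_one' := by simp
  map_mul' x y := by
    have : (x * y).toAdd.1 e = x.toAdd.1 e + y.toAdd.1 e := rfl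
    rw [this]
    by_cases hx : Odd (x.toAdd.1 e) <;> by_cases hy : Odd (y.toAdd.1 e) <;>
      simp [Int.odd_add, hx, hy, ← Int.not_odd_iff_even]

theorem parityChar_apply (e : G.E) (z : Multiplicative (G.homology ℤ)) :
    G.parityChar e z = if Odd (z.toAdd.1 e) then -1 else 1 := rfl

variable {G}

theorem ite_odd_eq_iff {a b : ℤ} :
    ((if Odd a then -1 else 1 : ℝ) = if Odd b then -1 else 1) ↔ (Odd a ↔ Odd b) := by
  by_cases ha : Odd a <;> by_cases hb : Odd b <;> simp [ha, hb] <;> norm_num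

theorem parityChar_eq_iff {e f : G.E} :
    G.parityChar e = G.parityChar f ↔ ∀ z ∈ G.homology ℤ, (Odd (z e) ↔ Odd (z f)) := by
  rw [MonoidHom.ext_iff]
  simp only [parityChar_apply, ite_odd_eq_iff]
  exact ⟨fun h z hz => h (Multiplicative.ofAdd ⟨z, hz⟩), fun h z => h _ z.toAdd.2⟩

theorem parityChar_eq_one_iff {e : G.E} :
    G.parityChar e = 1 ↔ ∀ z ∈ G.homology ℤ, ¬ Odd (z e) := by
  rw [MonoidHom.ext_iff]
  simp only [parityChar_apply, MonoidHom.one_apply]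
  have : ∀ a : ℤ, (if Odd a then -1 else 1 : ℝ) = 1 ↔ ¬ Odd a := fun a => by
    by_cases ha : Odd a <;> simp [ha]
    norm_num
  simp only [this]
  exact ⟨fun h z hz => h (Multiplicative.ofAdd ⟨z, hz⟩), fun h z => h _ z.toAdd.2⟩

theorem IsOrientation.odd_iff {S : Set G.E} {y : G.E → ℤ} (h : G.IsOrientation S y) {e : G.E} :
    Odd (y e) ↔ e ∈ S := by
  by_cases he : e ∈ S
  · rcases h.on e he with h1 | h1 <;> simp [h1, he]
  · simp [h.off e he, he]

theorem parityChar_eq_one_iff_isSeparating (hG : G.IsConnected) {e : G.E} :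
    G.parityChar e = 1 ↔ G.IsSeparating e := by
  rw [parityChar_eq_one_iff]
  constructor
  · intro h
    by_contra he
    obtain ⟨S, hS, heS⟩ := exists_isCycle_of_not_isSeparating he
    obtain ⟨y, hy⟩ := hS.exists_isOrientation
    exact h y hy.mem (hy.odd_iff.2 heS)
  · intro h z hz ho
    refine not_isSeparating_of_flow hG hz (e := e) ?_ h
    rintro h0
    simp [h0] at ho

/-- Two nonseparating edges are in the same C1-set if and only if they have the same parity
character. -/
theorem mem_c1Class_iff (hG : G.IsConnected) {e : G.E} (he : ¬ G.IsSeparating e) {f : G.E} :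
    f ∈ G.c1Class e ↔ G.parityChar e = G.parityChar f := by
  constructor
  · rintro ⟨-, h⟩
    rw [parityChar_eq_iff]
    intro z hz
    -- the flows with values of equal parity on `e` and `f` form a subgroup containing all cycles
    let P : Submodule ℤ (G.E → ℤ) :=
      { carrier := {z | Even (z e - z f)}
        zero_mem' := by simp
        add_mem' := fun {a b} ha hb => by
          have : (a + b) e - (a + b) f = (a e - a f) + (b e - b f) := by
            simp only [Pi.add_apply]
            ring
          change Even ((a + b) e - (a + b) f)
          rw [this]
          exact Even.add ha hb
        smul_mem' := fun k a ha => by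
          have : (k • a) e - (k • a) f = k * (a e - a f) := by
            simp only [Pi.smul_apply, smul_eq_mul]
            ring
          change Even ((k • a) e - (k • a) f)
          rw [this]
          exact Even.mul_left ha k }
    have : z ∈ P := mem_of_forall_isOrientation hz P fun S _ hS y hy => by
      change Even ((y e : ℤ) - (y f : ℤ))
      rw [Int.even_sub', hy.odd_iff, hy.odd_iff]
      exact h S hS
    exact Int.even_sub'.1 this
  · intro h
    refine ⟨?_, fun S hS => ?_⟩
    · rwa [← parityChar_eq_one_iff_isSeparating hG, ← h, parityChar_eq_one_iff_isSeparating hG]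
    · obtain ⟨y, hy⟩ := hS.exists_isOrientation
      rw [← hy.odd_iff, ← hy.odd_iff]
      exact parityChar_eq_iff.1 h y hy.mem

end Parity

end Multigraph

namespace TropicalCurve

/-! ### The isometry of flow lattices given by an isomorphism of Jacobians -/

open Multigraph

theorem fst_eq_zero_of_jacForm_eq_zero (C : TropicalCurve.{u, v}) {x : C.JacSpace}
    (hx : C.jacForm x = 0) : x.1 = 0 := by
  rw [jacForm_apply, Finset.sum_eq_zero_iff_of_nonneg
    fun e _ => mul_nonneg (sq_nonneg _) (C.length_pos e).le] at hx
  refine Subtype.ext (funext fun e => ?_)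
  have := hx e (Finset.mem_univ e)
  simpa [(C.length_pos e).ne'] using this

/-- The lattice vector of the Jacobian defined by an integral flow. -/
def latticeVector (C : TropicalCurve.{u, v}) : C.homology ℤ →+ C.JacSpace where
  toFun z := (⟨fun e => z.1 e, intCast_mem_homology ℝ z.2⟩, 0)
  map_zero' := by
    refine Prod.ext (Subtype.ext (funext fun e => ?_)) rfl
    simp
  map_add' x y := by
    refine Prod.ext (Subtype.ext (funext fun e => ?_)) (by simp)
    simp

theorem latticeVector_mem (C : TropicalCurve.{u, v}) (z : C.homology ℤ) :
    C.latticeVector z ∈ C.jacLattice :=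
  ⟨⟨z.1, z.2, fun _ => rfl⟩, 0, fun i => by simp [latticeVector]⟩

/-- An isometry of Jacobian spaces that respects the lattices gives an isometry of the lattices of
integral flows, because it respects the null spaces of the forms. -/
theorem exists_addEquiv_of_isomorphic {C : TropicalCurve.{u₁, v₁}} {C' : TropicalCurve.{u₂, v₂}}
    (h : C.jacobian.Isomorphic C'.jacobian) :
    ∃ T : C.homology ℤ ≃+ C'.homology ℤ, ∀ z : C.homology ℤ,
      ∑ e, ((T z).1 e : ℝ) ^ 2 * C'.length e = ∑ e, (z.1 e : ℝ) ^ 2 * C.length e := by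
  obtain ⟨h, hlat, hform⟩ := h
  change C.JacSpace ≃ₗ[ℝ] C'.JacSpace at h
  change ∀ x : C.JacSpace, h x ∈ C'.jacLattice ↔ x ∈ C.jacLattice at hlat
  change ∀ x : C.JacSpace, C'.jacForm (h x) = C.jacForm x at hform
  have hlat' : ∀ x : C'.JacSpace, h.symm x ∈ C.jacLattice ↔ x ∈ C'.jacLattice := fun x => by
    rw [← hlat, h.apply_symm_apply]
  have hform' : ∀ x : C'.JacSpace, C.jacForm (h.symm x) = C'.jacForm x := fun x => by
    rw [← hform, h.apply_symm_apply]
  have ht : ∀ z : C.homology ℤ, ∃ w : C'.homology ℤ,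
      (h (C.latticeVector z)).1 = (C'.latticeVector w).1 := by
    intro z
    obtain ⟨⟨w, hw, hwe⟩, -⟩ := (hlat _).2 (C.latticeVector_mem z)
    exact ⟨⟨w, hw⟩, Subtype.ext (funext hwe)⟩
  have ht' : ∀ z : C'.homology ℤ, ∃ w : C.homology ℤ,
      (h.symm (C'.latticeVector z)).1 = (C.latticeVector w).1 := by
    intro z
    obtain ⟨⟨w, hw, hwe⟩, -⟩ := (hlat' _).2 (C'.latticeVector_mem z)
    exact ⟨⟨w, hw⟩, Subtype.ext (funext hwe)⟩
  choose t ht using ht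
  choose t' ht' using ht'
  have hinj : ∀ {z w : C.homology ℤ}, (C.latticeVector z).1 = (C.latticeVector w).1 → z = w := by
    intro z w hzw
    refine Subtype.ext (funext fun e => ?_)
    have : (z.1 e : ℝ) = w.1 e := congrFun (congrArg Subtype.val hzw) e
    exact_mod_cast this
  have hinj' : ∀ {z w : C'.homology ℤ},
      (C'.latticeVector z).1 = (C'.latticeVector w).1 → z = w := by
    intro z w hzw
    refine Subtype.ext (funext fun e => ?_)
    have : (z.1 e : ℝ) = w.1 e := congrFun (congrArg Subtype.val hzw) e
    exact_mod_cast this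
  have hnull : ∀ x y : C.JacSpace, x.1 = y.1 → (h x).1 = (h y).1 := by
    intro x y hxy
    have h0 : C.jacForm (x - y) = 0 := by
      rw [jacForm_apply]
      simp [hxy]
    have := C'.fst_eq_zero_of_jacForm_eq_zero (x := h (x - y)) (by rw [hform, h0])
    rw [map_sub] at this
    exact sub_eq_zero.1 this
  have hnull' : ∀ x y : C'.JacSpace, x.1 = y.1 → (h.symm x).1 = (h.symm y).1 := by
    intro x y hxy
    have h0 : C'.jacForm (x - y) = 0 := by
      rw [jacForm_apply]
      simp [hxy]
    have := C.fst_eq_zero_of_jacForm_eq_zero (x := h.symm (x - y)) (by rw [hform', h0])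
    rw [map_sub] at this
    exact sub_eq_zero.1 this
  refine ⟨{ toFun := t, invFun := t', left_inv := fun z => ?_, right_inv := fun z => ?_,
            map_add' := fun x y => ?_ }, fun z => ?_⟩
  · refine hinj ?_
    rw [← ht', hnull' _ _ (ht z).symm, h.symm_apply_apply]
  · refine hinj' ?_
    rw [← ht, hnull _ _ (ht' z).symm, h.apply_symm_apply]
  · refine hinj' ?_
    rw [← ht, map_add, map_add, map_add, Prod.fst_add, Prod.fst_add, ht, ht]
  · have h1 := hform (C.latticeVector z)
    rw [jacForm_apply, jacForm_apply, ht z] at h1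
    exact h1

/-! ### The lengths of the odd parts of flows -/

/-- An isometry `T` does not increase the length of the odd part: replace `z` by the orientation `y`
of its odd part, whose norm is that length; `T y` and `T z` have the same odd part, whose length is
at most the norm of `T y`. -/
theorem length_odd_le_of_isometry {C : TropicalCurve.{u₁, v₁}} {C' : TropicalCurve.{u₂, v₂}}
    (T : C.homology ℤ →+ C'.homology ℤ)
    (hT : ∀ z : C.homology ℤ,
      ∑ e, ((T z).1 e : ℝ) ^ 2 * C'.length e = ∑ e, (z.1 e : ℝ) ^ 2 * C.length e)
    (z : C.homology ℤ) :
    (∑ e, if Odd ((T z).1 e) then C'.length e else 0) ≤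
      ∑ e, if Odd (z.1 e) then C.length e else 0 := by
  obtain ⟨y, hy⟩ := exists_isOrientation_odd z.2
  have hpar : ∀ e, Even (y e - z.1 e) := fun e => by
    rw [Int.even_sub', hy.odd_iff]
    rfl
  -- `y = z + 2 d` for an integral flow `d`
  choose d hd using hpar
  have hdmem : d ∈ C.homology ℤ := by
    rw [mem_homology_iff_pairing]
    intro f
    have h1 := (mem_homology_iff_pairing _ ℤ _).1 (sub_mem hy.mem z.2) f
    have h2 : ∑ e, (f (C.tgt e) - f (C.src e)) * (y - z.1) e =
        2 * ∑ e, (f (C.tgt e) - f (C.src e)) * d e := by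
      rw [Finset.mul_sum]
      refine Finset.sum_congr rfl fun e _ => ?_
      rw [Pi.sub_apply, hd]
      ring
    omega
  have hsum : (⟨y, hy.mem⟩ : C.homology ℤ) = z + (⟨d, hdmem⟩ + ⟨d, hdmem⟩) := by
    refine Subtype.ext (funext fun e => ?_)
    simp only [Submodule.coe_add, Pi.add_apply]
    have := hd e
    omega
  have hodd : ∀ e, Odd ((T ⟨y, hy.mem⟩).1 e) ↔ Odd ((T z).1 e) := by
    intro e
    rw [hsum, map_add, map_add]
    simp only [Submodule.coe_add, Pi.add_apply]
    rw [Int.odd_add]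
    simp
  calc (∑ e, if Odd ((T z).1 e) then C'.length e else 0)
      ≤ ∑ e, ((T ⟨y, hy.mem⟩).1 e : ℝ) ^ 2 * C'.length e := by
        refine Finset.sum_le_sum fun e _ => ?_
        split_ifs with ho
        · rw [← hodd] at ho
          have h0 : (T ⟨y, hy.mem⟩).1 e ≠ 0 := by
            intro h0
            simp [h0] at ho
          have h1 : (1 : ℤ) ≤ (T ⟨y, hy.mem⟩).1 e ^ 2 := by
            have := sq_pos_of_ne_zero h0
            omega
          have h2 : (1 : ℝ) ≤ ((T ⟨y, hy.mem⟩).1 e : ℝ) ^ 2 := by exact_mod_cast h1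
          nlinarith [C'.length_pos e]
        · exact mul_nonneg (sq_nonneg _) (C'.length_pos e).le
    _ = ∑ e, (y e : ℝ) ^ 2 * C.length e := hT _
    _ = ∑ e, if Odd (z.1 e) then C.length e else 0 := by
        refine Finset.sum_congr rfl fun e _ => ?_
        split_ifs with ho
        · rcases hy.on e ho with h | h <;> simp [h]
        · simp [hy.off e ho]

/-- The minimum of the form on the class of `z` modulo `2` is the length of the odd part of `z`, so
an isometry preserves that length. -/
theorem length_odd_eq_of_isometry {C : TropicalCurve.{u₁, v₁}} {C' : TropicalCurve.{u₂, v₂}}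
    (T : C.homology ℤ ≃+ C'.homology ℤ)
    (hT : ∀ z : C.homology ℤ,
      ∑ e, ((T z).1 e : ℝ) ^ 2 * C'.length e = ∑ e, (z.1 e : ℝ) ^ 2 * C.length e)
    (z : C.homology ℤ) :
    (∑ e, if Odd ((T z).1 e) then C'.length e else 0) =
      ∑ e, if Odd (z.1 e) then C.length e else 0 := by
  refine le_antisymm (length_odd_le_of_isometry T.toAddMonoidHom hT z) ?_
  have := length_odd_le_of_isometry T.symm.toAddMonoidHom (fun w => by
    have := hT (T.symm w)
    rw [T.apply_symm_apply] at this
    exact this.symm) (T z)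
  simpa using this

/-- The lengths of the edges with a given nontrivial parity character are determined by the isometry
class of the flow lattice: they are the coefficients of `z ↦ length of the odd part of z` as a
linear combination of characters, and distinct characters are linearly independent. -/
theorem sum_length_parityChar_eq {C : TropicalCurve.{u₁, v₁}} {C' : TropicalCurve.{u₂, v₂}}
    (T : C.homology ℤ ≃+ C'.homology ℤ)
    (hT : ∀ z : C.homology ℤ,
      ∑ e, ((T z).1 e : ℝ) ^ 2 * C'.length e = ∑ e, (z.1 e : ℝ) ^ 2 * C.length e)
    {χ : Multiplicative (C.homology ℤ) →* ℝ} (hχ : χ ≠ 1) :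
    ∑ e with C.parityChar e = χ, C.length e =
      ∑ e with (C'.parityChar e).comp (AddMonoidHom.toMultiplicative T.toAddMonoidHom) = χ,
        C'.length e := by
  set τ := AddMonoidHom.toMultiplicative T.toAddMonoidHom
  have hτ : ∀ e z, (C'.parityChar e).comp τ z =
      if Odd ((T z.toAdd).1 e) then -1 else 1 := fun e z => rfl
  -- in terms of the character `χ` of an edge, it contributes `l * (1 - χ z) / 2` to the length of
  -- the odd part of `z`; the constants are absorbed by the trivial character
  let a : (Multiplicative (C.homology ℤ) →* ℝ) →₀ ℝ :=
    ∑ e, Finsupp.single (C.parityChar e) (C.length e) -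
      ∑ e, Finsupp.single ((C'.parityChar e).comp τ) (C'.length e) +
      Finsupp.single 1 (∑ e, C'.length e - ∑ e, C.length e)
  have ha : a = 0 := by
    refine (linearIndependent_iff.1
      (linearIndependent_monoidHom (Multiplicative (C.homology ℤ)) ℝ)) a (funext fun z => ?_)
    have hz := length_odd_eq_of_isometry T hT z.toAdd
    have hite : ∀ (n : ℤ) (r : ℝ), r * (if Odd n then -1 else 1) =
        r - 2 * if Odd n then r else 0 := by
      intro n r
      split_ifs <;> ring
    simp only [a, map_add, map_sub, map_sum, Finsupp.linearCombination_single, Pi.add_apply,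
      Pi.sub_apply, Finset.sum_apply, Pi.smul_apply, smul_eq_mul, hτ, parityChar_apply, hite,
      Finset.sum_sub_distrib, ← Finset.mul_sum, MonoidHom.one_apply, Pi.zero_apply]
    rw [hz]
    ring
  have := congrArg (fun b => b χ) ha
  simp only [a, Finsupp.add_apply, Finsupp.sub_apply, Finsupp.finsetSum_apply,
    Finsupp.single_apply, Finsupp.zero_apply, if_neg (Ne.symm hχ), add_zero] at this
  rw [Finset.sum_filter, Finset.sum_filter]
  exact sub_eq_zero.1 this

/-! ### The bijection of C1-sets -/

theorem exists_parityChar_eq_of_isC1Transversal {C : TropicalCurve.{u, v}} {R : Set C.E}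
    (hR : C.toMultigraph.IsC1Transversal R) {e : C.E} (he : ¬ C.IsSeparating e) :
    ∃ f ∈ R, C.parityChar f = C.parityChar e := by
  obtain ⟨f, ⟨hf, hfR⟩, -⟩ := hR.2 _ ⟨e, he, rfl⟩
  exact ⟨f, hfR, ((mem_c1Class_iff C.connected he).1 hf).symm⟩

theorem eq_of_parityChar_eq_of_isC1Transversal {C : TropicalCurve.{u, v}} {R : Set C.E}
    (hR : C.toMultigraph.IsC1Transversal R) {e f : C.E} (he : e ∈ R) (hf : f ∈ R)
    (h : C.parityChar e = C.parityChar f) : e = f := by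
  have hes := hR.1 e he
  obtain ⟨g, -, hg⟩ := hR.2 _ ⟨e, hes, rfl⟩
  rw [hg e ⟨(mem_c1Class_iff C.connected hes).2 rfl, he⟩,
    hg f ⟨(mem_c1Class_iff C.connected hes).2 h, hf⟩]

/-- An isomorphism of Jacobians yields a bijection of the C1-sets that preserves the total lengths
and is compatible, modulo `2`, with an isomorphism of the groups of integral flows. -/
theorem exists_equiv_of_isomorphic {C : TropicalCurve.{u₁, v₁}} {C' : TropicalCurve.{u₂, v₂}}
    (h : C.jacobian.Isomorphic C'.jacobian) {R : Set C.E} {R' : Set C'.E}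
    (hR : C.toMultigraph.IsC1Transversal R) (hR' : C'.toMultigraph.IsC1Transversal R') :
    ∃ (T : C.homology ℤ ≃+ C'.homology ℤ) (φ : R ≃ R'),
      (∀ e, ∑ f with f ∈ C'.c1Class (φ e).1, C'.length f = ∑ f with f ∈ C.c1Class e.1, C.length f) ∧
      ∀ (z : C.homology ℤ) (e : R), Odd ((T z).1 (φ e).1) ↔ Odd (z.1 e.1) := by
  obtain ⟨T, hT⟩ := exists_addEquiv_of_isomorphic h
  have key := fun χ (hχ : χ ≠ 1) => sum_length_parityChar_eq T hT (χ := χ) hχ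
  set τ := AddMonoidHom.toMultiplicative T.toAddMonoidHom with hτ
  have hcancel : ∀ {χ₁ χ₂ : Multiplicative (C'.homology ℤ) →* ℝ}, χ₁.comp τ = χ₂.comp τ → χ₁ = χ₂ :=
    fun {χ₁ χ₂} h12 => (MonoidHom.cancel_right (f := τ) T.surjective).1 h12
  have hfwd : ∀ e : R, ∃ e' : R', (C'.parityChar e'.1).comp τ = C.parityChar e.1 := by
    intro e
    have hes := hR.1 e.1 e.2
    have hne : C.parityChar e.1 ≠ 1 := (parityChar_eq_one_iff_isSeparating C.connected).not.2 hes
    have hpos : 0 < ∑ f with C.parityChar f = C.parityChar e.1, C.length f :=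
      Finset.sum_pos (fun f _ => C.length_pos f) ⟨e.1, by simp⟩
    rw [key _ hne] at hpos
    obtain ⟨f, hf, -⟩ := Finset.exists_ne_zero_of_sum_ne_zero hpos.ne'
    have hf' := (Finset.mem_filter.1 hf).2
    have hfs : ¬ C'.IsSeparating f := by
      rw [← parityChar_eq_one_iff_isSeparating C'.connected]
      intro h1
      rw [h1, MonoidHom.one_comp] at hf'
      exact hne hf'.symm
    obtain ⟨g, hg, hgf⟩ := exists_parityChar_eq_of_isC1Transversal hR' hfs
    exact ⟨⟨g, hg⟩, by rw [hgf, hf']⟩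
  choose φ hφ using hfwd
  have hinj : Function.Injective φ := by
    intro e f hef
    refine Subtype.ext (eq_of_parityChar_eq_of_isC1Transversal hR e.2 f.2 ?_)
    rw [← hφ e, ← hφ f, hef]
  have hsurj : Function.Surjective φ := by
    intro e'
    have hes := hR'.1 e'.1 e'.2
    have hne : (C'.parityChar e'.1).comp τ ≠ 1 := by
      intro h1
      refine (parityChar_eq_one_iff_isSeparating C'.connected).not.2 hes (hcancel ?_)
      rw [h1, MonoidHom.one_comp]
    have hpos : 0 < ∑ f with (C'.parityChar f).comp τ = (C'.parityChar e'.1).comp τ, C'.length f :=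
      Finset.sum_pos (fun f _ => C'.length_pos f) ⟨e'.1, by simp⟩
    rw [← key _ hne] at hpos
    obtain ⟨f, hf, -⟩ := Finset.exists_ne_zero_of_sum_ne_zero hpos.ne'
    have hf' := (Finset.mem_filter.1 hf).2
    have hfs : ¬ C.IsSeparating f := by
      rw [← parityChar_eq_one_iff_isSeparating C.connected, hf']
      exact hne
    obtain ⟨g, hg, hgf⟩ := exists_parityChar_eq_of_isC1Transversal hR hfs
    refine ⟨⟨g, hg⟩, Subtype.ext (eq_of_parityChar_eq_of_isC1Transversal hR' (φ ⟨g, hg⟩).2 e'.2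
      (hcancel ?_))⟩
    rw [hφ, hgf, hf']
  have hbij : Function.Bijective φ := ⟨hinj, hsurj⟩
  refine ⟨T, Equiv.ofBijective φ hbij, fun e => ?_, fun z e => ?_⟩
  · rw [Equiv.ofBijective_apply]
    have h1 := key (C.parityChar e.1)
      ((parityChar_eq_one_iff_isSeparating C.connected).not.2 (hR.1 e.1 e.2))
    have hs : ∀ f, f ∈ C.c1Class e.1 ↔ C.parityChar f = C.parityChar e.1 := fun f => by
      rw [mem_c1Class_iff C.connected (hR.1 e.1 e.2), eq_comm]
    have hs' : ∀ f, f ∈ C'.c1Class (φ e).1 ↔ (C'.parityChar f).comp τ = C.parityChar e.1 :=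
      fun f => by
        rw [mem_c1Class_iff C'.connected (hR'.1 _ (φ e).2), ← hφ e]
        exact ⟨fun h => by rw [h], fun h => (hcancel h).symm⟩
    simp only [hs, hs']
    exact h1.symm
  · rw [Equiv.ofBijective_apply, ← ite_odd_eq_iff]
    exact DFunLike.congr_fun (hφ e) (Multiplicative.ofAdd z)

end TropicalCurve

namespace Multigraph

/-! ### Flows of contracted graphs -/

section Contraction

variable {G : Multigraph.{u, v}} {A : Type} [CommRing A] {R : Set G.E}

theorem sum_contractTo_pairing (c : G.E → A) (d : (G.contractTo R).E → A)
    (hcd : ∀ e : R, d e = c e.1) (f : (G.contractTo R).V → A) :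
    ∑ e, (f ((G.contractTo R).tgt e) - f ((G.contractTo R).src e)) * d e =
      ∑ e, (f (Quotient.mk (G.contractSetoid Rᶜ) (G.tgt e)) -
        f (Quotient.mk (G.contractSetoid Rᶜ) (G.src e))) * c e := by
  refine Fintype.sum_of_injective (Subtype.val : R → G.E) Subtype.val_injective _ _ ?_ ?_
  · intro e he
    have heR : e ∈ Rᶜ := fun h => he ⟨⟨e, h⟩, rfl⟩
    have : Quotient.mk (G.contractSetoid Rᶜ) (G.src e) =
        Quotient.mk (G.contractSetoid Rᶜ) (G.tgt e) :=
      Quotient.sound (s := G.contractSetoid Rᶜ) (Joined.of_edge heR)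
    rw [this, sub_self, zero_mul]
  · intro e
    rw [hcd e]
    rfl

theorem restrict_mem_homology {c : G.E → A} (hc : c ∈ G.homology A) :
    (fun e : R => c e.1) ∈ (G.contractTo R).homology A := by
  rw [mem_homology_iff_pairing] at hc
  refine (mem_homology_iff_pairing (G.contractTo R) A _).2 fun f => ?_
  rw [sum_contractTo_pairing c _ (fun _ => rfl) f]
  exact hc fun w => f (Quotient.mk (G.contractSetoid Rᶜ) w)

/-- Every flow of a contracted graph extends to a flow of the graph: the boundary of the extension
by zero has total `0` on each contracted piece, so it can be corrected along the contracted edges.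
-/
theorem exists_flow_of_contractTo {d : (G.contractTo R).E → A}
    (hd : d ∈ (G.contractTo R).homology A) :
    ∃ c ∈ G.homology A, ∀ e : R, c e.1 = d e := by
  let c₀ : G.E → A := fun e => if h : e ∈ R then d ⟨e, h⟩ else 0
  have hc₀ : ∀ e : R, d e = c₀ e.1 := fun e => by
    simp only [c₀, dif_pos e.2]
  set b := G.boundary A c₀ with hb
  let rep : G.V → G.V := fun w => (Quotient.mk (G.contractSetoid Rᶜ) w).out
  have hj : ∀ w, G.Joined Rᶜ (rep w) w := fun w =>
    Quotient.mk_out (s := G.contractSetoid Rᶜ) w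
  choose k hk hkb using fun w => (hj w).exists_chain A
  refine ⟨c₀ - ∑ w, b w • k w, ?_, fun e => ?_⟩
  · rw [homology, LinearMap.mem_ker, map_sub, map_sum, ← hb]
    simp only [map_smul, hkb]
    funext a
    simp only [Pi.sub_apply, Finset.sum_apply, Pi.smul_apply, smul_eq_mul, mul_sub,
      Finset.sum_sub_distrib, Pi.zero_apply]
    have h1 : ∑ w, b w * (Pi.single w (1 : A) : G.V → A) a = b a := by
      simp [Pi.single_apply]
    have h2 : ∑ w, b w * (Pi.single (rep w) (1 : A) : G.V → A) a = 0 := by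
      let f : (G.contractTo R).V → A :=
        fun q => (Pi.single (Quotient.out q) (1 : A) : G.V → A) a
      have h3 := (mem_homology_iff_pairing _ A d).1 hd f
      rw [sum_contractTo_pairing c₀ d hc₀ f] at h3
      rw [← h3, ← sum_mul_boundary G A c₀ fun w => (Pi.single (rep w) (1 : A) : G.V → A) a]
      exact Finset.sum_congr rfl fun w _ => mul_comm _ _
    rw [h1, h2]
    ring
  · have : ∀ w, k w e.1 = 0 := fun w => hk w e.1 fun h => h e.2
    simp [hc₀ e, this]

theorem flow_intCast_iff {x : G.E → ℝ} (hx : x ∈ G.homology ℝ) :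
    (∃ z ∈ G.homology ℤ, ∀ e, x e = (z e : ℝ)) ↔ ∀ e, ∃ n : ℤ, x e = n := by
  constructor
  · rintro ⟨z, -, hz⟩ e
    exact ⟨z e, hz e⟩
  · intro h
    choose z hz using h
    refine ⟨z, mem_homology_of_intCast ?_, hz⟩
    have : (fun e => (z e : ℝ)) = x := funext fun e => (hz e).symm
    rwa [this]

/-- If the edges outside `R` form a forest, then restriction to `R` identifies the flows of `G` with
those of the contracted graph, and the integral flows correspond to each other. -/
theorem exists_restrict_equiv (hR : ∀ S ⊆ Rᶜ, ¬ G.IsCycle S) :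
    ∃ ρ : G.homology ℝ ≃ₗ[ℝ] (G.contractTo R).homology ℝ,
      (∀ (x : G.homology ℝ) (e : R), (ρ x).1 e = x.1 e.1) ∧
      ∀ x : G.homology ℝ, (∀ e, ∃ n : ℤ, (ρ x).1 e = n) ↔ ∀ e, ∃ n : ℤ, x.1 e = n := by
  let ρ₀ : G.homology ℝ →ₗ[ℝ] (G.contractTo R).homology ℝ :=
    { toFun := fun x => ⟨fun e => x.1 e.1, restrict_mem_homology x.2⟩
      map_add' := fun x y => rfl
      map_smul' := fun a x => rfl }
  have hinj : Function.Injective ρ₀ := by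
    intro x y hxy
    refine Subtype.ext (eq_of_forall_not_isCycle x.2 y.2 hR fun e he => ?_)
    exact congrFun (congrArg Subtype.val hxy) ⟨e, not_not.1 he⟩
  have hsurj : Function.Surjective ρ₀ := by
    intro d
    obtain ⟨c, hc, hcd⟩ := exists_flow_of_contractTo d.2
    exact ⟨⟨c, hc⟩, Subtype.ext (funext hcd)⟩
  refine ⟨LinearEquiv.ofBijective ρ₀ ⟨hinj, hsurj⟩, fun _ _ => rfl, fun x => ⟨fun h => ?_,
    fun h e => h e.1⟩⟩
  obtain ⟨d, hd, hxd⟩ := (flow_intCast_iff (ρ₀ x).2).2 h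
  obtain ⟨c, hc, hcd⟩ := exists_flow_of_contractTo hd
  have : x.1 = fun e => (c e : ℝ) := by
    refine eq_of_forall_not_isCycle x.2 (intCast_mem_homology ℝ hc) hR fun e he => ?_
    have h1 : x.1 e = d ⟨e, not_not.1 he⟩ := hxd ⟨e, not_not.1 he⟩
    rw [h1, ← hcd]
  intro e
  exact ⟨c e, congrFun this e⟩

/-- On a C1-set, all flows have constant absolute value. -/
theorem sq_eq_of_mem_c1Class {e f : G.E} (he : ¬ G.IsSeparating e) (hf : f ∈ G.c1Class e)
    {x : G.E → A} (hx : x ∈ G.homology A) : x f ^ 2 = x e ^ 2 := by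
  obtain ⟨S, hS, heS⟩ := exists_isCycle_of_not_isSeparating he
  obtain ⟨y, hy, hye⟩ := hS.exists_isOrientation_eq_one heS
  have h0 : (x - x e • fun g => (y g : A)) f = 0 := by
    by_contra h
    obtain ⟨S', hS', hSc, hfS⟩ := exists_isCycle_of_ne_zero
      (sub_mem hx (Submodule.smul_mem _ (x e) (intCast_mem_homology A hy.mem))) h
    exact hS' ((hf.2 S' hSc).2 hfS) (by simp [hye])
  have hfS : (y f : A) * y f = 1 := by
    exact_mod_cast congrArg (Int.cast : ℤ → A) (hy.mul_self ((hf.2 S hS).1 heS))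
  have h1 : x f = x e * y f := by simpa [sub_eq_zero] using h0
  rw [h1, mul_pow, sq (y f : A), hfS, mul_one]

theorem IsC1Transversal.not_isCycle_of_subset_compl (hG : G.IsConnected)
    (hR : G.IsC1Transversal R) {S : Set G.E} (hS : S ⊆ Rᶜ) : ¬ G.IsCycle S := by
  intro hSc
  obtain ⟨e, he⟩ := hSc.1
  obtain ⟨f, ⟨hf, hfR⟩, -⟩ := hR.2 _ ⟨e, not_isSeparating_of_mem_isCycle hG hSc he, rfl⟩
  exact hS ((hf.2 S hSc).1 he) hfR

end Contraction

end Multigraph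

namespace TropicalCurve

open Multigraph

/-- The quadratic form can be computed on the `3`-edge-connectivization. -/
theorem sum_sq_mul_length_eq (C : TropicalCurve.{u, v}) {R : Set C.E}
    (hR : C.toMultigraph.IsC1Transversal R) {x : C.E → ℝ} (hx : x ∈ C.homology ℝ) :
    ∑ e, x e ^ 2 * C.length e =
      ∑ e : R, x e.1 ^ 2 * ∑ f with f ∈ C.c1Class e.1, C.length f := by
  simp only [Finset.sum_filter, Finset.mul_sum]
  rw [Finset.sum_comm]
  refine Finset.sum_congr rfl fun f _ => ?_
  by_cases hf : C.IsSeparating f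
  · have h0 : x f = 0 := by
      by_contra h
      exact not_isSeparating_of_flow C.connected hx h hf
    rw [h0, Finset.sum_eq_zero]
    · simp
    · intro e _
      rw [if_neg fun h => h.1 hf, mul_zero]
  · obtain ⟨e, ⟨he, heR⟩, huniq⟩ := hR.2 _ ⟨f, hf, rfl⟩
    rw [Finset.sum_eq_single ⟨e, heR⟩]
    · have hfe : f ∈ C.c1Class e := ⟨hf, fun S hS => (he.2 S hS).symm⟩
      rw [if_pos hfe, sq_eq_of_mem_c1Class he.1 hfe hx]
    · intro e' _ hne
      rw [if_neg, mul_zero]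
      intro h
      exact hne (Subtype.ext (huniq e'.1 ⟨⟨hR.1 _ e'.2, fun S hS => (h.2 S hS).symm⟩, e'.2⟩))
    · simp

end TropicalCurve

/-! ### Signs on a bipartite graph -/

section Switching

variable {α β : Type*}

theorem exists_seq_of_reflTransGen {N : β → β → Prop} {b b' : β} (h : Relation.ReflTransGen N b b') :
    ∃ (k : ℕ) (p : ℕ → β), p 0 = b ∧ p k = b' ∧ ∀ i < k, N (p i) (p (i + 1)) := by
  induction h with
  | refl => exact ⟨0, fun _ => b, rfl, rfl, by simp⟩
  | @tail c d _ hcd ih =>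
    obtain ⟨k, p, h0, hk, hp⟩ := ih
    refine ⟨k + 1, fun i => if i ≤ k then p i else d, by simpa using h0, by simp, fun i hi => ?_⟩
    rcases Nat.lt_succ_iff_lt_or_eq.1 hi with h | rfl
    · simpa [h.le, Nat.succ_le_of_lt h] using hp i h
    · simpa [hk] using hcd

/-- Signs `s a b = ±1` on the edges of a bipartite graph, with product `1` on every cycle that is an
induced subgraph. If they are a coboundary on the edges at `K`, then, up to this coboundary, the
signs at another vertex `a₀` are constant on the connected components of the edges at `K`: a
shortest path that violates this would close up to an induced cycle through `a₀`. -/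
theorem sign_eq_of_joined (M : α → β → Prop) (s : α → β → ℤˣ)
    (h : ∀ (A : Finset α) (B : Finset β), (∀ a ∈ A, (B.filter (M a)).card = 2) →
      (∀ b ∈ B, (A.filter (M · b)).card = 2) → ∏ a ∈ A, ∏ b ∈ B with M a b, s a b = 1)
    {K : Finset α} {a₀ : α} (ha₀ : a₀ ∉ K) {η : α → ℤˣ} {θ : β → ℤˣ}
    (hK : ∀ a ∈ K, ∀ b, M a b → s a b = η a * θ b) {b b' : β}
    (hbb : Relation.ReflTransGen (fun b b' => ∃ a ∈ K, M a b ∧ M a b') b b')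
    (hb : M a₀ b) (hb' : M a₀ b') : s a₀ b * θ b = s a₀ b' * θ b' := by
  set N : β → β → Prop := fun b b' => ∃ a ∈ K, M a b ∧ M a b' with hN
  set r : β → ℤˣ := fun b => s a₀ b * θ b with hr
  change r b = r b'
  by_contra hne
  let P : ℕ → Prop := fun k => ∃ p : ℕ → β, M a₀ (p 0) ∧ M a₀ (p k) ∧ r (p 0) ≠ r (p k) ∧
    ∀ i < k, N (p i) (p (i + 1))
  have hP : ∃ k, P k := by
    obtain ⟨k, p, rfl, rfl, hp⟩ := exists_seq_of_reflTransGen hbb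
    exact ⟨k, p, hb, hb', hne, hp⟩
  obtain ⟨k, ⟨p, h0, hk, hrk, hp⟩, hmin⟩ : ∃ k, P k ∧ ∀ j < k, ¬ P j :=
    ⟨Nat.find hP, Nat.find_spec hP, fun j hj => Nat.find_min hP hj⟩
  have hkpos : 0 < k := by
    rcases Nat.eq_zero_or_pos k with rfl | hk0
    · exact absurd rfl hrk
    · exact hk0
  -- an interior vertex next to `a₀` would give a shorter violation on one of its two sides
  have hint : ∀ i, 0 < i → i < k → ¬ M a₀ (p i) := by
    intro i hi0 hik hi
    by_cases hri : r (p 0) = r (p i)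
    · refine hmin (k - i) (by omega) ⟨fun m => p (m + i), by simpa using hi, ?_, ?_, fun m hm => ?_⟩
      · simpa [Nat.sub_add_cancel hik.le] using hk
      · simpa [Nat.sub_add_cancel hik.le, ← hri] using hrk
      · have := hp (m + i) (by omega)
        rwa [show m + i + 1 = m + 1 + i by ring] at this
    · exact hmin i hik ⟨p, h0, hi, hri, fun m hm => hp m (hm.trans hik)⟩
  -- a chord would be a shortcut
  have hchord : ∀ i j, i < j → j ≤ k → N (p i) (p j) → j = i + 1 := by
    intro i j hij hjk hNij
    by_contra hji
    refine hmin (k - (j - i - 1)) (by omega)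
      ⟨fun m => if m ≤ i then p m else p (m + (j - i - 1)), by simpa using h0, ?_, ?_, fun m hm => ?_⟩
    · dsimp only
      rw [if_neg (by omega), Nat.sub_add_cancel (by omega)]
      exact hk
    · dsimp only
      rw [if_pos (Nat.zero_le i), if_neg (by omega), Nat.sub_add_cancel (by omega)]
      exact hrk
    · dsimp only
      rcases lt_trichotomy m i with hmi | rfl | hmi
      · rw [if_pos hmi.le, if_pos (by omega)]
        exact hp m (by omega)
      · rw [if_pos le_rfl, if_neg (by omega), show m + 1 + (j - m - 1) = j by omega]
        exact hNij
      · rw [if_neg (by omega), if_neg (by omega),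
          show m + 1 + (j - i - 1) = m + (j - i - 1) + 1 by omega]
        exact hp _ (by omega)
  have hpinj : ∀ i j, i < j → j ≤ k → p i ≠ p j := by
    intro i j hij hjk heq
    rcases hjk.lt_or_eq with hjk | rfl
    · have := hchord i (j + 1) (by omega) hjk (heq ▸ hp j hjk)
      omega
    · rcases Nat.eq_zero_or_pos i with rfl | hi
      · exact hrk (by rw [heq])
      · exact hint i hi hij (heq ▸ hk)
  -- the vertices `a i` between `p i` and `p (i + 1)` complete the path to an induced cycle through
  -- `a₀`
  have hpex : ∀ i, ∃ a, i < k → a ∈ K ∧ M a (p i) ∧ M a (p (i + 1)) := by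
    intro i
    by_cases hi : i < k
    · obtain ⟨a, ha⟩ := hp i hi
      exact ⟨a, fun _ => ha⟩
    · exact ⟨a₀, fun h => absurd h hi⟩
  choose a ha using hpex
  have haM : ∀ i j, i < k → j ≤ k → (M (a i) (p j) ↔ j = i ∨ j = i + 1) := by
    intro i j hi hj
    constructor
    · intro hM
      by_contra hcon
      rcases lt_or_gt_of_ne (show j ≠ i by omega) with hlt | hgt
      · have := hchord j (i + 1) (by omega) hi ⟨a i, (ha i hi).1, hM, (ha i hi).2.2⟩
        omega
      · have := hchord i j hgt hj ⟨a i, (ha i hi).1, (ha i hi).2.1, hM⟩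
        omega
    · rintro (rfl | rfl)
      · exact (ha j hi).2.1
      · exact (ha i hi).2.2
  have hainj : ∀ i j, i < k → j < k → a i = a j → i = j := by
    intro i j hi hj hij
    have h1 := (haM i j hi hj.le).1 (hij ▸ (ha j hj).2.1)
    have h2 := (haM i (j + 1) hi hj).1 (hij ▸ (ha j hj).2.2)
    omega
  have haa₀ : ∀ i < k, a i ≠ a₀ := fun i hi heq => ha₀ (heq ▸ (ha i hi).1)
  have ha₀M : ∀ j ≤ k, (M a₀ (p j) ↔ j = 0 ∨ j = k) := by
    intro j hj
    constructor
    · intro hM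
      by_contra hcon
      exact hint j (by omega) (by omega) hM
    · rintro (rfl | rfl)
      exacts [h0, hk]
  set B := (Finset.range (k + 1)).image p with hB
  set A₁ := (Finset.range k).image a with hA₁
  have ha₀A : a₀ ∉ A₁ := by
    simp only [hA₁, Finset.mem_image, Finset.mem_range, not_exists, not_and]
    exact haa₀
  have hfa₀ : B.filter (M a₀) = {p 0, p k} := by
    ext b
    simp only [hB, Finset.mem_filter, Finset.mem_image, Finset.mem_range, Finset.mem_insert,
      Finset.mem_singleton]
    constructor
    · rintro ⟨⟨j, hj, rfl⟩, hM⟩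
      rcases (ha₀M j (by omega)).1 hM with rfl | rfl
      exacts [Or.inl rfl, Or.inr rfl]
    · rintro (rfl | rfl)
      exacts [⟨⟨0, by omega, rfl⟩, h0⟩, ⟨⟨k, by omega, rfl⟩, hk⟩]
  have hfa : ∀ i < k, B.filter (M (a i)) = {p i, p (i + 1)} := by
    intro i hi
    ext b
    simp only [hB, Finset.mem_filter, Finset.mem_image, Finset.mem_range, Finset.mem_insert,
      Finset.mem_singleton]
    constructor
    · rintro ⟨⟨j, hj, rfl⟩, hM⟩
      rcases (haM i j hi (by omega)).1 hM with rfl | rfl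
      exacts [Or.inl rfl, Or.inr rfl]
    · rintro (rfl | rfl)
      exacts [⟨⟨i, by omega, rfl⟩, (ha i hi).2.1⟩, ⟨⟨i + 1, by omega, rfl⟩, (ha i hi).2.2⟩]
  have hprod := h (insert a₀ A₁) B ?_ ?_
  · rw [Finset.prod_insert ha₀A, hfa₀, Finset.prod_pair (hpinj 0 k hkpos le_rfl), hA₁,
      Finset.prod_image (fun i hi j hj => hainj i j (Finset.mem_range.1 hi) (Finset.mem_range.1 hj)),
      Finset.prod_congr rfl (g := fun i => θ (p i) * θ (p (i + 1)))] at hprod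
    · have htel : ∀ n, ∏ i ∈ Finset.range n, θ (p i) * θ (p (i + 1)) = θ (p 0) * θ (p n) := by
        intro n
        induction n with
        | zero => simp [Int.units_mul_self]
        | succ n ih =>
          rw [Finset.prod_range_succ, ih]
          calc θ (p 0) * θ (p n) * (θ (p n) * θ (p (n + 1)))
              = θ (p 0) * (θ (p n) * θ (p n)) * θ (p (n + 1)) := by simp only [mul_assoc]
            _ = _ := by rw [Int.units_mul_self, mul_one]
      rw [htel] at hprod
      have h1 : r (p 0) * r (p k) = 1 := by
        rw [← hprod]
        exact mul_mul_mul_comm _ _ _ _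
      refine hrk ?_
      rw [← mul_one (r (p 0)), ← Int.units_mul_self (r (p k)), ← mul_assoc, h1, one_mul]
    · intro i hi
      have hi := Finset.mem_range.1 hi
      rw [hfa i hi, Finset.prod_pair (hpinj i (i + 1) (by omega) hi),
        hK _ (ha i hi).1 _ (ha i hi).2.1, hK _ (ha i hi).1 _ (ha i hi).2.2]
      calc η (a i) * θ (p i) * (η (a i) * θ (p (i + 1)))
          = (η (a i) * η (a i)) * (θ (p i) * θ (p (i + 1))) := mul_mul_mul_comm _ _ _ _
        _ = _ := by rw [Int.units_mul_self, one_mul]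
  · intro c hc
    rcases Finset.mem_insert.1 hc with rfl | hc
    · rw [hfa₀]
      exact Finset.card_pair (hpinj 0 k hkpos le_rfl)
    · obtain ⟨i, hi, rfl⟩ := Finset.mem_image.1 hc
      have hi := Finset.mem_range.1 hi
      rw [hfa i hi]
      exact Finset.card_pair (hpinj i (i + 1) (by omega) hi)
  · intro b hb
    obtain ⟨j, hj, rfl⟩ := Finset.mem_image.1 hb
    have hj : j ≤ k := Nat.lt_succ_iff.1 (Finset.mem_range.1 hj)
    have hmem : ∀ c, c ∈ (insert a₀ A₁).filter (M · (p j)) ↔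
        (c = a₀ ∧ (j = 0 ∨ j = k)) ∨ ∃ i < k, a i = c ∧ (j = i ∨ j = i + 1) := by
      intro c
      simp only [hA₁, Finset.mem_filter, Finset.mem_insert, Finset.mem_image, Finset.mem_range]
      constructor
      · rintro ⟨rfl | ⟨i, hi, rfl⟩, hM⟩
        · exact Or.inl ⟨rfl, (ha₀M j hj).1 hM⟩
        · exact Or.inr ⟨i, hi, rfl, (haM i j hi hj).1 hM⟩
      · rintro (⟨rfl, hj'⟩ | ⟨i, hi, rfl, hj'⟩)
        · exact ⟨Or.inl rfl, (ha₀M j hj).2 hj'⟩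
        · exact ⟨Or.inr ⟨i, hi, rfl⟩, (haM i j hi hj).2 hj'⟩
    rw [Finset.card_eq_two]
    rcases Nat.eq_zero_or_pos j with rfl | hj0
    · refine ⟨a₀, a 0, (haa₀ 0 hkpos).symm, ?_⟩
      ext c
      rw [hmem, Finset.mem_insert, Finset.mem_singleton]
      constructor
      · rintro (⟨rfl, -⟩ | ⟨i, hi, rfl, hi'⟩)
        · exact Or.inl rfl
        · obtain rfl : i = 0 := by omega
          exact Or.inr rfl
      · rintro (rfl | rfl)
        exacts [Or.inl ⟨rfl, Or.inl rfl⟩, Or.inr ⟨0, hkpos, rfl, Or.inl rfl⟩]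
    rcases hj.lt_or_eq with hjk | rfl
    · refine ⟨a (j - 1), a j, fun heq => ?_, ?_⟩
      · have := hainj _ _ (by omega) hjk heq
        omega
      · ext c
        rw [hmem, Finset.mem_insert, Finset.mem_singleton]
        constructor
        · rintro (⟨rfl, h'⟩ | ⟨i, hi, rfl, rfl | rfl⟩)
          · omega
          · exact Or.inr rfl
          · exact Or.inl rfl
        · rintro (rfl | rfl)
          · exact Or.inr ⟨j - 1, by omega, rfl, Or.inr (by omega)⟩
          · exact Or.inr ⟨j, hjk, rfl, Or.inl rfl⟩
    · refine ⟨a₀, a (j - 1), (haa₀ _ (by omega)).symm, ?_⟩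
      ext c
      rw [hmem, Finset.mem_insert, Finset.mem_singleton]
      constructor
      · rintro (⟨rfl, -⟩ | ⟨i, hi, rfl, hi'⟩)
        · exact Or.inl rfl
        · obtain rfl : i = j - 1 := by omega
          exact Or.inr rfl
      · rintro (rfl | rfl)
        exacts [Or.inl ⟨rfl, Or.inr rfl⟩, Or.inr ⟨j - 1, by omega, rfl, Or.inr (by omega)⟩]

/-- Signs on the edges of a finite bipartite graph whose product is `1` on every induced cycle form
a coboundary. -/
theorem exists_switching [Finite α] (M : α → β → Prop) (s : α → β → ℤˣ)
    (h : ∀ (A : Finset α) (B : Finset β), (∀ a ∈ A, (B.filter (M a)).card = 2) →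
      (∀ b ∈ B, (A.filter (M · b)).card = 2) → ∏ a ∈ A, ∏ b ∈ B with M a b, s a b = 1) :
    ∃ (η : α → ℤˣ) (θ : β → ℤˣ), ∀ a b, M a b → s a b = η a * θ b := by
  have := Fintype.ofFinite α
  suffices hK : ∀ K : Finset α, ∃ (η : α → ℤˣ) (θ : β → ℤˣ),
      ∀ a ∈ K, ∀ b, M a b → s a b = η a * θ b by
    obtain ⟨η, θ, hηθ⟩ := hK Finset.univ
    exact ⟨η, θ, fun a => hηθ a (Finset.mem_univ a)⟩
  intro K
  induction K using Finset.induction_on with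
  | empty => exact ⟨1, 1, by simp⟩
  | insert a₀ K ha₀ ih =>
  obtain ⟨η, θ, hηθ⟩ := ih
  let Rel := Relation.ReflTransGen (fun b b' => ∃ a ∈ K, M a b ∧ M a b')
  have hstd : Std.Symm fun b b' => ∃ a ∈ K, M a b ∧ M a b' :=
    ⟨fun _ _ ⟨a, ha, h1, h2⟩ => ⟨a, ha, h2, h1⟩⟩
  have hsymm : ∀ {b b'}, Rel b b' → Rel b' b := fun {b b'} hbb =>
    Relation.ReflTransGen.stdSymm.symm _ _ hbb
  -- `κ b` is the common value of `s a₀ b₁ * θ b₁` on the neighbours `b₁` of `a₀` in the component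
  -- of `b`, if there are any; switching by `κ` on all components corrects the signs at `a₀`
  let g : (β → Prop) → ℤˣ := fun Q => if hQ : ∃ b, Q b then s a₀ hQ.choose * θ hQ.choose else 1
  let κ : β → ℤˣ := fun b => g fun b₁ => M a₀ b₁ ∧ Rel b b₁
  have hκ : ∀ {b b'}, Rel b b' → κ b = κ b' := by
    intro b b' hbb
    have : (fun b₁ => M a₀ b₁ ∧ Rel b b₁) = fun b₁ => M a₀ b₁ ∧ Rel b' b₁ := by
      funext b₁
      exact propext (and_congr_right fun _ => ⟨fun h => (hsymm hbb).trans h, fun h => hbb.trans h⟩)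
    simp only [κ, this]
  have hκ₀ : ∀ b, M a₀ b → κ b = s a₀ b * θ b := by
    intro b hb
    have hQ : ∃ b₁, M a₀ b₁ ∧ Rel b b₁ := ⟨b, hb, Relation.ReflTransGen.refl⟩
    simp only [κ, g, dif_pos hQ]
    exact (sign_eq_of_joined M s h ha₀ hηθ hQ.choose_spec.2 hb hQ.choose_spec.1).symm
  refine ⟨fun a => if a = a₀ then 1 else η a * g fun b₁ => M a₀ b₁ ∧ ∃ b, M a b ∧ Rel b b₁,
    fun b => θ b * κ b, fun a ha b hab => ?_⟩
  rcases Finset.mem_insert.1 ha with rfl | haK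
  · simp only [if_true, one_mul, hκ₀ b hab]
    rw [mul_comm (s a b), ← mul_assoc, Int.units_mul_self, one_mul]
  · have hne : a ≠ a₀ := fun h => ha₀ (h ▸ haK)
    have hκa : (g fun b₁ => M a₀ b₁ ∧ ∃ b, M a b ∧ Rel b b₁) = κ b := by
      have : (fun b₁ => M a₀ b₁ ∧ ∃ b, M a b ∧ Rel b b₁) = fun b₁ => M a₀ b₁ ∧ Rel b b₁ := by
        funext b₁
        refine propext (and_congr_right fun _ => ⟨?_, fun h => ⟨b, hab, h⟩⟩)
        rintro ⟨b', hab', h⟩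
        exact (Relation.ReflTransGen.single ⟨a, haK, hab, hab'⟩).trans h
      simp only [κ, this]
    simp only [if_neg hne, hκa, hηθ a haK b hab]
    calc η a * θ b = η a * θ b * (κ b * κ b) := by rw [Int.units_mul_self, mul_one]
      _ = _ := by simp only [mul_assoc, mul_comm (θ b)]

end Switching

namespace Multigraph

/-! ### Graphs with the same cycles have the same flows up to signs -/

section Signs

/-- A system of fundamental cycles of `G`, indexed by `ι`: the edge `p i` lies in the `i`-th cycle
only, with value `1` in its orientation `γ i`, and the edges not of the form `p i` form a forest. -/
structure FundamentalSystem (G : Multigraph.{u, v}) {ι : Type*} (p : ι → G.E) (S : ι → Set G.E)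
    (γ : ι → G.E → ℤ) : Prop where
  isOrientation : ∀ i, G.IsOrientation (S i) (γ i)
  apply_self : ∀ i, γ i (p i) = 1
  apply_ne : ∀ i j, j ≠ i → γ i (p j) = 0
  forest : ∀ T ⊆ (Set.range p)ᶜ, ¬ G.IsCycle T

variable {G : Multigraph.{u, v}} {ι : Type*} {p : ι → G.E} {S : ι → Set G.E} {γ : ι → G.E → ℤ}

theorem FundamentalSystem.eq_sum [Fintype ι] (h : G.FundamentalSystem p S γ) {A : Type}
    [CommRing A] {x : G.E → A} (hx : x ∈ G.homology A) (e : G.E) :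
    x e = ∑ i, x (p i) * γ i e := by
  have hsum : (∑ i, x (p i) • fun e => (γ i e : A)) ∈ G.homology A :=
    Submodule.sum_mem _ fun i _ => Submodule.smul_mem _ _ (intCast_mem_homology A
      (h.isOrientation i).mem)
  have := eq_of_forall_not_isCycle hx hsum h.forest fun e he => by
    obtain ⟨i, rfl⟩ := not_not.1 he
    rw [Finset.sum_apply, Finset.sum_eq_single i]
    · simp [h.apply_self]
    · intro j _ hj
      simp [h.apply_ne j i hj.symm]
    · simp
  have h2 := congrFun this e
  simpa [Finset.sum_apply] using h2

/-- The fundamental cycles in a sum can be reoriented so that the new sum vanishes wherever the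
original one is even: take the orientation of the odd part of the sum. -/
theorem FundamentalSystem.exists_signs [Fintype ι] (h : G.FundamentalSystem p S γ) (A : Finset ι) :
    ∃ w : ι → ℤ, (∀ i ∈ A, w i = 1 ∨ w i = -1) ∧
      ∀ e, Even (∑ i ∈ A, γ i e) → ∑ i ∈ A, w i * γ i e = 0 := by
  have hmem : (∑ i ∈ A, γ i) ∈ G.homology ℤ :=
    Submodule.sum_mem _ fun i _ => (h.isOrientation i).mem
  obtain ⟨y, hy⟩ := exists_isOrientation_odd hmem
  have hval : ∀ j, (∑ i ∈ A, γ i) (p j) = if j ∈ A then 1 else 0 := by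
    intro j
    rw [Finset.sum_apply]
    split_ifs with hj
    · rw [Finset.sum_eq_single_of_mem j hj fun i _ hi => h.apply_ne i j hi.symm, h.apply_self]
    · exact Finset.sum_eq_zero fun i hi => h.apply_ne i j fun hji => hj (hji ▸ hi)
  refine ⟨fun i => y (p i), fun i hi => hy.on _ ?_, fun e he => ?_⟩
  · change Odd ((∑ i ∈ A, γ i) (p i))
    rw [hval, if_pos hi]
    exact odd_one
  · have h0 : y e = 0 := hy.off e fun ho => by
      have ho' : Odd ((∑ i ∈ A, γ i) e) := ho
      rw [Finset.sum_apply] at ho'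
      exact Int.not_odd_iff_even.2 he ho'
    rw [h.eq_sum hy.mem] at h0
    rw [← h0]
    refine Finset.sum_subset (Finset.subset_univ A) fun i _ hi => ?_
    dsimp only
    rw [hy.off (p i), zero_mul]
    change ¬ Odd ((∑ i ∈ A, γ i) (p i))
    rw [hval, if_neg hi]
    simp

theorem IsOrientation.even_add_of_mem {S T : Set G.E} {y z : G.E → ℤ} (hy : G.IsOrientation S y)
    (hz : G.IsOrientation T z) {e : G.E} (hS : e ∈ S) (hT : e ∈ T) : Even (y e + z e) := by
  rcases hy.on e hS with h1 | h1 <;> rcases hz.on e hT with h2 | h2 <;> simp [h1, h2]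

/-- In a maximal forest, every further edge closes a cycle. -/
theorem exists_maximal_forest (G : Multigraph.{u, v}) :
    ∃ T : Set G.E, (∀ S ⊆ T, ¬ G.IsCycle S) ∧ ∀ e ∉ T, ∃ S ⊆ insert e T, G.IsCycle S ∧ e ∈ S := by
  let P : Finset (Set G.E) := Finset.univ.filter fun T => ∀ S ⊆ T, ¬ G.IsCycle S
  obtain ⟨T, hT, hmax⟩ := P.exists_max_image Set.ncard ⟨∅, by
    simp only [P, Finset.mem_filter, Finset.mem_univ, true_and]
    intro S hS hSc
    exact hSc.1.ne_empty (Set.subset_empty_iff.1 hS)⟩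
  simp only [P, Finset.mem_filter, Finset.mem_univ, true_and] at hT hmax
  refine ⟨T, hT, fun e he => ?_⟩
  by_contra! hcon
  have := hmax (insert e T) fun S hS hSc => by
    refine hT S (fun f hf => (hS hf).resolve_left ?_) hSc
    rintro rfl
    exact hcon S hS hSc hf
  rw [Set.ncard_insert_of_notMem he] at this
  omega

/-- A bijection of edges that induces a bijection of cycles respects flows, after the signs of the
values on some edges are changed. -/
theorem exists_signs_of_isCycle_iff {G : Multigraph.{u₁, v₁}} {G' : Multigraph.{u₂, v₂}}
    (φ : G.E ≃ G'.E) (hφ : ∀ S : Set G.E, G.IsCycle S ↔ G'.IsCycle (φ '' S)) :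
    ∃ ε : G.E → ℤˣ, ∀ (A : Type) [CommRing A] (x : G.E → A) (x' : G'.E → A),
      (∀ e, x' (φ e) = ((ε e : ℤ) : A) * x e) → (x ∈ G.homology A ↔ x' ∈ G'.homology A) := by
  obtain ⟨T, hT, hTmax⟩ := G.exists_maximal_forest
  let ι := {e : G.E // e ∉ T}
  choose S hST hSc hmem using fun i : ι => hTmax i.1 i.2
  choose γ hγ hγ1 using fun i : ι => (hSc i).exists_isOrientation_eq_one (hmem i)
  choose γ' hγ' hγ1' using fun i : ι => ((hφ (S i)).1 (hSc i)).exists_isOrientation_eq_one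
    (Set.mem_image_of_mem φ (hmem i))
  have hnot : ∀ i j : ι, j ≠ i → j.1 ∉ S i := by
    intro i j hij h
    rcases hST i h with h | h
    · exact hij (Subtype.ext h)
    · exact j.2 h
  have hF : G.FundamentalSystem (fun i : ι => i.1) S γ :=
    { isOrientation := hγ
      apply_self := hγ1
      apply_ne := fun i j hij => (hγ i).off _ (hnot i j hij)
      forest := fun X hX => hT X fun e he => by
        by_contra h
        exact hX he ⟨⟨e, h⟩, rfl⟩ }
  have hF' : G'.FundamentalSystem (fun i : ι => φ i.1) (fun i => φ '' S i) γ' :=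
    { isOrientation := hγ'
      apply_self := hγ1'
      apply_ne := fun i j hij => (hγ' i).off _ fun h =>
        hnot i j hij ((Function.Injective.mem_set_image φ.injective).1 h)
      forest := fun X hX hXc => by
        have hXφ : φ '' (φ ⁻¹' X) = X := Set.image_preimage_eq X φ.surjective
        rw [← hXφ, ← hφ] at hXc
        refine hT _ (fun e he => ?_) hXc
        by_contra h
        exact hX he ⟨⟨e, h⟩, rfl⟩ }
  -- `M` relates a fundamental cycle to the edges of the forest on it; on each such pair `s`
  -- compares the two orientations
  obtain ⟨M, hM⟩ : ∃ M : ι → G.E → Prop, ∀ i e, M i e ↔ e ∈ T ∧ e ∈ S i := ⟨_, fun _ _ => Iff.rfl⟩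
  let s : ι → G.E → ℤˣ := fun i e => if γ i e * γ' i (φ e) = 1 then 1 else -1
  have hs : ∀ i e, e ∈ S i → (s i e : ℤ) = γ i e * γ' i (φ e) := by
    intro i e he
    rcases (hγ i).on e he with h1 | h1 <;>
      rcases (hγ' i).on (φ e) (Set.mem_image_of_mem φ he) with h2 | h2 <;> simp [s, h1, h2]
  obtain ⟨η, θ, hηθ⟩ := exists_switching M s (by
    intro A B hA hB
    -- both reorientations vanish on `B`, so on each `b ∈ B` the two terms cancel
    obtain ⟨w, hw, hw0⟩ := hF.exists_signs A
    obtain ⟨w', hw', hw0'⟩ := hF'.exists_signs A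
    have hcol : ∀ b ∈ B, ∏ a ∈ A with M a b, (s a b : ℤ) = ∏ a ∈ A with M a b, w a * w' a := by
      intro b hb
      have hsub : ∀ f : ι → ℤ, (∀ a ∈ A, ¬ M a b → f a = 0) →
          ∑ a ∈ A, f a = ∑ a ∈ A with M a b, f a := by
        intro f hf
        rw [Finset.sum_filter]
        refine Finset.sum_congr rfl fun a ha => ?_
        split_ifs with hMa
        · rfl
        · exact hf a ha hMa
      obtain ⟨a, a', haa', hpair⟩ := Finset.card_eq_two.1 (hB b hb)
      have haA : a ∈ A ∧ b ∈ T ∧ b ∈ S a := by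
        have : a ∈ ({a, a'} : Finset ι) := by simp
        rw [← hpair, Finset.mem_filter, hM] at this
        exact this
      have haA' : a' ∈ A ∧ b ∈ T ∧ b ∈ S a' := by
        have : a' ∈ ({a, a'} : Finset ι) := by simp
        rw [← hpair, Finset.mem_filter, hM] at this
        exact this
      have hbT : b ∈ T := haA.2.1
      have hoff : ∀ i, ¬ M i b → b ∉ S i := fun i hi h => hi ((hM i b).2 ⟨hbT, h⟩)
      have hoff' : ∀ i, ¬ M i b → φ b ∉ φ '' S i := fun i hi h =>
        hoff i hi ((Function.Injective.mem_set_image φ.injective).1 h)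
      have e1 : w a * γ a b + w a' * γ a' b = 0 := by
        have := hw0 b (by
          rw [hsub _ fun i _ hi => (hγ i).off b (hoff i hi), hpair, Finset.sum_pair haa']
          exact (hγ a).even_add_of_mem (hγ a') haA.2.2 haA'.2.2)
        rwa [hsub _ fun i _ hi => by rw [(hγ i).off b (hoff i hi), mul_zero], hpair,
          Finset.sum_pair haa'] at this
      have e2 : w' a * γ' a (φ b) + w' a' * γ' a' (φ b) = 0 := by
        have := hw0' (φ b) (by
          rw [hsub _ fun i _ hi => (hγ' i).off _ (hoff' i hi), hpair, Finset.sum_pair haa']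
          exact (hγ' a).even_add_of_mem (hγ' a') (Set.mem_image_of_mem φ haA.2.2)
            (Set.mem_image_of_mem φ haA'.2.2))
        rwa [hsub _ fun i _ hi => by rw [(hγ' i).off _ (hoff' i hi), mul_zero], hpair,
          Finset.sum_pair haa'] at this
      rw [hpair, Finset.prod_pair haa', Finset.prod_pair haa', hs a b haA.2.2, hs a' b haA'.2.2]
      have hwa : w a * w a = 1 := by rcases hw a haA.1 with h | h <;> simp [h]
      have hwa' : w' a * w' a = 1 := by rcases hw' a haA.1 with h | h <;> simp [h]
      have hg := (hγ a').mul_self haA'.2.2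
      have hg' := (hγ' a').mul_self (Set.mem_image_of_mem φ haA'.2.2)
      have h1 : γ a b = -(w a * w a' * γ a' b) := by linear_combination w a * e1 - γ a b * hwa
      have h2 : γ' a (φ b) = -(w' a * w' a' * γ' a' (φ b)) := by
        linear_combination w' a * e2 - γ' a (φ b) * hwa'
      rw [h1, h2]
      linear_combination (w a * w a' * w' a * w' a') *
        (γ' a' (φ b) * γ' a' (φ b) * hg + hg')
    have hswap : ∀ f : ι → G.E → ℤ, ∏ a ∈ A, ∏ b ∈ B with M a b, f a b =
        ∏ b ∈ B, ∏ a ∈ A with M a b, f a b := by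
      intro f
      simp only [Finset.prod_filter]
      exact Finset.prod_comm
    apply Units.ext
    push_cast
    rw [hswap, Finset.prod_congr rfl hcol, ← hswap]
    refine Finset.prod_eq_one fun a ha => ?_
    rw [Finset.prod_const, hA a ha]
    rcases hw a ha with h1 | h1 <;> rcases hw' a ha with h2 | h2 <;> simp [h1, h2])
  let ε : G.E → ℤˣ := fun e => if h : e ∉ T then η ⟨e, h⟩ else θ e
  have hεε : ∀ e, (ε e : ℤ) * ε e = 1 := fun e => by
    rw [← Units.val_mul, Int.units_mul_self, Units.val_one]
  have hηη : ∀ i, (η i : ℤ) * η i = 1 := fun i => by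
    rw [← Units.val_mul, Int.units_mul_self, Units.val_one]
  have hεi : ∀ i : ι, ε i.1 = η i := fun i => by
    simp only [ε]
    rw [dif_pos i.2]
  -- the signs transform each fundamental cycle into plus or minus its counterpart
  have hkey : ∀ i e, γ' i (φ e) = (ε e : ℤ) * η i * γ i e := by
    intro i e
    by_cases he : e ∈ S i
    · by_cases heT : e ∈ T
      · have h1 := hs i e he
        rw [hηθ i e ((hM i e).2 ⟨heT, he⟩), Units.val_mul] at h1
        have h2 : ε e = θ e := by simp only [ε, heT, not_true, dif_neg, not_false_eq_true]
        rw [h2, mul_comm (θ e : ℤ), h1]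
        calc γ' i (φ e) = γ i e * γ i e * γ' i (φ e) := by rw [(hγ i).mul_self he, one_mul]
          _ = _ := by ring
      · have hei : i = ⟨e, heT⟩ := by
          by_contra h
          exact hnot i ⟨e, heT⟩ (Ne.symm h) he
        subst hei
        have h1 := hγ1 ⟨e, heT⟩
        have h1' := hγ1' ⟨e, heT⟩
        have h2 := hεi ⟨e, heT⟩
        dsimp only at h1 h1' h2
        rw [h1, h1', h2, hηη, mul_one]
    · rw [(hγ i).off e he, (hγ' i).off _ fun h =>
        he ((Function.Injective.mem_set_image φ.injective).1 h), mul_zero]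
  refine ⟨ε, fun A _ x x' hxx' => ?_⟩
  have hcast : ∀ i e, (γ' i (φ e) : A) = ((ε e : ℤ) : A) * ((η i : ℤ) : A) * (γ i e : A) := by
    intro i e
    rw [hkey]
    push_cast
    rfl
  have hεA : ∀ e, ((ε e : ℤ) : A) * ((ε e : ℤ) : A) = 1 := fun e => by
    have := congrArg (Int.cast : ℤ → A) (hεε e)
    simpa only [Int.cast_mul, Int.cast_one] using this
  have hηA : ∀ i, ((η i : ℤ) : A) * ((η i : ℤ) : A) = 1 := fun i => by
    have := congrArg (Int.cast : ℤ → A) (hηη i)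
    simpa only [Int.cast_mul, Int.cast_one] using this
  constructor
  · intro hx
    have : x' = ∑ i : ι, (((η i : ℤ) : A) * x i.1) • fun e => (γ' i e : A) := by
      funext e'
      obtain ⟨e, rfl⟩ := φ.surjective e'
      rw [hxx', hF.eq_sum hx e, Finset.mul_sum, Finset.sum_apply]
      refine Finset.sum_congr rfl fun i _ => ?_
      simp only [Pi.smul_apply, smul_eq_mul, hcast]
      linear_combination (-((ε e : ℤ) : A) * x i.1 * (γ i e : A)) * hηA i
    rw [this]
    exact Submodule.sum_mem _ fun i _ => Submodule.smul_mem _ _ (intCast_mem_homology A (hγ' i).mem)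
  · intro hx'
    have : x = ∑ i : ι, (((η i : ℤ) : A) * x' (φ i.1)) • fun e => (γ i e : A) := by
      funext e
      have h1 := hF'.eq_sum hx' (φ e)
      have h2 : x e = ((ε e : ℤ) : A) * x' (φ e) := by
        rw [hxx', ← mul_assoc, hεA, one_mul]
      rw [h2, h1, Finset.mul_sum, Finset.sum_apply]
      refine Finset.sum_congr rfl fun i _ => ?_
      simp only [Pi.smul_apply, smul_eq_mul, hcast]
      linear_combination (((η i : ℤ) : A) * x' (φ i.1) * (γ i e : A)) * hεA e
    rw [this]
    exact Submodule.sum_mem _ fun i _ => Submodule.smul_mem _ _ (intCast_mem_homology A (hγ i).mem)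

end Signs

end Multigraph

namespace Multigraph

/-- Changing signs on edges turns a bijection of cycles into an isomorphism of flow spaces that
preserves the squares of the values and the integral flows. -/
theorem exists_homology_equiv_of_isCycle_iff {G : Multigraph.{u₁, v₁}} {G' : Multigraph.{u₂, v₂}}
    (φ : G.E ≃ G'.E) (hφ : ∀ S : Set G.E, G.IsCycle S ↔ G'.IsCycle (φ '' S)) :
    ∃ σ : G.homology ℝ ≃ₗ[ℝ] G'.homology ℝ,
      (∀ (x : G.homology ℝ) (e : G.E), (σ x).1 (φ e) ^ 2 = x.1 e ^ 2) ∧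
      ∀ x : G.homology ℝ, (∀ e, ∃ n : ℤ, (σ x).1 e = n) ↔ ∀ e, ∃ n : ℤ, x.1 e = n := by
  obtain ⟨ε, hε⟩ := exists_signs_of_isCycle_iff φ hφ
  have hεε : ∀ e, ((ε e : ℤ) : ℝ) * ((ε e : ℤ) : ℝ) = 1 := fun e => by
    rw [← Int.cast_mul, ← Units.val_mul, Int.units_mul_self, Units.val_one, Int.cast_one]
  let σ : G.homology ℝ ≃ₗ[ℝ] G'.homology ℝ :=
    { toFun := fun x => ⟨fun e' => ((ε (φ.symm e') : ℤ) : ℝ) * x.1 (φ.symm e'),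
        (hε ℝ x.1 _ fun e => by rw [φ.symm_apply_apply]).1 x.2⟩
      invFun := fun x => ⟨fun e => ((ε e : ℤ) : ℝ) * x.1 (φ e),
        (hε ℝ _ x.1 fun e => by rw [← mul_assoc, hεε, one_mul]).2 x.2⟩
      map_add' := fun x y => Subtype.ext (funext fun e' => mul_add _ _ _)
      map_smul' := fun a x => Subtype.ext (funext fun e' => mul_left_comm _ _ _)
      left_inv := fun x => Subtype.ext (funext fun e => by
        dsimp only
        rw [φ.symm_apply_apply, ← mul_assoc, hεε, one_mul])
      right_inv := fun x => Subtype.ext (funext fun e' => by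
        dsimp only
        rw [φ.apply_symm_apply, ← mul_assoc, hεε, one_mul]) }
  have hσ : ∀ x e, (σ x).1 (φ e) = ((ε e : ℤ) : ℝ) * x.1 e := by
    intro x e
    change ((ε (φ.symm (φ e)) : ℤ) : ℝ) * x.1 (φ.symm (φ e)) = _
    rw [φ.symm_apply_apply]
  refine ⟨σ, fun x e => ?_, fun x => ⟨fun h e => ?_, fun h e' => ?_⟩⟩
  · rw [hσ, mul_pow, sq ((ε e : ℤ) : ℝ), hεε, one_mul]
  · obtain ⟨n, hn⟩ := h (φ e)
    rw [hσ] at hn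
    refine ⟨ε e * n, ?_⟩
    rw [Int.cast_mul, ← hn, ← mul_assoc, hεε, one_mul]
  · obtain ⟨e, rfl⟩ := φ.surjective e'
    obtain ⟨n, hn⟩ := h e
    exact ⟨ε e * n, by rw [hσ, hn, Int.cast_mul]⟩

/-! ### Flows modulo two determine the cycles -/

section FlowsModTwo

theorem intCast_zmod_two_eq_iff {a b : ℤ} : (a : ZMod 2) = (b : ZMod 2) ↔ (Odd a ↔ Odd b) := by
  rw [ZMod.intCast_eq_intCast_iff_dvd_sub, ← Int.even_sub', ← even_neg, neg_sub, even_iff_two_dvd]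
  rfl

theorem mem_homology_zmod_two_iff {G : Multigraph.{u, v}} {c : G.E → ZMod 2} :
    c ∈ G.homology (ZMod 2) ↔ ∃ z ∈ G.homology ℤ, ∀ e, c e = (z e : ZMod 2) := by
  constructor
  · intro hc
    obtain ⟨y, hy⟩ := exists_isOrientation_support hc
    refine ⟨y, hy.mem, congrFun (eq_of_support_eq ?_)⟩
    ext e
    exact (hy.intCast_ne_zero_iff (ZMod 2)).symm
  · rintro ⟨z, hz, h⟩
    rw [show c = fun e => (z e : ZMod 2) from funext h]
    exact intCast_mem_homology _ hz

/-- The flows modulo `2` of a contracted graph are the reductions of the integral flows of the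
graph. -/
theorem mem_homology_contractTo_zmod_two_iff {G : Multigraph.{u, v}} {R : Set G.E}
    {c : (G.contractTo R).E → ZMod 2} :
    c ∈ (G.contractTo R).homology (ZMod 2) ↔
      ∃ z ∈ G.homology ℤ, ∀ e : R, c e = (z e.1 : ZMod 2) := by
  constructor
  · intro hc
    obtain ⟨d, hd, hdc⟩ := exists_flow_of_contractTo hc
    obtain ⟨z, hz, hdz⟩ := mem_homology_zmod_two_iff.1 hd
    exact ⟨z, hz, fun e => by rw [← hdc, hdz]⟩
  · rintro ⟨z, hz, h⟩
    have hc := restrict_mem_homology (R := R) (intCast_mem_homology (ZMod 2) hz)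
    have hcz : c = fun e : R => (z e.1 : ZMod 2) := funext h
    exact hcz ▸ hc

theorem IsCycle.image_of_flows {G : Multigraph.{u₁, v₁}} {G' : Multigraph.{u₂, v₂}}
    (φ : G.E ≃ G'.E)
    (hφ : ∀ c : G'.E → ZMod 2, c ∘ φ ∈ G.homology (ZMod 2) ↔ c ∈ G'.homology (ZMod 2))
    {S : Set G.E} (hS : G.IsCycle S) : G'.IsCycle (φ '' S) := by
  obtain ⟨c, hc, hc0, rfl, hmin⟩ := isCycle_iff_minimal.1 hS
  have hsupp : ∀ d : G'.E → ZMod 2, Function.support d = φ '' Function.support (d ∘ φ) := fun d => by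
    rw [Function.support_comp_eq_preimage, Set.image_preimage_eq _ φ.surjective]
  have hcφ : (c ∘ φ.symm) ∘ φ = c := by
    funext e
    simp
  refine isCycle_iff_minimal.2 ⟨c ∘ φ.symm, ?_, ?_, ?_, fun d hd hd0 hdS => ?_⟩
  · rwa [← hφ, hcφ]
  · intro h
    refine hc0 ?_
    rw [← hcφ, h]
    rfl
  · rw [hsupp, hcφ]
  · rw [hsupp d, hmin (d ∘ φ) ((hφ d).2 hd)]
    · intro h
      refine hd0 (funext fun e' => ?_)
      obtain ⟨e, rfl⟩ := φ.surjective e'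
      exact congrFun h e
    · rw [hsupp d] at hdS
      exact (Set.image_subset_image_iff φ.injective).1 hdS

theorem isCycle_image_iff_of_flows {G : Multigraph.{u₁, v₁}} {G' : Multigraph.{u₂, v₂}}
    (φ : G.E ≃ G'.E)
    (hφ : ∀ c : G'.E → ZMod 2, c ∘ φ ∈ G.homology (ZMod 2) ↔ c ∈ G'.homology (ZMod 2))
    (S : Set G.E) : G.IsCycle S ↔ G'.IsCycle (φ '' S) := by
  refine ⟨fun h => h.image_of_flows φ hφ, fun h => ?_⟩
  have := h.image_of_flows φ.symm fun c => by
    rw [← hφ]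
    have : (c ∘ φ.symm) ∘ φ = c := by
      funext e
      simp
    rw [this]
  rwa [← Set.image_comp, show (φ.symm : G'.E → G.E) ∘ φ = id from funext fun e => by simp,
    Set.image_id] at this

end FlowsModTwo

end Multigraph

namespace TropicalCurve

open Multigraph

/-! ### Jacobians and `3`-edge-connectivizations -/

theorem twoIsomorphic_of_isomorphic {C : TropicalCurve.{u₁, v₁}} {C' : TropicalCurve.{u₂, v₂}}
    (h : C.jacobian.Isomorphic C'.jacobian) {R : Set C.E} {R' : Set C'.E}
    (hR : C.toMultigraph.IsC1Transversal R) (hR' : C'.toMultigraph.IsC1Transversal R') :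
    (C.threeEdgeConnectivization R hR).TwoIsomorphic (C'.threeEdgeConnectivization R' hR') := by
  obtain ⟨T, φ, hlen, hpar⟩ := exists_equiv_of_isomorphic h hR hR'
  refine ⟨φ, hlen, isCycle_image_iff_of_flows (G := C.toMultigraph.contractTo R)
    (G' := C'.toMultigraph.contractTo R') φ fun c => ?_⟩
  have h1 := mem_homology_contractTo_zmod_two_iff (G := C.toMultigraph) (R := R) (c := c ∘ φ)
  have h2 := mem_homology_contractTo_zmod_two_iff (G := C'.toMultigraph) (R := R') (c := c)
  refine h1.trans (Iff.trans ⟨?_, ?_⟩ h2.symm)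
  · rintro ⟨z, hz, hcz⟩
    refine ⟨(T ⟨z, hz⟩).1, (T ⟨z, hz⟩).2, fun e' => ?_⟩
    obtain ⟨e, rfl⟩ := φ.surjective e'
    exact (hcz e).trans (intCast_zmod_two_eq_iff.2 (hpar ⟨z, hz⟩ e).symm)
  · rintro ⟨z, hz, hcz⟩
    refine ⟨(T.symm ⟨z, hz⟩).1, (T.symm ⟨z, hz⟩).2, fun e => (hcz (φ e)).trans ?_⟩
    have := hpar (T.symm ⟨z, hz⟩) e
    rw [T.apply_symm_apply] at this
    exact intCast_zmod_two_eq_iff.2 this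

theorem mem_jacLattice_iff (C : TropicalCurve.{u, v}) (x : C.JacSpace) :
    x ∈ C.jacLattice ↔ (∀ e, ∃ n : ℤ, x.1.1 e = n) ∧ ∀ i, ∃ n : ℤ, x.2 i = n := by
  rw [← flow_intCast_iff x.1.2]
  exact and_congr_right fun _ => ⟨fun ⟨m, hm⟩ i => ⟨m i, hm i⟩, fun h =>
    ⟨fun i => (h i).choose, fun i => (h i).choose_spec⟩⟩

/-- Equality of the genera is needed here, since `2`-isomorphism ignores the weights: it makes the
null spaces of the two forms isomorphic. -/
theorem isomorphic_of_twoIsomorphic {C : TropicalCurve.{u₁, v₁}} {C' : TropicalCurve.{u₂, v₂}}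
    (hg : C.genus = C'.genus) {R : Set C.E} {R' : Set C'.E}
    (hR : C.toMultigraph.IsC1Transversal R) (hR' : C'.toMultigraph.IsC1Transversal R')
    (h : (C.threeEdgeConnectivization R hR).TwoIsomorphic (C'.threeEdgeConnectivization R' hR')) :
    C.jacobian.Isomorphic C'.jacobian := by
  obtain ⟨φ, hlen, hcyc⟩ := h
  obtain ⟨ρ, hρ, hρZ⟩ := exists_restrict_equiv (G := C.toMultigraph) (R := R)
    fun S hS => hR.not_isCycle_of_subset_compl C.connected hS
  obtain ⟨ρ', hρ', hρZ'⟩ := exists_restrict_equiv (G := C'.toMultigraph) (R := R')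
    fun S hS => hR'.not_isCycle_of_subset_compl C'.connected hS
  obtain ⟨σ, hσ, hσZ⟩ := exists_homology_equiv_of_isCycle_iff (G := C.toMultigraph.contractTo R)
    (G' := C'.toMultigraph.contractTo R') φ hcyc
  let Φ : C.homology ℝ ≃ₗ[ℝ] C'.homology ℝ := ρ.trans (σ.trans ρ'.symm)
  have hΦρ : ∀ x, ρ' (Φ x) = σ (ρ x) := fun x => ρ'.apply_symm_apply _
  have hΦ : ∀ (x : C.homology ℝ) (e : R), (Φ x).1 (φ e).1 ^ 2 = x.1 e.1 ^ 2 := by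
    intro x e
    rw [← hρ' (Φ x) (φ e), ← hρ x e, ← hσ (ρ x) e, hΦρ]
    rfl
  have hw : C.totalWeight = C'.totalWeight := by
    have h1 : C.toMultigraph.genus = C'.toMultigraph.genus := Φ.finrank_eq
    rw [genus, genus, h1] at hg
    exact Nat.add_left_cancel hg
  have hΦZ : ∀ x : C.homology ℝ,
      (∀ e', ∃ n : ℤ, (Φ x).1 e' = n) ↔ ∀ e, ∃ n : ℤ, x.1 e = n := by
    intro x
    rw [← hρZ, ← hρZ', hΦρ, hσZ]
  let H : C.JacSpace ≃ₗ[ℝ] C'.JacSpace :=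
    Φ.prodCongr (LinearEquiv.funCongrLeft ℝ ℝ (finCongr hw.symm))
  have h1 : ∀ x : C.JacSpace, (H x).1 = Φ x.1 := fun x => rfl
  have h2 : ∀ (x : C.JacSpace) i, (H x).2 i = x.2 (finCongr hw.symm i) := fun x i => rfl
  refine ⟨H, fun (x : C.JacSpace) => ?_, fun (x : C.JacSpace) => ?_⟩
  · change H x ∈ C'.jacLattice ↔ x ∈ C.jacLattice
    rw [mem_jacLattice_iff, mem_jacLattice_iff, h1, hΦZ]
    refine and_congr_right fun _ => ?_
    simp only [h2]
    exact (finCongr hw.symm).forall_congr_right (q := fun i => ∃ n : ℤ, x.2 i = n)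
  · change C'.jacForm (H x) = C.jacForm x
    rw [jacForm_apply, jacForm_apply, h1, C.sum_sq_mul_length_eq hR x.1.2,
      C'.sum_sq_mul_length_eq hR' (Φ x.1).2]
    refine (Fintype.sum_equiv φ _ _ fun e => ?_).symm
    exact congrArg₂ (· * ·) (hΦ x.1 e).symm (hlen e).symm

end TropicalCurve

namespace Multigraph

/-! ### Vertex stars of `3`-connected graphs -/

section Stars

theorem ncard_pair_le_two {α : Type*} (a b : α) : ({a, b} : Set α).ncard ≤ 2 :=
  (Set.ncard_insert_le a {b}).trans (by simp)

variable (G : Multigraph.{u, v})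

/-- The coboundary modulo `2` of a function on the vertices; its support is the cut between the
vertices with value `0` and those with value `1`. -/
def coboundary (f : G.V → ZMod 2) : G.E → ZMod 2 := fun e => f (G.tgt e) - f (G.src e)

/-- A cochain modulo `2` that is orthogonal to all flows, that is, a cut. -/
def IsCut (d : G.E → ZMod 2) : Prop := ∀ c ∈ G.homology (ZMod 2), ∑ e, d e * c e = 0

/-- The star of a vertex, as a cut; loops are not counted. -/
noncomputable def star (w : G.V) : G.E → ZMod 2 := G.coboundary (Pi.single w 1)

/-- A minimal cut whose complement is connected as a matroid: the edges outside it cannot be divided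
into two nonempty parts such that the restriction of every flow to one part is again a flow. This is
phrased in terms of flows alone. In a `3`-connected graph these are the stars of the vertices. -/
structure IsNonseparatingCut (d : G.E → ZMod 2) : Prop where
  isCut : G.IsCut d
  ne_zero : d ≠ 0
  minimal : ∀ d', G.IsCut d' → d' ≠ 0 → Function.support d' ⊆ Function.support d → d' = d
  connected : ∀ B : Set G.E,
    (∀ c ∈ G.homology (ZMod 2), (∀ e, d e ≠ 0 → c e = 0) → B.indicator c ∈ G.homology (ZMod 2)) →
      (∀ e ∈ B, d e ≠ 0) ∨ ∀ e ∉ B, d e ≠ 0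

variable {G}

theorem isCut_coboundary (f : G.V → ZMod 2) : G.IsCut (G.coboundary f) :=
  fun c hc => (G.mem_homology_iff_pairing _ c).1 hc f

/-- The annihilator of the kernel of the boundary map is the range of its dual. -/
theorem IsCut.exists_coboundary {d : G.E → ZMod 2} (hd : G.IsCut d) :
    ∃ f, d = G.coboundary f := by
  let D : Module.Dual (ZMod 2) (G.E → ZMod 2) := ∑ e, d e • LinearMap.proj e
  have hD : ∀ c, D c = ∑ e, d e * c e := fun c => by simp [D, LinearMap.sum_apply]
  have hmem : D ∈ (LinearMap.ker (G.boundary (ZMod 2))).dualAnnihilator := by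
    rw [Submodule.mem_dualAnnihilator]
    intro c hc
    rw [hD]
    exact hd c hc
  rw [← LinearMap.range_dualMap_eq_dualAnnihilator_ker] at hmem
  obtain ⟨F, hF⟩ := hmem
  refine ⟨fun w => F (Pi.single w 1), funext fun e => ?_⟩
  have h1 : D (Pi.single e 1) = d e := by
    rw [hD]
    simp [Pi.single_apply]
  rw [← h1, ← hF, LinearMap.dualMap_apply, boundary_single, map_sub]
  rfl

theorem star_ne_zero_iff {w : G.V} {e : G.E} (he : G.src e ≠ G.tgt e) :
    G.star w e ≠ 0 ↔ G.src e = w ∨ G.tgt e = w := by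
  simp only [star, coboundary, Pi.single_apply]
  by_cases h1 : G.tgt e = w <;> by_cases h2 : G.src e = w
  · exact absurd (h2.trans h1.symm) he
  all_goals simp [h1, h2]

theorem coboundary_ne_zero_iff {f : G.V → ZMod 2} {e : G.E} :
    G.coboundary f e ≠ 0 ↔ f (G.src e) ≠ f (G.tgt e) := by
  rw [coboundary, sub_ne_zero, ne_comm]

theorem coboundary_ne_zero (hG : G.IsConnected) {f : G.V → ZMod 2} {a b : G.V} (hab : f a ≠ f b) :
    G.coboundary f ≠ 0 := by
  intro h
  refine hab ((Joined.iff_of_forall_edge (P := fun w => f a = f w) (fun e _ => ?_) (hG.2 a b)).1 rfl)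
  have : f (G.src e) = f (G.tgt e) := by
    by_contra hne
    exact coboundary_ne_zero_iff.2 hne (congrFun h e)
  rw [this]

theorem star_ne_zero (hG : G.IsConnected) [Nontrivial G.V] (w : G.V) : G.star w ≠ 0 := by
  obtain ⟨b, hb⟩ := exists_ne w
  refine coboundary_ne_zero hG (a := w) (b := b) ?_
  simp [hb]

/-- In a `3`-connected graph, the stars are nonseparating cuts. -/
theorem IsThreeConnected.isNonseparatingCut_star (hG : G.IsConnected) (h3 : G.IsThreeConnected)
    (hloop : ∀ e, G.src e ≠ G.tgt e) [Nontrivial G.V] (w : G.V) :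
    G.IsNonseparatingCut (G.star w) where
  isCut := isCut_coboundary _
  ne_zero := star_ne_zero hG w
  minimal := by
    intro d' hd' hd0 hsub
    obtain ⟨f, rfl⟩ := hd'.exists_coboundary
    -- `f` is constant on the connected graph obtained by removing `w`
    have hconst : ∀ a b, a ≠ w → b ≠ w → f a = f b := by
      intro a b ha hb
      refine (Joined.iff_of_forall_edge (P := fun x => f a = f x) (fun e he => ?_)
        (h3.1 {w} (by simp) a b (by simpa using ha) (by simpa using hb))).1 rfl
      have : f (G.src e) = f (G.tgt e) := by
        by_contra hne
        have h1 := hsub (coboundary_ne_zero_iff.2 hne : e ∈ Function.support (G.coboundary f))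
        rcases (star_ne_zero_iff (hloop e)).1 h1 with h2 | h2
        · exact he.1 h2
        · exact he.2 h2
      rw [this]
    refine eq_of_support_eq (hsub.antisymm fun e he => ?_)
    have hne : ∀ b, b ≠ w → f w ≠ f b := by
      intro b hb heq
      refine hd0 (funext fun e => ?_)
      by_contra h
      refine coboundary_ne_zero_iff.1 h ?_
      have : ∀ x, f x = f w := fun x => by
        by_cases hx : x = w
        · rw [hx]
        · rw [heq, hconst x b hx hb]
      rw [this (G.src e), this (G.tgt e)]
    refine coboundary_ne_zero_iff.2 ?_
    rcases (star_ne_zero_iff (hloop e)).1 he with h | h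
    · rw [h]
      exact hne _ fun h' => hloop e (h.trans h'.symm)
    · rw [h]
      exact (hne _ fun h' => hloop e (h'.trans h.symm)).symm
  connected := by
    intro B hB
    by_contra! hcon
    obtain ⟨⟨a₀, ha₀B, ha₀⟩, b₀, hb₀B, hb₀⟩ := hcon
    have hstar : ∀ e, G.star w e = 0 ↔ G.src e ≠ w ∧ G.tgt e ≠ w := fun e => by
      rw [← not_iff_not, ← Ne.eq_def, star_ne_zero_iff (hloop e), not_and_or, not_not, not_not]
    rw [hstar] at ha₀ hb₀
    -- the graph without `w` is connected, so some vertex `x` meets both parts of its edges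
    obtain ⟨x, hxw, ⟨a, haB, haw, hax⟩, b, hbB, hbw, hbx⟩ : ∃ x, x ≠ w ∧
        (∃ a ∈ B, (G.src a ≠ w ∧ G.tgt a ≠ w) ∧ (G.src a = x ∨ G.tgt a = x)) ∧
        ∃ b ∉ B, (G.src b ≠ w ∧ G.tgt b ≠ w) ∧ (G.src b = x ∨ G.tgt b = x) := by
      by_contra! hx
      let P : G.V → Prop := fun x =>
        ∃ a ∈ B, (G.src a ≠ w ∧ G.tgt a ≠ w) ∧ (G.src a = x ∨ G.tgt a = x)
      have hP : ∀ e, G.src e ≠ w → G.tgt e ≠ w → (P (G.src e) ↔ P (G.tgt e)) := by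
        intro e hs ht
        by_cases heB : e ∈ B
        · exact ⟨fun _ => ⟨e, heB, ⟨hs, ht⟩, Or.inr rfl⟩, fun _ => ⟨e, heB, ⟨hs, ht⟩, Or.inl rfl⟩⟩
        · exact ⟨fun h => absurd rfl (hx _ hs h e heB ⟨hs, ht⟩).1,
            fun h => absurd rfl (hx _ ht h e heB ⟨hs, ht⟩).2⟩
      have hPb : P (G.src b₀) := by
        refine (Joined.iff_of_forall_edge (P := P) (fun e he => hP e ?_ ?_) (h3.1 {w} (by simp)
          (G.src a₀) (G.src b₀) (by simpa using ha₀.1) (by simpa using hb₀.1))).1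
          ⟨a₀, ha₀B, ha₀, Or.inl rfl⟩
        · simpa using he.1
        · simpa using he.2
      exact (hx _ hb₀.1 hPb b₀ hb₀B hb₀).1 rfl
    have hother : ∀ e, (G.src e ≠ w ∧ G.tgt e ≠ w) → (G.src e = x ∨ G.tgt e = x) →
        ∃ y, y ≠ x ∧ y ≠ w ∧
          G.boundary (ZMod 2) (Pi.single e 1) = Pi.single x 1 + Pi.single y 1 := by
      rintro e ⟨hs, ht⟩ (rfl | rfl)
      · refine ⟨G.tgt e, (hloop e).symm, ht, ?_⟩
        rw [boundary_single, CharTwo.sub_eq_add, add_comm]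
      · refine ⟨G.src e, hloop e, hs, ?_⟩
        rw [boundary_single, CharTwo.sub_eq_add]
    obtain ⟨y, hyx, hyw, hya⟩ := hother a haw hax
    obtain ⟨z, hzx, hzw, hzb⟩ := hother b hbw hbx
    -- join the other ends of `a` and `b` away from `w` and `x`: this closes up to a flow
    obtain ⟨k, hk, hkb⟩ := (h3.1 {w, x} (ncard_pair_le_two w x) y z (by simp [hyx, hyw])
      (by simp [hzx, hzw])).exists_chain (ZMod 2)
    have hk' : ∀ e, (G.src e = w ∨ G.tgt e = w ∨ G.src e = x ∨ G.tgt e = x) → k e = 0 := by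
      intro e he
      refine hk e fun h => ?_
      have h1 : G.src e ∉ ({w, x} : Set G.V) := h.1
      have h2 : G.tgt e ∉ ({w, x} : Set G.V) := h.2
      simp only [Set.mem_insert_iff, Set.mem_singleton_iff, not_or] at h1 h2
      tauto
    set c : G.E → ZMod 2 := Pi.single a 1 + Pi.single b 1 + k with hc
    have hcmem : c ∈ G.homology (ZMod 2) := by
      rw [homology, LinearMap.mem_ker, hc, map_add, map_add, hya, hzb, hkb, CharTwo.sub_eq_add]
      funext t
      simp only [Pi.add_apply, Pi.zero_apply]
      have hsum : ∀ p q r : ZMod 2, p + q + (p + r) + (r + q) = 0 := by decide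
      exact hsum _ _ _
    have hab : a ≠ b := fun h => hbB (h ▸ haB)
    have hcB := hB c hcmem fun e he => by
      have he' := (star_ne_zero_iff (hloop e)).1 he
      have hea : e ≠ a := by
        rintro rfl
        tauto
      have heb : e ≠ b := by
        rintro rfl
        tauto
      simp only [hc, Pi.add_apply, Pi.single_eq_of_ne hea, Pi.single_eq_of_ne heb, zero_add]
      exact hk' e (by tauto)
    -- but `a` is the only edge of its restriction to `B` at `x`
    have hpair := (G.mem_homology_iff_pairing _ _).1 hcB (Pi.single x 1)
    rw [Finset.sum_eq_single a] at hpair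
    · have h1 : G.star x a ≠ 0 := (star_ne_zero_iff (hloop a)).2 hax
      have h2 : B.indicator c a = 1 := by
        rw [Set.indicator_of_mem haB]
        have := hk' a (by tauto)
        simp [hc, hab, this]
      rw [h2, mul_one] at hpair
      exact h1 hpair
    · intro e _ hea
      by_cases heB : e ∈ B
      · have heb : e ≠ b := fun h => hbB (h ▸ heB)
        rw [Set.indicator_of_mem heB]
        by_cases hex : G.src e = x ∨ G.tgt e = x
        · have : c e = 0 := by
            simp only [hc, Pi.add_apply, Pi.single_eq_of_ne hea, Pi.single_eq_of_ne heb, zero_add]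
            exact hk' e (by tauto)
          rw [this, mul_zero]
        · rw [not_or] at hex
          rw [Pi.single_eq_of_ne hex.1, Pi.single_eq_of_ne hex.2, sub_zero, zero_mul]
      · rw [Set.indicator_of_notMem heB, mul_zero]
    · simp

/-- Every nonseparating cut of a loopless graph is a star: one of its two sides spans no edge. -/
theorem IsNonseparatingCut.exists_eq_star (hG : G.IsConnected) (hloop : ∀ e, G.src e ≠ G.tgt e)
    [Nontrivial G.V] {d : G.E → ZMod 2} (hd : G.IsNonseparatingCut d) : ∃ w, d = G.star w := by
  obtain ⟨f, rfl⟩ := hd.isCut.exists_coboundary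
  suffices h : ∃ x, ∀ e, (G.src e = x ∨ G.tgt e = x) → f (G.src e) ≠ f (G.tgt e) by
    obtain ⟨x, hx⟩ := h
    refine ⟨x, (hd.minimal _ (isCut_coboundary _) (star_ne_zero hG x) fun e he => ?_).symm⟩
    exact coboundary_ne_zero_iff.2 (hx e ((star_ne_zero_iff (hloop e)).1 he))
  obtain ⟨e₀, he₀⟩ := Function.ne_iff.1 hd.ne_zero
  have he₀ := coboundary_ne_zero_iff.1 he₀
  have hval : ∀ t : ZMod 2, ∃ x, f x = t := by
    intro t
    have : f (G.src e₀) = t ∨ f (G.tgt e₀) = t := by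
      revert he₀
      generalize f (G.src e₀) = p
      generalize f (G.tgt e₀) = q
      revert p q t
      decide
    rcases this with h | h
    exacts [⟨_, h⟩, ⟨_, h⟩]
  have hB := hd.connected {e | f (G.src e) = 1} (by
    intro c hc hcd
    rw [mem_homology_iff_pairing] at hc ⊢
    intro g
    rw [← hc fun x => g x * f x]
    refine Finset.sum_congr rfl fun e _ => ?_
    by_cases he : c e = 0
    · have : Set.indicator {e | f (G.src e) = 1} c e = 0 := by
        rw [Set.indicator_apply, he, ite_self]
      rw [this, he, mul_zero, mul_zero]
    · have hfe : f (G.src e) = f (G.tgt e) := by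
        by_contra h
        exact he (hcd e (coboundary_ne_zero_iff.2 h))
      by_cases h : f (G.src e) = 1
      · rw [Set.indicator_of_mem (show e ∈ {e | f (G.src e) = 1} from h), ← hfe, h, mul_one, mul_one]
      · rw [Set.indicator_of_notMem (show e ∉ {e | f (G.src e) = 1} from h), ← hfe,
          not_not.1 (mt zmod_two_ne_zero.1 h)]
        simp)
  simp only [coboundary_ne_zero_iff] at hB
  rcases hB with hB | hB
  · obtain ⟨x, hx⟩ := hval 1
    refine ⟨x, ?_⟩
    rintro e (rfl | rfl)
    · exact hB e hx
    · intro h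
      exact hB e (h.trans hx) h
  · obtain ⟨x, hx⟩ := hval 0
    refine ⟨x, ?_⟩
    rintro e (rfl | rfl)
    · exact hB e (by simp [hx])
    · intro h
      exact hB e (by simp [h.trans hx]) h

/-- Two vertices of a `3`-connected graph have the same star only if there are no other vertices. -/
theorem IsThreeConnected.eq_or_eq_of_star_eq (h3 : G.IsThreeConnected)
    (hloop : ∀ e, G.src e ≠ G.tgt e) {a b : G.V} (hab : a ≠ b) (hs : G.star a = G.star b)
    (x : G.V) : x = a ∨ x = b := by
  by_contra! hx
  refine hx.2 ((Joined.iff_of_forall_edge (P := fun t => t = b) (fun e he => ?_)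
    (h3.1 {a} (by simp) b x (by simpa using hab.symm) (by simpa using hx.1))).1 rfl)
  have ha : ¬ G.star a e ≠ 0 := by
    rw [star_ne_zero_iff (hloop e)]
    rintro (h | h)
    · exact he.1 h
    · exact he.2 h
  rw [hs, star_ne_zero_iff (hloop e), not_or] at ha
  exact ⟨fun h => absurd h ha.1, fun h => absurd h ha.2⟩

end Stars

/-! ### Whitney's theorem for `3`-connected graphs -/

section Whitney

variable {G : Multigraph.{u₁, v₁}} {G' : Multigraph.{u₂, v₂}}

theorem IsCut.comp (φ : G.E ≃ G'.E)
    (hφ : ∀ c : G'.E → ZMod 2, c ∘ φ ∈ G.homology (ZMod 2) ↔ c ∈ G'.homology (ZMod 2))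
    (d : G'.E → ZMod 2) : G.IsCut (d ∘ φ) ↔ G'.IsCut d := by
  have hsum : ∀ c : G'.E → ZMod 2, ∑ e, (d ∘ φ) e * (c ∘ φ) e = ∑ e, d e * c e := fun c =>
    Fintype.sum_equiv φ _ _ fun e => rfl
  constructor
  · intro h c hc
    rw [← hsum]
    exact h _ ((hφ c).2 hc)
  · intro h c hc
    have hcφ : (c ∘ φ.symm) ∘ φ = c := by
      funext e
      simp
    rw [← hcφ] at hc ⊢
    rw [hsum]
    exact h _ ((hφ _).1 hc)

theorem IsNonseparatingCut.comp (φ : G.E ≃ G'.E)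
    (hφ : ∀ c : G'.E → ZMod 2, c ∘ φ ∈ G.homology (ZMod 2) ↔ c ∈ G'.homology (ZMod 2))
    {d : G'.E → ZMod 2} (hd : G'.IsNonseparatingCut d) : G.IsNonseparatingCut (d ∘ φ) where
  isCut := (IsCut.comp φ hφ d).2 hd.isCut
  ne_zero := by
    intro h
    refine hd.ne_zero (funext fun e' => ?_)
    obtain ⟨e, rfl⟩ := φ.surjective e'
    exact congrFun h e
  minimal := by
    intro d' hd' hd0 hsub
    have hcφ : (d' ∘ φ.symm) ∘ φ = d' := by
      funext e
      simp
    have := hd.minimal (d' ∘ φ.symm) ((IsCut.comp φ hφ _).1 (hcφ.symm ▸ hd')) (fun h => hd0 (by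
      rw [← hcφ, h]
      rfl)) fun e he => by
        have := hsub (show φ.symm e ∈ Function.support d' from he)
        simpa using this
    rw [← this, hcφ]
  connected := by
    intro B hB
    have h := hd.connected (φ '' B) fun c hc hcd => by
      have hind : (φ '' B).indicator c ∘ φ = B.indicator (c ∘ φ) := by
        funext e
        simp only [Function.comp_apply, Set.indicator_apply,
          Function.Injective.mem_set_image φ.injective]
      rw [← hφ, hind]
      exact hB _ ((hφ c).2 hc) fun e he => hcd _ he
    rcases h with h | h
    · exact Or.inl fun e he => h _ (Set.mem_image_of_mem φ he)
    · exact Or.inr fun e he => h _ fun h' => he ((Function.Injective.mem_set_image φ.injective).1 h')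

theorem subsingleton_of_flows (hG' : G'.IsConnected) (φ : G.E ≃ G'.E)
    (hφ : ∀ c : G'.E → ZMod 2, c ∘ φ ∈ G.homology (ZMod 2) ↔ c ∈ G'.homology (ZMod 2))
    [Subsingleton G.V] : Subsingleton G'.V := by
  by_contra h
  have : Nontrivial G'.V := not_subsingleton_iff_nontrivial.1 h
  obtain ⟨w⟩ := hG'.1
  obtain ⟨f, hf⟩ := ((IsCut.comp φ hφ _).2 (isCut_coboundary (Pi.single w 1))).exists_coboundary
  refine star_ne_zero hG' w (funext fun e' => ?_)
  obtain ⟨e, rfl⟩ := φ.surjective e'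
  refine (congrFun hf e).trans ?_
  rw [coboundary, Subsingleton.elim (G.tgt e) (G.src e), sub_self]
  rfl

theorem flows_symm (φ : G.E ≃ G'.E)
    (hφ : ∀ c : G'.E → ZMod 2, c ∘ φ ∈ G.homology (ZMod 2) ↔ c ∈ G'.homology (ZMod 2))
    (c : G.E → ZMod 2) : c ∘ φ.symm ∈ G'.homology (ZMod 2) ↔ c ∈ G.homology (ZMod 2) := by
  rw [← hφ]
  have : (c ∘ φ.symm) ∘ φ = c := by
    funext e
    simp
  rw [this]

/-- If two vertices of `G` have the same star, then `G` has only one nonseparating cut, hence so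
does `G'`. -/
theorem star_injective_of_flows (hG : G.IsConnected) (hG' : G'.IsConnected)
    (h3 : G.IsThreeConnected) (h3' : G'.IsThreeConnected)
    (hl : ∀ e, G.src e ≠ G.tgt e) (hl' : ∀ e, G'.src e ≠ G'.tgt e)
    [Nontrivial G.V] [Nontrivial G'.V] (φ : G.E ≃ G'.E)
    (hφ : ∀ c : G'.E → ZMod 2, c ∘ φ ∈ G.homology (ZMod 2) ↔ c ∈ G'.homology (ZMod 2))
    (hinj : Function.Injective G'.star) : Function.Injective G.star := by
  intro a b hs
  by_contra hab
  have hall := h3.eq_or_eq_of_star_eq hl hab hs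
  have hst : ∀ x, G.star x = G.star a := fun x => by
    rcases hall x with rfl | rfl
    exacts [rfl, hs.symm]
  obtain ⟨p, q, hpq⟩ := exists_pair_ne G'.V
  obtain ⟨x, hx⟩ := ((h3'.isNonseparatingCut_star hG' hl' p).comp φ hφ).exists_eq_star hG hl
  obtain ⟨y, hy⟩ := ((h3'.isNonseparatingCut_star hG' hl' q).comp φ hφ).exists_eq_star hG hl
  refine hpq (hinj (funext fun e' => ?_))
  obtain ⟨e, rfl⟩ := φ.surjective e'
  have := congrFun (hx.trans ((hst x).trans ((hst y).symm.trans hy.symm))) e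
  exact this

theorem card_eq_two_of_star_not_injective (h3 : G.IsThreeConnected)
    (hl : ∀ e, G.src e ≠ G.tgt e) (h : ¬ Function.Injective G.star) : Fintype.card G.V = 2 := by
  rw [Function.Injective] at h
  push Not at h
  obtain ⟨a, b, hs, hab⟩ := h
  rw [← Finset.card_univ, Finset.card_eq_two]
  refine ⟨a, b, hab, ?_⟩
  ext x
  simpa using h3.eq_or_eq_of_star_eq hl hab hs x

/-- A bijection between the edges of two `3`-connected graphs that respects the flows modulo `2` is
induced by an isomorphism: it maps nonseparating cuts, hence stars, to each other. -/
theorem exists_vertex_equiv_of_flows (hG : G.IsConnected) (hG' : G'.IsConnected)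
    (h3 : G.IsThreeConnected) (h3' : G'.IsThreeConnected) (φ : G.E ≃ G'.E)
    (hφ : ∀ c : G'.E → ZMod 2, c ∘ φ ∈ G.homology (ZMod 2) ↔ c ∈ G'.homology (ZMod 2)) :
    ∃ ψ : G.V ≃ G'.V, ∀ e, s(G'.src (φ e), G'.tgt (φ e)) = s(ψ (G.src e), ψ (G.tgt e)) := by
  have hφ' := flows_symm φ hφ
  rcases subsingleton_or_nontrivial G.V with hV | hV
  · have hV' : Subsingleton G'.V := subsingleton_of_flows hG' φ hφ
    obtain ⟨a⟩ := hG.1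
    obtain ⟨a'⟩ := hG'.1
    refine ⟨⟨fun _ => a', fun _ => a, fun _ => Subsingleton.elim _ _,
      fun _ => Subsingleton.elim _ _⟩, fun e => ?_⟩
    rw [Subsingleton.elim (G'.src (φ e)) a', Subsingleton.elim (G'.tgt (φ e)) a']
    rfl
  have hV' : Nontrivial G'.V := by
    rw [← not_subsingleton_iff_nontrivial]
    intro h
    exact not_subsingleton_iff_nontrivial.2 hV (subsingleton_of_flows hG φ.symm hφ')
  have hl := h3.2.resolve_right (not_subsingleton_iff_nontrivial.2 hV)
  have hl' := h3'.2.resolve_right (not_subsingleton_iff_nontrivial.2 hV')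
  by_cases hinj : Function.Injective G'.star
  · have hinj' := star_injective_of_flows hG hG' h3 h3' hl hl' φ hφ hinj
    choose ψ hψ using fun w => ((h3.isNonseparatingCut_star hG hl w).comp φ.symm hφ').exists_eq_star
      hG' hl'
    have hψ' : ∀ w e, G'.star (ψ w) (φ e) = G.star w e := fun w e => by
      rw [← hψ]
      simp
    have hbij : Function.Bijective ψ := by
      constructor
      · intro a b hab
        refine hinj' (funext fun e => ?_)
        rw [← hψ', ← hψ', hab]
      · intro w'
        obtain ⟨w, hw⟩ := ((h3'.isNonseparatingCut_star hG' hl' w').comp φ hφ).exists_eq_star hG hl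
        refine ⟨w, hinj (funext fun e' => ?_)⟩
        obtain ⟨e, rfl⟩ := φ.surjective e'
        rw [hψ', ← hw]
        rfl
    refine ⟨Equiv.ofBijective ψ hbij, fun e => ?_⟩
    rw [Equiv.ofBijective_apply, Equiv.ofBijective_apply]
    have hinc : ∀ w, (G.src e = w ∨ G.tgt e = w) →
        G'.src (φ e) = ψ w ∨ G'.tgt (φ e) = ψ w := by
      intro w hw
      rw [← star_ne_zero_iff (hl' _), hψ', star_ne_zero_iff (hl e)]
      exact hw
    have hne : ψ (G.src e) ≠ ψ (G.tgt e) := fun h => hl e (hbij.1 h)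
    rw [Sym2.eq_iff]
    rcases hinc _ (Or.inl rfl) with h1 | h1 <;> rcases hinc _ (Or.inr rfl) with h2 | h2
    · exact absurd (h1.symm.trans h2) hne
    · exact Or.inl ⟨h1, h2⟩
    · exact Or.inr ⟨h2, h1⟩
    · exact absurd (h1.symm.trans h2) hne
  -- otherwise both graphs have two vertices, and every edge joins them
  · have hinj' : ¬ Function.Injective G.star := fun h =>
      hinj (star_injective_of_flows hG' hG h3' h3 hl' hl φ.symm hφ' h)
    have hc := card_eq_two_of_star_not_injective h3 hl hinj'
    have hc' := card_eq_two_of_star_not_injective h3' hl' hinj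
    obtain ψ : G.V ≃ G'.V := Fintype.equivOfCardEq (hc.trans hc'.symm)
    have hpair : ∀ a b c d : G'.V, a ≠ b → c ≠ d → s(a, b) = s(c, d) := by
      intro a b c d hab hcd
      rw [← Finset.card_univ, Finset.card_eq_two] at hc'
      obtain ⟨p, q, -, hpq⟩ := hc'
      have hmem : ∀ x : G'.V, x = p ∨ x = q := fun x => by
        have := Finset.mem_univ x
        rw [hpq] at this
        simpa using this
      rw [Sym2.eq_iff]
      rcases hmem a with rfl | rfl <;> rcases hmem b with rfl | rfl <;>
        rcases hmem c with rfl | rfl <;> rcases hmem d with rfl | rfl <;> simp_all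
    exact ⟨ψ, fun e => hpair _ _ _ _ (hl' _) fun h => hl e (ψ.injective h)⟩

end Whitney

/-! ### Edge connectivity -/

section EdgeConnectivity

variable {G : Multigraph.{u, v}}

theorem IsThreeEdgeConnected.not_isSeparating (h : G.IsThreeEdgeConnected) (e : G.E) :
    ¬ G.IsSeparating e := by
  rintro ⟨a, b, hab⟩
  exact hab (h {e} (by simp) a b)

theorem IsThreeEdgeConnected.c1Class_eq (h : G.IsThreeEdgeConnected) (e : G.E) :
    G.c1Class e = {e} := by
  ext f
  rw [Set.mem_singleton_iff]
  constructor
  · rintro ⟨-, hf⟩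
    by_contra hfe
    obtain ⟨c, hc, hce, hc0⟩ := exists_flow_of_joined ℤ (S := {e, f}ᶜ) (e := e) (by simp)
      (h {e, f} (ncard_pair_le_two e f) _ _)
    obtain ⟨S, hS, hSc, heS⟩ := exists_isCycle_of_ne_zero hc (e := e) (by simp [hce])
    exact hS ((hf S hSc).1 heS) (hc0 f (by simp) hfe)
  · rintro rfl
    exact ⟨h.not_isSeparating f, fun _ _ => Iff.rfl⟩

theorem IsThreeEdgeConnected.sum_c1Class (h : G.IsThreeEdgeConnected) (l : G.E → ℝ) (e : G.E) :
    ∑ f with f ∈ G.c1Class e, l f = l e := by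
  have : (Finset.univ.filter fun f => f ∈ G.c1Class e) = {e} := by
    ext f
    simp [h.c1Class_eq]
  rw [this, Finset.sum_singleton]

theorem IsThreeEdgeConnected.isC1Transversal_univ (h : G.IsThreeEdgeConnected) :
    G.IsC1Transversal Set.univ := by
  refine ⟨fun e _ => h.not_isSeparating e, ?_⟩
  rintro S ⟨e, -, rfl⟩
  rw [h.c1Class_eq]
  exact ⟨e, ⟨rfl, Set.mem_univ _⟩, fun f hf => hf.1⟩

theorem valenceIn_le_ncard (hl : ∀ e, G.src e ≠ G.tgt e) {F : Set G.E} {x : G.V}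
    (hF : ∀ e, (G.src e = x ∨ G.tgt e = x) → e ∈ F) (S : Set G.E) : G.valenceIn S x ≤ F.ncard := by
  rw [valenceIn, ← Finset.card_union_of_disjoint, Set.ncard_eq_toFinset_card']
  · refine Finset.card_le_card fun e he => ?_
    simp only [Finset.mem_union, Finset.mem_filter, Finset.mem_univ, true_and] at he
    exact Set.mem_toFinset.2 (hF e (he.imp And.right And.right))
  · rw [Finset.disjoint_filter]
    rintro e - ⟨-, h1⟩ ⟨-, h2⟩
    exact hl e (h1.trans h2.symm)

theorem valence_le_ncard (hl : ∀ e, G.src e ≠ G.tgt e) {F : Set G.E} {x : G.V}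
    (hF : ∀ e, (G.src e = x ∨ G.tgt e = x) → e ∈ F) : G.valence x ≤ F.ncard :=
  valenceIn_le_ncard hl hF Set.univ

/-- A `3`-connected graph whose vertices have valence at least `3` is `3`-edge-connected: a cut with
at most two edges has at least two vertices on both sides, so removing one end of each of the two
edges, on different sides, disconnects the graph. -/
theorem IsThreeConnected.isThreeEdgeConnected (h3 : G.IsThreeConnected)
    (hval : ∀ w, 3 ≤ G.valence w) : G.IsThreeEdgeConnected := by
  intro F hF a b
  by_contra hab
  have hV : ¬ Subsingleton G.V := fun h => hab (Subsingleton.elim a b ▸ Relation.EqvGen.refl _)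
  have hl := h3.2.resolve_right hV
  obtain ⟨e₁, e₂, hF'⟩ : ∃ e₁ e₂, F ⊆ {e₁, e₂} := by
    obtain ⟨e, he⟩ : ∃ e : G.E, True := by
      by_contra! h
      have : G.valence a ≤ F.ncard := valence_le_ncard hl fun e => (h e).elim
      have := hval a
      omega
    rcases Nat.lt_or_ge F.ncard 2 with h | h
    · rcases F.eq_empty_or_nonempty with rfl | ⟨e', he'⟩
      · exact ⟨e, e, Set.empty_subset _⟩
      · exact ⟨e', e', fun f hf => Or.inl ((Set.ncard_le_one_iff).1 (by omega) hf he')⟩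
    · obtain ⟨x, y, -, rfl⟩ := Set.ncard_eq_two.1 (le_antisymm hF h)
      exact ⟨x, y, subset_rfl⟩
  -- `K` and its complement are the two sides of the cut
  suffices key : ∀ K : Set G.V, (∀ e ∉ F, G.src e ∈ K ↔ G.tgt e ∈ K) → a ∈ K → b ∉ K → False by
    refine key {x | G.Joined Fᶜ a x} (fun e he => ?_) (Relation.EqvGen.refl _) hab
    have hj : G.Joined Fᶜ (G.src e) (G.tgt e) := Joined.of_edge he
    exact ⟨fun h => Joined.trans h hj, fun h => Joined.trans h hj.symm⟩
  intro K hK ha hb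
  have hone : ∀ L : Set G.V, (∀ e ∉ F, G.src e ∈ L ↔ G.tgt e ∈ L) → ∀ x ∈ L, ∃ p ∈ L, p ≠ x := by
    intro L hL x hx
    by_contra! h
    have : G.valence x ≤ F.ncard := by
      refine valence_le_ncard hl fun e he => ?_
      by_contra heF
      rcases he with rfl | rfl
      · exact hl e (h _ ((hL e heF).1 hx)).symm
      · exact hl e (h _ ((hL e heF).2 hx))
    have := hval x
    omega
  have hend : ∀ (L : Set G.V) (e : G.E), L.Nonempty →
      ∃ x ∈ L, (¬(G.src e ∈ L ↔ G.tgt e ∈ L) → G.src e = x ∨ G.tgt e = x) := by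
    rintro L e ⟨x, hx⟩
    by_cases hs : G.src e ∈ L
    · exact ⟨_, hs, fun _ => Or.inl rfl⟩
    · by_cases ht : G.tgt e ∈ L
      · exact ⟨_, ht, fun _ => Or.inr rfl⟩
      · exact ⟨x, hx, fun h => absurd (iff_of_false hs ht) h⟩
  obtain ⟨x, hx, hxe⟩ := hend K e₁ ⟨a, ha⟩
  obtain ⟨y, hy, hye⟩ := hend Kᶜ e₂ ⟨b, hb⟩
  obtain ⟨p, hp, hpx⟩ := hone K hK x hx
  obtain ⟨q, hq, hqy⟩ := hone Kᶜ (fun e he => not_congr (hK e he)) y hy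
  have hpy : p ≠ y := fun h => hy (h ▸ hp)
  have hqx : q ≠ x := fun h => hq (h ▸ hx)
  refine hq ((Joined.iff_of_forall_edge (P := (· ∈ K)) (fun e he => ?_)
    (h3.1 {x, y} (ncard_pair_le_two x y) p q (by simp [hpx, hpy]) (by simp [hqx, hqy]))).1 hp)
  by_contra hcross
  have h1 : G.src e ∉ ({x, y} : Set G.V) := he.1
  have h2 : G.tgt e ∉ ({x, y} : Set G.V) := he.2
  simp only [Set.mem_insert_iff, Set.mem_singleton_iff, not_or] at h1 h2
  have heF : e ∈ F := by
    by_contra h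
    exact hcross (hK e h)
  rcases hF' heF with rfl | heq
  · have := hxe hcross
    tauto
  · have heq : e = e₂ := heq
    subst heq
    have := hye fun h => hcross (not_iff_not.1 h)
    tauto

end EdgeConnectivity

end Multigraph

namespace TropicalCurve

open Multigraph

/-! ### The Torelli theorem for tropical curves -/

theorem metricIsomorphic_of_isomorphic {C : TropicalCurve.{u₁, v₁}} {C' : TropicalCurve.{u₂, v₂}}
    (h3 : C.toMultigraph.IsThreeConnected) (h3' : C'.toMultigraph.IsThreeConnected)
    (he : C.toMultigraph.IsThreeEdgeConnected) (he' : C'.toMultigraph.IsThreeEdgeConnected)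
    (h : C.jacobian.Isomorphic C'.jacobian) : C.MetricIsomorphic C' := by
  obtain ⟨T, φ, hlen, hpar⟩ :=
    exists_equiv_of_isomorphic h he.isC1Transversal_univ he'.isC1Transversal_univ
  let φ₀ : C.E ≃ C'.E := (Equiv.Set.univ _).symm.trans (φ.trans (Equiv.Set.univ _))
  have hpar' : ∀ (z : C.homology ℤ) e, Odd ((T z).1 (φ₀ e)) ↔ Odd (z.1 e) := fun z e =>
    hpar z ⟨e, Set.mem_univ e⟩
  obtain ⟨ψ, hψ⟩ := exists_vertex_equiv_of_flows C.connected C'.connected h3 h3' φ₀ fun c => by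
    rw [mem_homology_zmod_two_iff, mem_homology_zmod_two_iff]
    constructor
    · rintro ⟨z, hz, hcz⟩
      refine ⟨(T ⟨z, hz⟩).1, (T ⟨z, hz⟩).2, fun e' => ?_⟩
      obtain ⟨e, rfl⟩ := φ₀.surjective e'
      exact (hcz e).trans (intCast_zmod_two_eq_iff.2 (hpar' ⟨z, hz⟩ e).symm)
    · rintro ⟨z, hz, hcz⟩
      refine ⟨(T.symm ⟨z, hz⟩).1, (T.symm ⟨z, hz⟩).2, fun e => (hcz (φ₀ e)).trans ?_⟩
      have := hpar' (T.symm ⟨z, hz⟩) e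
      rw [T.apply_symm_apply] at this
      exact intCast_zmod_two_eq_iff.2 this
  refine ⟨φ₀, ψ, hψ, fun e => ?_⟩
  have := hlen ⟨e, Set.mem_univ e⟩
  rw [he.sum_c1Class, he'.sum_c1Class] at this
  exact this

end TropicalCurve

theorem theorem5p7 (g : ℕ) (C : TropicalCurve.{u₁, v₁}) (C' : TropicalCurve.{u₂, v₂})
    (hC : C.genus = g) (hC' : C'.genus = g) :
    (∀ (R : Set C.E) (R' : Set C'.E) (hR : C.toMultigraph.IsC1Transversal R)
      (hR' : C'.toMultigraph.IsC1Transversal R'),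
      C.jacobian.Isomorphic C'.jacobian ↔
        (C.threeEdgeConnectivization R hR).TwoIsomorphic (C'.threeEdgeConnectivization R' hR')) ∧
    (C.toMultigraph.IsThreeConnected → C'.toMultigraph.IsThreeConnected →
      (∀ v, C.weight v = 0) → (∀ v, C'.weight v = 0) →
      C.jacobian.Isomorphic C'.jacobian → C.Isomorphic C') ∧
    (C.toMultigraph.IsThreeConnected → C'.toMultigraph.IsThreeConnected →
      C.toMultigraph.IsThreeEdgeConnected → C'.toMultigraph.IsThreeEdgeConnected →
      C.jacobian.Isomorphic C'.jacobian → C.MetricIsomorphic C') := by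
  refine ⟨fun R R' hR hR' => ⟨fun h => TropicalCurve.twoIsomorphic_of_isomorphic h hR hR',
    TropicalCurve.isomorphic_of_twoIsomorphic (hC.trans hC'.symm) hR hR'⟩,
    fun h3 h3' hw hw' h => ?_, TropicalCurve.metricIsomorphic_of_isomorphic⟩
  obtain ⟨φ, ψ, hφψ⟩ := TropicalCurve.metricIsomorphic_of_isomorphic h3 h3'
    (h3.isThreeEdgeConnected fun v => C.stable v (hw v))
    (h3'.isThreeEdgeConnected fun v => C'.stable v (hw' v)) h
  exact ⟨φ, ψ, hφψ, fun v => by rw [hw, hw']⟩
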